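/- **Setting.** Let $E,A\in\mathbb R^{c\times n}$, $B\in\mathbb R^{c\times m}$ be arbitrary, let $Q\in\mathbb R^{n\times n}$, $R\in\mathbb R^{m\times m}$ be symmetric positive definite and $Q_0\in\mathbb R^{c\times c}$ symmetric positive semidefinite. An *interval* is a set $\mathbb R$, $[a,\infty)$, $(-\infty,a]$ or $[a,b]$ with $a<b$. $AC(I)$ denotes the functions that are absolutely continuous on every compact subinterval of $I$. A *solution* on $I$ of the DAE-LTI $\frac{d(Ex)}{dt}=Ax+Bu$ is a pair $(x,u)\in L^1_{loc}(I,\mathbb R^n)\times L^1_{loc}(I,\mathbb R^m)$ with $Ex\in AC(I)$ and $Ex(t)=Ex(t_0)+\int_{t_0}^t(Ax+Bu)\,ds$ for all $t_0\le t$ in $I$; $\mathcal B_I$ is the set of solutions on $I$. A vector $z\in\mathbb R^c$ is *differentiably consistent* if $Ex(0)=z$ for some solution on some interval containing $0$. Let $\mathscr D_z(t)$ and $\mathscr D_z(\infty)$ be the sets of solutions on $[0,t]$ and on $[0,\infty)$ with $Ex(0)=z$. Put $$J_t(x,u)=(Ex(t))^TQ_0Ex(t)+\int_0^t(x^TQx+u^TRu)\,ds\in[0,\infty],\qquad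 J_\infty(x,u)=\limsup_{t\to\infty}J_t(x,u),$$ $$J_\infty^*=\limsup_{t\to\infty}\ \inf_{(x,u)\in\mathscr D_z(t)}J_t(x,u).$$ A *solution of the infinite horizon problem* for $z$ is a pair $(x,u)\in\mathscr D_z(\infty)$ with $J_\infty(x,u)=J_\infty^*<\infty$. The DAE-LTI is *behaviorally stabilizable from $z$* if some $(x,u)\in\mathscr D_z(\infty)$ satisfies $x(t)\to0$ as $t\to\infty$. An *ODE-LTI* is a system $\mathscr S$: $\dot p=A_lp+B_lq$, $\nu=C_lp+D_lq$ with $r$ states, $k$ inputs and $n+m$ outputs; its trajectories on $I$ are the pairs $p\in AC(I)$, $q\in L^1_{loc}(I)$ satisfying the differential equation a.e. Let $C_s,D_s$ be the first $n$ rows of $C_l,D_l$. $\mathscr S$ is *associated* with the DAE-LTI if $r\le n$; either $D_l=0$, $B_l=0$, $k=1$, or $\operatorname{rank}D_l=k$; $ED_s=0$; $\operatorname{rank}EC_s=r$; and for every interval $I$ the outputs of $\mathscr S$ on $I$ are, up to modification on null sets, exactly the elements of $\mathcal B_I$. Its *state map* is the Moore–Penrose inverse $\mathcal M=(EC_s)^+$.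 Its *stabilizability subspace* $\mathcal V_g$ is the set of all $p(0)$ of trajectories $(p,q)$ on $[0,\infty)$ with $p(t)\to0$. Let $l=\dim\mathcal V_g$ and let $T$ be an invertible matrix mapping $\mathcal V_g$ onto the span of the first $l$ coordinate vectors. The *stabilizable associated ODE-LTI* $(A_g,B_g,C_g,D_g)$ consists of the upper left $l\times l$ block $A_g$ of $TA_lT^{-1}$, the first $l$ rows $B_g$ of $TB_l$, the first $l$ columns $C_g$ of $C_lT^{-1}$, and $D_g=D_l$; its state map is $\mathcal M_g=[I_l\ 0]\,T\mathcal M$. With $S=\operatorname{diag}(Q,R)$, its algebraic Riccati equation (ARE) is $$0=PA_g+A_g^TP-K^T(D_g^TSD_g)K+C_g^TSC_g,\qquad K=\begin{cases}(D_g^TSD_g)^{-1}(B_g^TP+D_g^TSC_g)&\text{if }D_g\ne0,\\0&\text{if }D_g=0.\end{cases}$$ **Theorem.** Let $z$ be differentiably consistent. The following are equivalent: (i) the infinite horizon problem for $z$ has a solution; (ii) the DAE-LTI is behaviorally stabilizable from $z$; (iii) $J_\infty^*<\infty$. Moreover, associated ODE-LTIs exist, and for each of them a matrix $T$ as above exists.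 For every choice of $\mathscr S$ and $T$, the ARE has a unique symmetric positive definite solution $P$. Let $K$ be the corresponding gain, let $v^*$ be the solution of $\dot v^*=(A_g-B_gK)v^*$ on $[0,\infty)$, $v^*(0)=\mathcal M_gz$, and let $\begin{bmatrix}x^*\\u^*\end{bmatrix}=(C_g-D_gK)v^*$. If one of (i)–(iii) holds, then: 1. $(x^*,u^*)$ is a solution of the infinite horizon problem for $z$, and $J_\infty^*=J_\infty(x^*,u^*)=(\mathcal M_gz)^TP\,\mathcal M_gz$; 2. $u^*(t)=K_fx^*(t)$ for all $t\ge 0$, where $K_f=(C_u-D_uK)\mathcal M_gE$ and $C_u,D_u$ are the last $m$ rows of $C_g,D_g$; 3. with $K_1=(C_g-D_gK)\mathcal M_gE-\begin{bmatrix}I_n\\0\end{bmatrix}$ and $K_2=\begin{bmatrix}0\\-I_m\end{bmatrix}$, the pair $(x^*,u^*)$ is a solution on $[0,\infty)$ of $$\frac{d(Ex)}{dt}=Ax+Bu,\qquad K_1x+K_2u=0\ \text{ a.e.},$$ with $Ex^*(0)=z$, and every solution $(x,u)$ of this system on $[0,\infty)$ with $Ex(0)=z$ satisfies $(x,u)=(x^*,u^*)$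 a.e. -/

import Mathlib

open MeasureTheory Filter Topology Matrix
open scoped ENNReal

namespace DaeLQ

noncomputable section

/-- Time intervals: `ℝ`, `[a, ∞)`, `(-∞, a]`, or `[a, b]` with `a < b`. -/
def IsTimeInterval (I : Set ℝ) : Prop :=
  I = Set.univ ∨ (∃ a, I = Set.Ici a) ∨ (∃ a, I = Set.Iic a) ∨ ∃ a b, a < b ∧ I = Set.Icc a b

/-- Membership in `AC(I)`: absolute continuity on every compact subinterval of `I`. -/
def LocallyAC {d : ℕ} (f : ℝ → Fin d → ℝ) (I : Set ℝ) : Prop :=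
  ∀ a b : ℝ, a ≤ b → Set.Icc a b ⊆ I → AbsolutelyContinuousOnInterval f a b

/-- `(x, u)` is a solution of `d(Ex)/dt = Ax + Bu` on `I`; functions on `I` are represented by
functions on `ℝ` whose values outside `I` are irrelevant. -/
structure IsSolution {c n m : ℕ} (E A : Matrix (Fin c) (Fin n) ℝ) (B : Matrix (Fin c) (Fin m) ℝ)
    (I : Set ℝ) (x : ℝ → Fin n → ℝ) (u : ℝ → Fin m → ℝ) : Prop where
  state_locallyIntegrable : LocallyIntegrableOn x I
  input_locallyIntegrable : LocallyIntegrableOn u I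
  absolutelyContinuous : LocallyAC (fun t => E *ᵥ x t) I
  integral_eq : ∀ t₀ ∈ I, ∀ t ∈ I, t₀ ≤ t →
    E *ᵥ x t = E *ᵥ x t₀ + ∫ s in t₀..t, (A *ᵥ x s + B *ᵥ u s)

/-- `z` is differentiably consistent: `z ∈ 𝒱(E, A, B)`. -/
def DifferentiablyConsistent {c n m : ℕ} (E A : Matrix (Fin c) (Fin n) ℝ)
    (B : Matrix (Fin c) (Fin m) ℝ) (z : Fin c → ℝ) : Prop :=
  ∃ I : Set ℝ, IsTimeInterval I ∧ (0 : ℝ) ∈ I ∧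
    ∃ x u, IsSolution E A B I x u ∧ E *ᵥ x 0 = z

/-- `(x, u)` is a solution on `I` with `Ex(0) = z`. For `I = [0, t]` and `I = [0, ∞)` these are the
members of `𝒟_z(t)` and `𝒟_z(∞)`. -/
def IsSolutionFrom {c n m : ℕ} (E A : Matrix (Fin c) (Fin n) ℝ) (B : Matrix (Fin c) (Fin m) ℝ)
    (I : Set ℝ) (z : Fin c → ℝ) (x : ℝ → Fin n → ℝ) (u : ℝ → Fin m → ℝ) : Prop :=
  IsSolution E A B I x u ∧ E *ᵥ x 0 = z

/-! ### The linear quadratic problems -/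

/-- The cost on `[0, t]`, an element of `[0, ∞]`. -/
def cost {c n m : ℕ} (E : Matrix (Fin c) (Fin n) ℝ) (Q : Matrix (Fin n) (Fin n) ℝ)
    (R : Matrix (Fin m) (Fin m) ℝ) (Q₀ : Matrix (Fin c) (Fin c) ℝ)
    (t : ℝ) (x : ℝ → Fin n → ℝ) (u : ℝ → Fin m → ℝ) : ℝ≥0∞ :=
  ENNReal.ofReal ((E *ᵥ x t) ⬝ᵥ (Q₀ *ᵥ (E *ᵥ x t))) +
    ∫⁻ s in Set.Icc 0 t, ENNReal.ofReal (x s ⬝ᵥ (Q *ᵥ x s) + u s ⬝ᵥ (R *ᵥ u s))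

/-- `J_∞(x, u)`, the upper limit of the costs on `[0, t]`. -/
def costInf {c n m : ℕ} (E : Matrix (Fin c) (Fin n) ℝ) (Q : Matrix (Fin n) (Fin n) ℝ)
    (R : Matrix (Fin m) (Fin m) ℝ) (Q₀ : Matrix (Fin c) (Fin c) ℝ)
    (x : ℝ → Fin n → ℝ) (u : ℝ → Fin m → ℝ) : ℝ≥0∞ :=
  limsup (fun t : ℝ => cost E Q R Q₀ t x u) atTop

/-- The infimal cost over `𝒟_z(t)`. -/
def optCost {c n m : ℕ} (E A : Matrix (Fin c) (Fin n) ℝ) (B : Matrix (Fin c) (Fin m) ℝ)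
    (Q : Matrix (Fin n) (Fin n) ℝ) (R : Matrix (Fin m) (Fin m) ℝ) (Q₀ : Matrix (Fin c) (Fin c) ℝ)
    (z : Fin c → ℝ) (t : ℝ) : ℝ≥0∞ :=
  ⨅ (x : ℝ → Fin n → ℝ) (u : ℝ → Fin m → ℝ)
    (_ : IsSolutionFrom E A B (Set.Icc 0 t) z x u), cost E Q R Q₀ t x u

/-- `J_∞^*`, the upper limit of the infimal costs over the finite horizons. -/
def optCostInf {c n m : ℕ} (E A : Matrix (Fin c) (Fin n) ℝ) (B : Matrix (Fin c) (Fin m) ℝ)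
    (Q : Matrix (Fin n) (Fin n) ℝ) (R : Matrix (Fin m) (Fin m) ℝ) (Q₀ : Matrix (Fin c) (Fin c) ℝ)
    (z : Fin c → ℝ) : ℝ≥0∞ :=
  limsup (fun t : ℝ => optCost E A B Q R Q₀ z t) atTop

/-- `(x, u)` solves the infinite horizon optimal control problem for the initial state `z`. -/
def IsOptimal {c n m : ℕ} (E A : Matrix (Fin c) (Fin n) ℝ) (B : Matrix (Fin c) (Fin m) ℝ)
    (Q : Matrix (Fin n) (Fin n) ℝ) (R : Matrix (Fin m) (Fin m) ℝ) (Q₀ : Matrix (Fin c) (Fin c) ℝ)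
    (z : Fin c → ℝ) (x : ℝ → Fin n → ℝ) (u : ℝ → Fin m → ℝ) : Prop :=
  IsSolutionFrom E A B (Set.Ici 0) z x u ∧
    costInf E Q R Q₀ x u = optCostInf E A B Q R Q₀ z ∧ optCostInf E A B Q R Q₀ z < ⊤

/-- The infinite horizon optimal control problem is solvable for `z`. -/
def Solvable {c n m : ℕ} (E A : Matrix (Fin c) (Fin n) ℝ) (B : Matrix (Fin c) (Fin m) ℝ)
    (Q : Matrix (Fin n) (Fin n) ℝ) (R : Matrix (Fin m) (Fin m) ℝ) (Q₀ : Matrix (Fin c) (Fin c) ℝ)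
    (z : Fin c → ℝ) : Prop :=
  ∃ x u, IsOptimal E A B Q R Q₀ z x u

/-- Behavioral stabilizability from `z`. -/
def BehaviorallyStabilizable {c n m : ℕ} (E A : Matrix (Fin c) (Fin n) ℝ)
    (B : Matrix (Fin c) (Fin m) ℝ) (z : Fin c → ℝ) : Prop :=
  ∃ x u, IsSolutionFrom E A B (Set.Ici 0) z x u ∧ Tendsto x atTop (𝓝 0)

/-! ### Associated ODE-LTIs -/

/-- An ODE-LTI `ṗ = Ap + Bq`, `ν = Cp + Dq` with `r` states, `k` inputs and `n + m` outputs. -/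
structure OdeLti (r k n m : ℕ) where
  A : Matrix (Fin r) (Fin r) ℝ
  B : Matrix (Fin r) (Fin k) ℝ
  C : Matrix (Fin n ⊕ Fin m) (Fin r) ℝ
  D : Matrix (Fin n ⊕ Fin m) (Fin k) ℝ

namespace OdeLti

variable {r k n m : ℕ}

/-- `p ∈ AC(I)`, `q ∈ L¹_loc(I)` and `ṗ = Ap + Bq` almost everywhere on `I`. -/
def IsTrajectory (S : OdeLti r k n m) (I : Set ℝ) (p : ℝ → Fin r → ℝ) (q : ℝ → Fin k → ℝ) :
    Prop :=
  LocallyAC p I ∧ LocallyIntegrableOn q I ∧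
    ∀ᵐ t ∂(volume.restrict I), HasDerivAt p (S.A *ᵥ p t + S.B *ᵥ q t) t

/-- `S` is a realization of the behavior `ℬ_I(E, A, B)`. -/
def IsRealization {c : ℕ} (S : OdeLti r k n m) (E A : Matrix (Fin c) (Fin n) ℝ)
    (B : Matrix (Fin c) (Fin m) ℝ) (I : Set ℝ) : Prop :=
  (∀ x u, IsSolution E A B I x u → ∃ p q, S.IsTrajectory I p q ∧
      ∀ᵐ t ∂(volume.restrict I), Sum.elim (x t) (u t) = S.C *ᵥ p t + S.D *ᵥ q t) ∧
  (∀ p q, S.IsTrajectory I p q → ∃ x u, IsSolution E A B I x u ∧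
      ∀ᵐ t ∂(volume.restrict I), Sum.elim (x t) (u t) = S.C *ᵥ p t + S.D *ᵥ q t)

/-- `S` is an ODE-LTI associated with the DAE-LTI `d(Ex)/dt = Ax + Bu`. -/
structure IsAssociated {c : ℕ} (S : OdeLti r k n m) (E A : Matrix (Fin c) (Fin n) ℝ)
    (B : Matrix (Fin c) (Fin m) ℝ) : Prop where
  dim_le : r ≤ n
  feedthrough : (S.D = 0 ∧ S.B = 0 ∧ k = 1) ∨ S.D.rank = k
  mul_feedthrough : E * S.D.toRows₁ = 0
  rank_output : (E * S.C.toRows₁).rank = r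
  realization : ∀ I, IsTimeInterval I → S.IsRealization E A B I

/-- The stabilizability subspace: the initial states that some input steers to zero. -/
def stabilizabilitySubspace (S : OdeLti r k n m) : Set (Fin r → ℝ) :=
  {p₀ | ∃ p q, S.IsTrajectory (Set.Ici 0) p q ∧ p 0 = p₀ ∧ Tendsto p atTop (𝓝 0)}

/-- `T` is a change of basis, with inverse `T'`, that maps the stabilizability subspace of `S`
onto the span of the first `l` coordinate vectors. -/
def IsStabilizabilityBasis {l l' : ℕ} (S : OdeLti r k n m)
    (T : Matrix (Fin l ⊕ Fin l') (Fin r) ℝ) (T' : Matrix (Fin r) (Fin l ⊕ Fin l') ℝ) : Prop :=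
  T * T' = 1 ∧ T' * T = 1 ∧
    (fun p => T *ᵥ p) '' S.stabilizabilitySubspace = {y | ∀ j : Fin l', y (Sum.inr j) = 0}

/-- The stabilizable ODE-LTI `(A_g, B_g, C_g, D_g)` obtained from `S` by the change of basis `T`
with inverse `T'`. -/
def stabilizablePart {l l' : ℕ} (S : OdeLti r k n m)
    (T : Matrix (Fin l ⊕ Fin l') (Fin r) ℝ) (T' : Matrix (Fin r) (Fin l ⊕ Fin l') ℝ) :
    OdeLti l k n m where
  A := (T * S.A * T').toBlocks₁₁
  B := (T * S.B).toRows₁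
  C := (S.C * T').toCols₁
  D := S.D

end OdeLti

/-! ### State maps -/

/-- The Moore-Penrose inverse of a matrix of full column rank. -/
def pinv {a b : ℕ} (X : Matrix (Fin a) (Fin b) ℝ) : Matrix (Fin b) (Fin a) ℝ :=
  (Xᵀ * X)⁻¹ * Xᵀ

/-- The four Penrose equations: `Y` is the Moore-Penrose inverse of `X`. -/
structure IsMoorePenrose {a b : ℕ} (X : Matrix (Fin a) (Fin b) ℝ) (Y : Matrix (Fin b) (Fin a) ℝ) :
    Prop where
  mul_mul_left : X * Y * X = X
  mul_mul_right : Y * X * Y = Y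
  symm_left : (X * Y)ᵀ = X * Y
  symm_right : (Y * X)ᵀ = Y * X

theorem pinv_mul_self {a b : ℕ} (X : Matrix (Fin a) (Fin b) ℝ) (h : X.rank = b) :
    pinv X * X = 1 := by
  have hu : IsUnit (Xᵀ * X) := by
    rw [← Matrix.mulVec_injective_iff_isUnit, ← Matrix.coe_mulVecLin,
      LinearMap.injective_iff_surjective, ← LinearMap.range_eq_top]
    apply Submodule.eq_top_of_finrank_eq
    have := Matrix.rank_transpose_mul_self X
    rw [h] at this
    simpa [Matrix.rank] using this
  rw [pinv, Matrix.mul_assoc]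
  exact Matrix.nonsing_inv_mul _ ((Matrix.isUnit_iff_isUnit_det _).1 hu)

theorem pinv_isMoorePenrose {a b : ℕ} (X : Matrix (Fin a) (Fin b) ℝ) (h : X.rank = b) :
    IsMoorePenrose X (pinv X) where
  mul_mul_left := by rw [Matrix.mul_assoc, pinv_mul_self X h, Matrix.mul_one]
  mul_mul_right := by rw [pinv_mul_self X h, Matrix.one_mul]
  symm_left := by
    simp [pinv, Matrix.transpose_mul, Matrix.transpose_nonsing_inv, Matrix.mul_assoc]
  symm_right := by rw [pinv_mul_self X h, Matrix.transpose_one]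

theorem IsMoorePenrose.eq_pinv {a b : ℕ} {X : Matrix (Fin a) (Fin b) ℝ} (h : X.rank = b)
    {Y : Matrix (Fin b) (Fin a) ℝ} (hY : IsMoorePenrose X Y) : Y = pinv X := by
  have h1 : Y * X = 1 := by
    have := congrArg (pinv X * ·) hY.mul_mul_left
    simpa [← Matrix.mul_assoc, pinv_mul_self X h] using this
  have h2 : X * Y = X * pinv X := by
    have hP := pinv_isMoorePenrose X h
    calc X * Y = (X * pinv X) * (X * Y) := by
          rw [← Matrix.mul_assoc, hP.mul_mul_left]
      _ = ((X * Y) * (X * pinv X))ᵀ := by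
          rw [Matrix.transpose_mul, hY.symm_left, hP.symm_left]
      _ = (X * pinv X)ᵀ := by rw [← Matrix.mul_assoc, hY.mul_mul_left]
      _ = X * pinv X := hP.symm_left
  calc Y = Y * (X * Y) := by rw [← Matrix.mul_assoc, hY.mul_mul_right]
    _ = pinv X := by rw [h2, ← Matrix.mul_assoc, h1, Matrix.one_mul]

/-- The state map `𝓜 = (E C_s)⁺`, where `C_s` consists of the first `n` rows of `C`. -/
def stateMap {c r k n m : ℕ} (E : Matrix (Fin c) (Fin n) ℝ) (S : OdeLti r k n m) :
    Matrix (Fin r) (Fin c) ℝ :=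
  pinv (E * S.C.toRows₁)

/-- The state map `𝓜_g = [I_l 0] T 𝓜` of the stabilizable associated ODE-LTI. -/
def stabilizableStateMap {c r k n m l l' : ℕ} (E : Matrix (Fin c) (Fin n) ℝ) (S : OdeLti r k n m)
    (T : Matrix (Fin l ⊕ Fin l') (Fin r) ℝ) : Matrix (Fin l) (Fin c) ℝ :=
  (T * stateMap E S).toRows₁

/-! ### The algebraic Riccati equation and the optimal controller -/

/-- `S = diag(Q, R)`. -/
def weight {n m : ℕ} (Q : Matrix (Fin n) (Fin n) ℝ) (R : Matrix (Fin m) (Fin m) ℝ) :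
    Matrix (Fin n ⊕ Fin m) (Fin n ⊕ Fin m) ℝ :=
  Matrix.fromBlocks Q 0 0 R

open Classical in
/-- The gain `K` of the algebraic Riccati equation as a function of `P`. -/
def gain {l k n m : ℕ} (G : OdeLti l k n m) (Q : Matrix (Fin n) (Fin n) ℝ)
    (R : Matrix (Fin m) (Fin m) ℝ) (P : Matrix (Fin l) (Fin l) ℝ) : Matrix (Fin k) (Fin l) ℝ :=
  if G.D = 0 then 0
  else (G.Dᵀ * weight Q R * G.D)⁻¹ * (G.Bᵀ * P + G.Dᵀ * weight Q R * G.C)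

/-- `P` solves the algebraic Riccati equation of `G`. -/
def IsRiccatiSolution {l k n m : ℕ} (G : OdeLti l k n m) (Q : Matrix (Fin n) (Fin n) ℝ)
    (R : Matrix (Fin m) (Fin m) ℝ) (P : Matrix (Fin l) (Fin l) ℝ) : Prop :=
  P * G.A + G.Aᵀ * P
    - (gain G Q R P)ᵀ * (G.Dᵀ * weight Q R * G.D) * gain G Q R P
    + G.Cᵀ * weight Q R * G.C = 0

/-- `v̇ = (A_g - B_g K) v` on `[0, ∞)` and `v(0) = v₀`. -/
def IsClosedLoop {l k n m : ℕ} (G : OdeLti l k n m) (K : Matrix (Fin k) (Fin l) ℝ)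
    (v₀ : Fin l → ℝ) (v : ℝ → Fin l → ℝ) : Prop :=
  v 0 = v₀ ∧ ∀ t, 0 ≤ t → HasDerivWithinAt v ((G.A - G.B * K) *ᵥ v t) (Set.Ici 0) t

/-- `x^* = (C_s - D_s K) v`. -/
def closedLoopState {l k n m : ℕ} (G : OdeLti l k n m) (K : Matrix (Fin k) (Fin l) ℝ)
    (v : ℝ → Fin l → ℝ) : ℝ → Fin n → ℝ :=
  fun t => (G.C.toRows₁ - G.D.toRows₁ * K) *ᵥ v t

/-- `u^* = (C_u - D_u K) v`. -/
def closedLoopInput {l k n m : ℕ} (G : OdeLti l k n m) (K : Matrix (Fin k) (Fin l) ℝ)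
    (v : ℝ → Fin l → ℝ) : ℝ → Fin m → ℝ :=
  fun t => (G.C.toRows₂ - G.D.toRows₂ * K) *ᵥ v t

/-- `K_f = (C_u - D_u K) 𝓜_g E`. -/
def feedbackMatrix {c l k n m : ℕ} (E : Matrix (Fin c) (Fin n) ℝ) (G : OdeLti l k n m)
    (Mg : Matrix (Fin l) (Fin c) ℝ) (K : Matrix (Fin k) (Fin l) ℝ) : Matrix (Fin m) (Fin n) ℝ :=
  (G.C.toRows₂ - G.D.toRows₂ * K) * Mg * E

/-- `K₁ = (C_g - D_g K) 𝓜_g E - [I; 0]`. -/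
def constraintState {c l k n m : ℕ} (E : Matrix (Fin c) (Fin n) ℝ) (G : OdeLti l k n m)
    (Mg : Matrix (Fin l) (Fin c) ℝ) (K : Matrix (Fin k) (Fin l) ℝ) :
    Matrix (Fin n ⊕ Fin m) (Fin n) ℝ :=
  (G.C - G.D * K) * Mg * E - Matrix.fromRows 1 0

/-- `K₂ = [0; -I]`. -/
def constraintInput (n m : ℕ) : Matrix (Fin n ⊕ Fin m) (Fin m) ℝ :=
  Matrix.fromRows 0 (-1)

/-- `(x, u)` is a solution on `[0, ∞)`, with `Ex(0) = z`, of the DAE-LTI augmented with the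
algebraic constraint `K₁ x + K₂ u = 0`, which is to hold almost everywhere. -/
def IsConstrainedSolutionFrom {c n m : ℕ} (E A : Matrix (Fin c) (Fin n) ℝ)
    (B : Matrix (Fin c) (Fin m) ℝ) (K₁ : Matrix (Fin n ⊕ Fin m) (Fin n) ℝ)
    (K₂ : Matrix (Fin n ⊕ Fin m) (Fin m) ℝ) (z : Fin c → ℝ)
    (x : ℝ → Fin n → ℝ) (u : ℝ → Fin m → ℝ) : Prop :=
  IsSolutionFrom E A B (Set.Ici 0) z x u ∧
    ∀ᵐ t ∂(volume.restrict (Set.Ici (0 : ℝ))), K₁ *ᵥ x t + K₂ *ᵥ u t = 0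

end

end DaeLQ

open DaeLQ

/-!
The theorem is a linear quadratic regulator result for the ODE-LTI `(A_g, B_g, C_g, D_g)`, carried
over to the DAE-LTI. Everything needed about that system is condensed in `OdeLti.IsRegular`: its
state is a linear function of its output, so that the running cost controls the state whatever the
input is (`exists_coercive`), and an input invisible in the output does not act at all.

*Associated systems exist* (`exists_isAssociated`). Almost all values of a solution `(x, u)` lie in
the largest subspace `V` with `[A B] V ⊆ [E 0] V`: a smallest subspace containing almost all values
has this property, because `E x` and hence its derivative stay in a subspace. Coordinates on `V`,
chosen so that `E x` determines the state, give the system.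

*The Riccati equation.* Completion of the square (`complete_square`) shows that the Riccati residual
of `P` is the minimum over all feedbacks of the Lyapunov residuals. Combined with the fact that the
Lyapunov operator of a system with a strict Lyapunov matrix reverses signs
(`quad_nonneg_of_lyap_nonpos`), this gives uniqueness. It also gives existence as soon as there is
an upper solution, by minimizing the trace: a Kleinman step would decrease it
(`exists_riccati_of_upper`). Upper solutions are found by lowering a discount rate in steps of fixed
size (`exists_riccati_of_trace_bound`), where the step size depends on an a priori bound for lower
solutions that stabilizability provides (`exists_trace_bound`).

*Optimality.* Let `v₀ = 𝓜_g z`. The closed loop has cost `⟨v₀, P v₀⟩` and tends to zero. A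
trajectory over a horizon `t` may end anywhere, but as its cost bounds the integral of `⟨v, P v⟩`,
that form is small at some time, whence the lower bound `⟨v₀, P v₀⟩ t / (κ + t)` for the cost
(`exists_cost_lower_bound`). Both bounds agree in the limit (`optCostInf_eq`).

*Equivalence of the conditions.* Each of them amounts to `𝓜 z` being in the stabilizability
subspace. The only substantial implication starts from finite optimal cost: the component of the
state transverse to that subspace evolves autonomously, so that it is the same for all horizons and
square integrable (`exists_transverse_bound`). Fed as a disturbance into the optimal closed loop of
the stabilizable part, it leaves the whole state square integrable, and a square integrable solution
of a linear equation tends to zero (`mem_of_transverse_bound`).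

*Inputs in `L¹`.* An integrable input may have infinite cost. Wherever a finite cost is needed, the
input is replaced by a continuous one with the same effect on the final state
(`exists_smooth_same_endpoint`); by duality with the adjoint equation continuous inputs reach
everything that integrable ones reach (`mem_reachable`). The same duality shows that the range of
`B` is stabilizable, which makes the transverse component autonomous.
-/

namespace DaeLQ

/-! ### Quadratic forms and the Lyapunov operator -/

theorem _root_.Matrix.PosSemidef.transpose_eq {ι : Type*} {P : Matrix ι ι ℝ}
    (hP : P.PosSemidef) : Pᵀ = P := by
  simpa [Matrix.IsHermitian] using hP.isHermitian

section Lyapunov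

variable {ι κ : Type*} [Fintype ι] [Fintype κ]

theorem dotProduct_transpose_mulVec (X : Matrix κ ι ℝ) (v : ι → ℝ) (w : κ → ℝ) :
    v ⬝ᵥ (Xᵀ *ᵥ w) = (X *ᵥ v) ⬝ᵥ w := by
  rw [Matrix.dotProduct_mulVec, Matrix.vecMul_transpose]

theorem dotProduct_conj_mulVec (X : Matrix κ ι ℝ) (M : Matrix κ κ ℝ) (v : ι → ℝ) :
    v ⬝ᵥ ((Xᵀ * M * X) *ᵥ v) = (X *ᵥ v) ⬝ᵥ (M *ᵥ (X *ᵥ v)) := by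
  rw [← Matrix.mulVec_mulVec, ← Matrix.mulVec_mulVec, dotProduct_transpose_mulVec]

theorem dotProduct_mulVec_symm {P : Matrix ι ι ℝ} (hP : Pᵀ = P) (v w : ι → ℝ) :
    v ⬝ᵥ (P *ᵥ w) = (P *ᵥ v) ⬝ᵥ w := by
  conv_lhs => rw [← hP]
  exact dotProduct_transpose_mulVec P v w

theorem dotProduct_self_pos {v : ι → ℝ} (hv : v ≠ 0) : 0 < v ⬝ᵥ v := by
  refine lt_of_le_of_ne ?_ fun h => hv (dotProduct_self_eq_zero.1 h.symm)
  exact Finset.sum_nonneg fun _ _ => mul_self_nonneg _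

theorem zero_le_dotProduct_self (v : ι → ℝ) : 0 ≤ v ⬝ᵥ v :=
  Finset.sum_nonneg fun _ _ => mul_self_nonneg _

theorem posSemidef_of_forall {P : Matrix ι ι ℝ} (hP : Pᵀ = P) (h : ∀ v, 0 ≤ v ⬝ᵥ (P *ᵥ v)) :
    P.PosSemidef :=
  .of_dotProduct_mulVec_nonneg (by simpa [Matrix.IsHermitian] using hP)
    (fun v => by simpa using h v)

theorem posDef_of_forall {P : Matrix ι ι ℝ} (hP : Pᵀ = P)
    (h : ∀ v, v ≠ 0 → 0 < v ⬝ᵥ (P *ᵥ v)) : P.PosDef :=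
  .of_dotProduct_mulVec_pos (by simpa [Matrix.IsHermitian] using hP)
    (fun v hv => by simpa using h v hv)

theorem _root_.Matrix.PosSemidef.quad_nonneg {P : Matrix ι ι ℝ} (hP : P.PosSemidef) (v : ι → ℝ) :
    0 ≤ v ⬝ᵥ (P *ᵥ v) := by simpa using hP.dotProduct_mulVec_nonneg v

theorem _root_.Matrix.PosDef.quad_pos {P : Matrix ι ι ℝ} (hP : P.PosDef) {v : ι → ℝ}
    (hv : v ≠ 0) : 0 < v ⬝ᵥ (P *ᵥ v) := by simpa using hP.dotProduct_mulVec_pos hv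

/-- The quotient of two quadratic forms, the second one positive definite, attains its minimum. -/
theorem exists_min_quotient (Y P : Matrix ι ι ℝ) (hP : ∀ v, v ≠ 0 → 0 < v ⬝ᵥ (P *ᵥ v))
    (hne : ∃ v : ι → ℝ, v ≠ 0) :
    ∃ v₀ : ι → ℝ, v₀ ≠ 0 ∧
      ∀ v, (v₀ ⬝ᵥ (Y *ᵥ v₀)) / (v₀ ⬝ᵥ (P *ᵥ v₀)) * (v ⬝ᵥ (P *ᵥ v)) ≤ v ⬝ᵥ (Y *ᵥ v) := by
  classical
  have hnt : Nontrivial (ι → ℝ) := by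
    obtain ⟨v, hv⟩ := hne
    exact ⟨v, 0, hv⟩
  have hcont : ∀ M : Matrix ι ι ℝ, Continuous fun v : ι → ℝ => v ⬝ᵥ (M *ᵥ v) := fun M => by
    simp only [dotProduct, Matrix.mulVec]
    fun_prop
  have hsph : ∀ v ∈ Metric.sphere (0 : ι → ℝ) 1, v ≠ 0 := by
    rintro v hv rfl
    simp at hv
  obtain ⟨v₀, hv₀, hmin⟩ := (isCompact_sphere (0 : ι → ℝ) 1).exists_isMinOn
    (NormedSpace.sphere_nonempty.2 zero_le_one)
    (f := fun v => (v ⬝ᵥ (Y *ᵥ v)) / (v ⬝ᵥ (P *ᵥ v)))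
    ((hcont Y).continuousOn.div (hcont P).continuousOn fun v hv => (hP v (hsph v hv)).ne')
  refine ⟨v₀, hsph v₀ hv₀, fun v => ?_⟩
  rcases eq_or_ne v 0 with rfl | hv
  · simp
  have hn : 0 < ‖v‖ := norm_pos_iff.2 hv
  have hmem : ‖v‖⁻¹ • v ∈ Metric.sphere (0 : ι → ℝ) 1 := by
    simp [norm_smul, hn.ne']
  have h := hmin hmem
  simp only [Set.mem_ofPred_eq, Matrix.mulVec_smul, dotProduct_smul, smul_dotProduct,
    smul_eq_mul] at h
  rw [mul_div_mul_left _ _ (inv_pos.2 hn).ne', mul_div_mul_left _ _ (inv_pos.2 hn).ne'] at h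
  rwa [← le_div_iff₀ (hP v hv)]

theorem exists_pos_mul_dotProduct_le (P : Matrix ι ι ℝ)
    (hP : ∀ v, v ≠ 0 → 0 < v ⬝ᵥ (P *ᵥ v)) :
    ∃ c : ℝ, 0 < c ∧ ∀ v, c * (v ⬝ᵥ v) ≤ v ⬝ᵥ (P *ᵥ v) := by
  classical
  by_cases hne : ∃ v : ι → ℝ, v ≠ 0
  · obtain ⟨v₀, hv₀, h⟩ := exists_min_quotient P 1
      (fun v hv => by simpa using dotProduct_self_pos hv) hne
    exact ⟨_, div_pos (hP v₀ hv₀) (by simpa using dotProduct_self_pos hv₀),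
      fun v => by simpa using h v⟩
  · push Not at hne
    exact ⟨1, one_pos, fun v => by simp [hne v]⟩

theorem exists_le_mul_dotProduct (P : Matrix ι ι ℝ) :
    ∃ c : ℝ, 0 < c ∧ ∀ v, v ⬝ᵥ (P *ᵥ v) ≤ c * (v ⬝ᵥ v) := by
  classical
  by_cases hne : ∃ v : ι → ℝ, v ≠ 0
  · obtain ⟨v₀, hv₀, h⟩ := exists_min_quotient (-P) 1
      (fun v hv => by simpa using dotProduct_self_pos hv) hne
    set μ := v₀ ⬝ᵥ (-P *ᵥ v₀) / v₀ ⬝ᵥ ((1 : Matrix ι ι ℝ) *ᵥ v₀)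
    refine ⟨max 1 (-μ), lt_max_of_lt_left one_pos, fun v => ?_⟩
    have h1 := h v
    rw [Matrix.neg_mulVec v P, dotProduct_neg, Matrix.one_mulVec v] at h1
    have h2 := mul_le_mul_of_nonneg_right (le_max_right 1 (-μ)) (zero_le_dotProduct_self v)
    linarith
  · push Not at hne
    exact ⟨1, one_pos, fun v => by simp [hne v]⟩

/-- A positive semidefinite form that vanishes at `v` has `v` in its kernel. -/
theorem mulVec_eq_zero_of_quad_eq_zero {P : Matrix ι ι ℝ} (hP : Pᵀ = P)
    (h : ∀ v, 0 ≤ v ⬝ᵥ (P *ᵥ v)) {v : ι → ℝ} (hv : v ⬝ᵥ (P *ᵥ v) = 0) : P *ᵥ v = 0 := by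
  have := (posSemidef_of_forall hP h).dotProduct_mulVec_zero_iff v
  simpa [hv] using this

/-- The Lyapunov operator `P ↦ P M + Mᵀ P`. -/
def lyap (M P : Matrix ι ι ℝ) : Matrix ι ι ℝ := P * M + Mᵀ * P

theorem lyap_transpose (M : Matrix ι ι ℝ) {P : Matrix ι ι ℝ} (hP : Pᵀ = P) :
    (lyap M P)ᵀ = lyap M P := by
  simp [lyap, Matrix.transpose_mul, hP, add_comm]

theorem quad_lyap (M : Matrix ι ι ℝ) {P : Matrix ι ι ℝ} (hP : Pᵀ = P) (v : ι → ℝ) :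
    v ⬝ᵥ (lyap M P *ᵥ v) = 2 * ((P *ᵥ v) ⬝ᵥ (M *ᵥ v)) := by
  rw [lyap, Matrix.add_mulVec, dotProduct_add, ← Matrix.mulVec_mulVec, ← Matrix.mulVec_mulVec,
    dotProduct_transpose_mulVec, dotProduct_mulVec_symm hP, dotProduct_comm (M *ᵥ v)]
  ring

/-- A positive semidefinite strict Lyapunov matrix is positive definite. -/
theorem quad_pos_of_lyap_neg {M P : Matrix ι ι ℝ} (hP : P.PosSemidef)
    (hneg : ∀ v, v ≠ 0 → v ⬝ᵥ (lyap M P *ᵥ v) < 0) {v : ι → ℝ} (hv : v ≠ 0) :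
    0 < v ⬝ᵥ (P *ᵥ v) := by
  refine lt_of_le_of_ne (hP.quad_nonneg v) fun h => ?_
  have h0 := mulVec_eq_zero_of_quad_eq_zero hP.transpose_eq hP.quad_nonneg h.symm
  have := hneg v hv
  rw [quad_lyap M hP.transpose_eq, h0] at this
  simp at this

/-- If `M` admits a strict Lyapunov matrix `P ≥ 0`, then the Lyapunov operator reverses signs:
at a minimizer of `⟨v, Y v⟩ / ⟨v, P v⟩` with negative value `μ` the matrix `Y - μ P ≥ 0` is
singular, which is incompatible with the sign of its image under the operator. -/
theorem quad_nonneg_of_lyap_nonpos {M P Y : Matrix ι ι ℝ} (hP : P.PosSemidef)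
    (hneg : ∀ v, v ≠ 0 → v ⬝ᵥ (lyap M P *ᵥ v) < 0) (hY : Yᵀ = Y)
    (hle : ∀ v, v ⬝ᵥ (lyap M Y *ᵥ v) ≤ 0) (v : ι → ℝ) : 0 ≤ v ⬝ᵥ (Y *ᵥ v) := by
  by_contra! hv
  have hPs := hP.transpose_eq
  have hpos : ∀ v, v ≠ 0 → 0 < v ⬝ᵥ (P *ᵥ v) := fun v hv => quad_pos_of_lyap_neg hP hneg hv
  have hv0 : v ≠ 0 := by rintro rfl; simp at hv
  obtain ⟨w, hw, hmin⟩ := exists_min_quotient Y P hpos ⟨v, hv0⟩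
  set μ := (w ⬝ᵥ (Y *ᵥ w)) / (w ⬝ᵥ (P *ᵥ w)) with hμ
  have hμneg : μ < 0 := by
    have := hmin v
    by_contra! hc
    nlinarith [mul_nonneg hc (hpos v hv0).le]
  have hZs : (Y - μ • P)ᵀ = Y - μ • P := by simp [hY, hPs]
  have hq : ∀ x, x ⬝ᵥ ((Y - μ • P) *ᵥ x) = x ⬝ᵥ (Y *ᵥ x) - μ * (x ⬝ᵥ (P *ᵥ x)) := fun x => by
    simp [Matrix.sub_mulVec, Matrix.smul_mulVec, dotProduct_sub, dotProduct_smul]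
  have h0 : (Y - μ • P) *ᵥ w = 0 := by
    refine mulVec_eq_zero_of_quad_eq_zero hZs (fun x => by rw [hq]; linarith [hmin x]) ?_
    rw [hq, hμ, div_mul_cancel₀ _ (hpos w hw).ne', sub_self]
  have h1 : Y *ᵥ w = μ • (P *ᵥ w) := by
    rw [Matrix.sub_mulVec, Matrix.smul_mulVec] at h0
    exact sub_eq_zero.1 h0
  have h2 := hle w
  have h3 := hneg w hw
  rw [quad_lyap M hY, h1, smul_dotProduct, smul_eq_mul] at h2
  rw [quad_lyap M hPs] at h3
  nlinarith

/-- The symmetric matrices as a subspace. -/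
def symmMatrices (ι : Type*) [Fintype ι] : Submodule ℝ (Matrix ι ι ℝ) where
  carrier := {Y | Yᵀ = Y}
  add_mem' := fun {X Y} hX hY => by
    simp only [Set.mem_ofPred_eq] at *
    rw [Matrix.transpose_add, hX, hY]
  zero_mem' := Matrix.transpose_zero
  smul_mem' := fun c X hX => by
    simp only [Set.mem_ofPred_eq] at *
    rw [Matrix.transpose_smul, hX]

theorem eq_zero_of_quad_eq_zero {Y : Matrix ι ι ℝ} (hY : Yᵀ = Y)
    (h : ∀ v, v ⬝ᵥ (Y *ᵥ v) = 0) : Y = 0 := by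
  classical
  refine Matrix.ext_of_mulVec_single fun i => ?_
  rw [mulVec_eq_zero_of_quad_eq_zero hY (fun v => (h v).ge) (h _), Matrix.zero_mulVec]

/-- Solvability of the Lyapunov equation: the operator is injective on symmetric matrices. -/
theorem exists_lyap_eq {M P N : Matrix ι ι ℝ} (hP : P.PosSemidef)
    (hneg : ∀ v, v ≠ 0 → v ⬝ᵥ (lyap M P *ᵥ v) < 0) (hN : Nᵀ = N) :
    ∃ X : Matrix ι ι ℝ, Xᵀ = X ∧ lyap M X = N := by
  let L : symmMatrices ι →ₗ[ℝ] symmMatrices ι :=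
    { toFun := fun Y => ⟨lyap M Y.1, lyap_transpose M Y.2⟩
      map_add' := fun X Y => by
        ext1; simp only [lyap, Submodule.coe_add, Matrix.add_mul, Matrix.mul_add]; abel
      map_smul' := fun c X => by
        ext1; simp [lyap] }
  have hinj : Function.Injective L := by
    rw [← LinearMap.ker_eq_bot, LinearMap.ker_eq_bot']
    intro Y hY
    have hY0 : lyap M Y.1 = 0 := congrArg Subtype.val hY
    have hYs : Y.1ᵀ = Y.1 := Y.2
    ext1
    refine eq_zero_of_quad_eq_zero hYs fun v => le_antisymm ?_ ?_
    · have := quad_nonneg_of_lyap_nonpos (Y := -Y.1) hP hneg (by simp [hYs])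
        (fun v => by
          have : lyap M (-Y.1) = 0 := by
            rw [← neg_eq_zero, ← hY0]; simp [lyap, add_comm]
          simp [this]) v
      rw [Matrix.neg_mulVec, dotProduct_neg] at this
      linarith
    · exact quad_nonneg_of_lyap_nonpos hP hneg hYs (fun v => by simp [hY0]) v
  obtain ⟨X, hX⟩ := LinearMap.injective_iff_surjective.1 hinj ⟨N, hN⟩
  exact ⟨X.1, X.2, congrArg Subtype.val hX⟩

open scoped MatrixOrder Matrix.Norms.L2Operator in
theorem quad_le_trace_mul {P : Matrix ι ι ℝ} (hP : P.PosSemidef) (v : ι → ℝ) :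
    v ⬝ᵥ (P *ᵥ v) ≤ P.trace * (v ⬝ᵥ v) := by
  classical
  obtain ⟨Z, rfl⟩ : ∃ Z : Matrix ι ι ℝ, P = Zᵀ * Z := by
    obtain ⟨Z, hZ⟩ := CStarAlgebra.nonneg_iff_eq_star_mul_self.1 hP.nonneg
    exact ⟨Z, by simpa [Matrix.star_eq_conjTranspose] using hZ⟩
  rw [← Matrix.mulVec_mulVec, dotProduct_transpose_mulVec]
  have h1 : (Zᵀ * Z).trace = ∑ j, ∑ i, Z j i ^ 2 := by
    rw [Finset.sum_comm]
    simp [Matrix.trace, Matrix.mul_apply, pow_two]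
  rw [h1, Finset.sum_mul]
  refine Finset.sum_le_sum fun j _ => ?_
  have := Finset.sum_mul_sq_le_sq_mul_sq Finset.univ (Z j) v
  simpa [Matrix.mulVec, dotProduct, pow_two] using this

theorem abs_apply_le_trace {P : Matrix ι ι ℝ} (hP : P.PosSemidef) (i j : ι) :
    |P i j| ≤ P.trace := by
  classical
  have hd : ∀ i, P i i ≤ P.trace := fun i =>
    Finset.single_le_sum (f := fun i => P i i) (fun i _ => hP.diag_nonneg) (Finset.mem_univ i)
  have hs : P j i = P i j := congrFun (congrFun hP.transpose_eq i) j
  have e : ∀ s : ℝ, (Pi.single i 1 + s • Pi.single j 1) ⬝ᵥ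
      (P *ᵥ (Pi.single i 1 + s • Pi.single j 1)) = P i i + 2 * s * P i j + s ^ 2 * P j j := by
    intro s
    simp [Matrix.mulVec_add, Matrix.mulVec_smul, add_dotProduct, hs]
    ring
  have h1 := hP.quad_nonneg (Pi.single i 1 + (1 : ℝ) • Pi.single j 1)
  have h2 := hP.quad_nonneg (Pi.single i 1 + (-1 : ℝ) • Pi.single j 1)
  rw [e] at h1 h2
  rw [abs_le]
  constructor <;> linarith [hd i, hd j]

end Lyapunov

/-! ### The algebraic Riccati equation -/

section Riccati

variable {l k n m : ℕ}

theorem weight_transpose {Q : Matrix (Fin n) (Fin n) ℝ} {R : Matrix (Fin m) (Fin m) ℝ}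
    (hQ : Q.PosDef) (hR : R.PosDef) : (weight Q R)ᵀ = weight Q R := by
  simp [weight, Matrix.fromBlocks_transpose, hQ.posSemidef.transpose_eq,
    hR.posSemidef.transpose_eq]

theorem quad_weight (Q : Matrix (Fin n) (Fin n) ℝ) (R : Matrix (Fin m) (Fin m) ℝ)
    (x : Fin n → ℝ) (u : Fin m → ℝ) :
    Sum.elim x u ⬝ᵥ (weight Q R *ᵥ Sum.elim x u) = x ⬝ᵥ (Q *ᵥ x) + u ⬝ᵥ (R *ᵥ u) := by
  simp [weight, Matrix.fromBlocks_mulVec]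

theorem weight_posDef {Q : Matrix (Fin n) (Fin n) ℝ} {R : Matrix (Fin m) (Fin m) ℝ}
    (hQ : Q.PosDef) (hR : R.PosDef) : (weight Q R).PosDef := by
  refine posDef_of_forall (weight_transpose hQ hR) fun y hy => ?_
  obtain ⟨x, u, rfl⟩ : ∃ x u, y = Sum.elim x u :=
    ⟨_, _, (Sum.elim_comp_inl_inr y).symm⟩
  rw [quad_weight]
  by_cases hx : x = 0
  · have hu : u ≠ 0 := by
      rintro rfl
      subst hx
      exact hy (by ext (i | i) <;> rfl)
    simpa [hx] using hR.quad_pos hu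
  · exact add_pos_of_pos_of_nonneg (hQ.quad_pos hx) (hR.posSemidef.quad_nonneg u)

/-- The two properties of an associated ODE-LTI, inherited by its stabilizable part, on which the
Riccati theory rests: the state is a linear function of the output, and an input that does not
show in the output does not act on the state. -/
structure OdeLti.IsRegular (G : OdeLti l k n m) : Prop where
  exists_leftInverse : ∃ Λ : Matrix (Fin l) (Fin n ⊕ Fin m) ℝ, Λ * G.C = 1 ∧ Λ * G.D = 0
  feedthrough : (G.D = 0 ∧ G.B = 0) ∨ ∀ w, G.D *ᵥ w = 0 → w = 0

/-- The residual of the algebraic Riccati equation. -/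
noncomputable def riccati (G : OdeLti l k n m) (Q : Matrix (Fin n) (Fin n) ℝ)
    (R : Matrix (Fin m) (Fin m) ℝ) (P : Matrix (Fin l) (Fin l) ℝ) : Matrix (Fin l) (Fin l) ℝ :=
  P * G.A + G.Aᵀ * P
    - (gain G Q R P)ᵀ * (G.Dᵀ * weight Q R * G.D) * gain G Q R P
    + G.Cᵀ * weight Q R * G.C

variable {G : OdeLti l k n m} {Q : Matrix (Fin n) (Fin n) ℝ} {R : Matrix (Fin m) (Fin m) ℝ}

/-- The normal equation of the gain. It also holds when `D = 0`, where both sides vanish because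
the inputs do not act at all, and the value `0` of the gain is one of its solutions. -/
theorem OdeLti.IsRegular.mul_gain (hG : G.IsRegular) (hQ : Q.PosDef) (hR : R.PosDef)
    (P : Matrix (Fin l) (Fin l) ℝ) :
    (G.Dᵀ * weight Q R * G.D) * gain G Q R P = G.Bᵀ * P + G.Dᵀ * weight Q R * G.C := by
  unfold gain
  split_ifs with h
  · have hB : G.B = 0 := by
      rcases hG.feedthrough with h' | h'
      · exact h'.2
      · have hk : ∀ w : Fin k → ℝ, w = 0 := fun w => h' w (by simp [h])
        refine Matrix.ext_of_mulVec_single fun i => ?_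
        rw [hk (Pi.single i 1)]
        simp
    simp [h, hB]
  · have hD : ∀ w, G.D *ᵥ w = 0 → w = 0 := hG.feedthrough.resolve_left fun h' => h h'.1
    have hpd : (G.Dᵀ * weight Q R * G.D).PosDef := by
      refine posDef_of_forall ?_ fun w hw => ?_
      · simp [Matrix.transpose_mul, weight_transpose hQ hR, Matrix.mul_assoc]
      · rw [dotProduct_conj_mulVec]
        exact (weight_posDef hQ hR).quad_pos fun h0 => hw (hD w h0)
    rw [← Matrix.mul_assoc,
      Matrix.mul_nonsing_inv _ ((Matrix.isUnit_iff_isUnit_det _).1 hpd.isUnit), Matrix.one_mul]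

theorem riccati_transpose (hQ : Q.PosDef) (hR : R.PosDef) {P : Matrix (Fin l) (Fin l) ℝ}
    (hP : Pᵀ = P) : (riccati G Q R P)ᵀ = riccati G Q R P := by
  simp [riccati, Matrix.transpose_mul, hP, weight_transpose hQ hR, Matrix.mul_assoc, add_comm]

theorem sub_mul_mulVec {ι κ ι' : Type*} [Fintype κ] [Fintype ι'] (X : Matrix ι ι' ℝ)
    (Y : Matrix ι κ ℝ) (F : Matrix κ ι' ℝ) (v : ι' → ℝ) :
    (X - Y * F) *ᵥ v = X *ᵥ v + Y *ᵥ (-(F *ᵥ v)) := by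
  rw [Matrix.sub_mulVec, Matrix.mulVec_neg, Matrix.mulVec_mulVec, sub_eq_add_neg]

/-- Completion of the square. For `v` the state and `w` the input, the left side is the derivative
of `⟨v, P v⟩` along the system plus the running cost. -/
theorem OdeLti.IsRegular.complete_square (hG : G.IsRegular) (hQ : Q.PosDef) (hR : R.PosDef)
    {P : Matrix (Fin l) (Fin l) ℝ} (hP : Pᵀ = P) (v : Fin l → ℝ) (w : Fin k → ℝ) :
    2 * ((P *ᵥ v) ⬝ᵥ (G.A *ᵥ v + G.B *ᵥ w)) +
        (G.C *ᵥ v + G.D *ᵥ w) ⬝ᵥ (weight Q R *ᵥ (G.C *ᵥ v + G.D *ᵥ w)) =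
      v ⬝ᵥ (riccati G Q R P *ᵥ v) +
        (G.D *ᵥ (w + gain G Q R P *ᵥ v)) ⬝ᵥ (weight Q R *ᵥ (G.D *ᵥ (w + gain G Q R P *ᵥ v))) := by
  have hS := weight_transpose hQ hR
  set S := weight Q R
  set K := gain G Q R P with hK
  have e1 : w ⬝ᵥ ((G.Dᵀ * S * G.D) *ᵥ (K *ᵥ v)) =
      (G.B *ᵥ w) ⬝ᵥ (P *ᵥ v) + (G.D *ᵥ w) ⬝ᵥ (S *ᵥ (G.C *ᵥ v)) := by
    rw [Matrix.mulVec_mulVec, hK, hG.mul_gain hQ hR, Matrix.add_mulVec, dotProduct_add,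
      ← Matrix.mulVec_mulVec, dotProduct_transpose_mulVec, ← Matrix.mulVec_mulVec,
      ← Matrix.mulVec_mulVec, dotProduct_transpose_mulVec]
  have e1' : w ⬝ᵥ ((G.Dᵀ * S * G.D) *ᵥ (K *ᵥ v)) =
      (G.D *ᵥ w) ⬝ᵥ (S *ᵥ (G.D *ᵥ (K *ᵥ v))) := by
    rw [← Matrix.mulVec_mulVec, ← Matrix.mulVec_mulVec, dotProduct_transpose_mulVec]
  have e2 : v ⬝ᵥ (riccati G Q R P *ᵥ v) = 2 * ((P *ᵥ v) ⬝ᵥ (G.A *ᵥ v)) -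
      (G.D *ᵥ (K *ᵥ v)) ⬝ᵥ (S *ᵥ (G.D *ᵥ (K *ᵥ v))) + (G.C *ᵥ v) ⬝ᵥ (S *ᵥ (G.C *ᵥ v)) := by
    have h1 := quad_lyap G.A hP v
    rw [lyap] at h1
    rw [riccati, Matrix.add_mulVec, Matrix.sub_mulVec, dotProduct_add, dotProduct_sub, h1,
      dotProduct_conj_mulVec, dotProduct_conj_mulVec, dotProduct_conj_mulVec]
  have e3 : (G.D *ᵥ w) ⬝ᵥ (S *ᵥ (G.D *ᵥ (K *ᵥ v))) = (G.D *ᵥ (K *ᵥ v)) ⬝ᵥ (S *ᵥ (G.D *ᵥ w)) := by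
    rw [dotProduct_mulVec_symm hS, dotProduct_comm]
  have e4 : (G.D *ᵥ w) ⬝ᵥ (S *ᵥ (G.C *ᵥ v)) = (G.C *ᵥ v) ⬝ᵥ (S *ᵥ (G.D *ᵥ w)) := by
    rw [dotProduct_mulVec_symm hS, dotProduct_comm]
  have e5 : (G.B *ᵥ w) ⬝ᵥ (P *ᵥ v) = (P *ᵥ v) ⬝ᵥ (G.B *ᵥ w) := dotProduct_comm _ _
  simp only [Matrix.mulVec_add, dotProduct_add, add_dotProduct]
  linarith

/-- The running cost dominates the state, uniformly in the input. -/
theorem OdeLti.IsRegular.exists_coercive (hG : G.IsRegular) (hQ : Q.PosDef) (hR : R.PosDef) :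
    ∃ c : ℝ, 0 < c ∧ ∀ (v : Fin l → ℝ) (w : Fin k → ℝ), c * (v ⬝ᵥ v) ≤
      (G.C *ᵥ v + G.D *ᵥ w) ⬝ᵥ (weight Q R *ᵥ (G.C *ᵥ v + G.D *ᵥ w)) := by
  obtain ⟨Λ, hC, hD⟩ := hG.exists_leftInverse
  obtain ⟨s, hs, hs'⟩ := exists_pos_mul_dotProduct_le (weight Q R)
    fun v hv => (weight_posDef hQ hR).quad_pos hv
  obtain ⟨κ, hκ, hκ'⟩ := exists_le_mul_dotProduct (Λᵀ * Λ)
  refine ⟨s / κ, div_pos hs hκ, fun v w => le_trans ?_ (hs' _)⟩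
  have h1 : Λ *ᵥ (G.C *ᵥ v + G.D *ᵥ w) = v := by
    rw [Matrix.mulVec_add, Matrix.mulVec_mulVec, Matrix.mulVec_mulVec, hC, hD]
    simp
  have h2 := hκ' (G.C *ᵥ v + G.D *ᵥ w)
  rw [← Matrix.mulVec_mulVec, dotProduct_transpose_mulVec, h1] at h2
  rw [div_mul_eq_mul_div, div_le_iff₀ hκ, mul_assoc, mul_comm _ κ]
  exact mul_le_mul_of_nonneg_left h2 hs.le

/-- The closed loop form of the completion of the square: the Riccati residual of `P` is the
minimum over all feedbacks `F` of the Lyapunov residuals, attained at the gain. -/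
theorem OdeLti.IsRegular.lyap_closedLoop (hG : G.IsRegular) (hQ : Q.PosDef) (hR : R.PosDef)
    {P : Matrix (Fin l) (Fin l) ℝ} (hP : Pᵀ = P) (F : Matrix (Fin k) (Fin l) ℝ) (v : Fin l → ℝ) :
    v ⬝ᵥ (lyap (G.A - G.B * F) P *ᵥ v) +
        ((G.C - G.D * F) *ᵥ v) ⬝ᵥ (weight Q R *ᵥ ((G.C - G.D * F) *ᵥ v)) =
      v ⬝ᵥ (riccati G Q R P *ᵥ v) + (G.D *ᵥ (gain G Q R P *ᵥ v - F *ᵥ v)) ⬝ᵥ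
        (weight Q R *ᵥ (G.D *ᵥ (gain G Q R P *ᵥ v - F *ᵥ v))) := by
  have h := hG.complete_square hQ hR hP v (-(F *ᵥ v))
  rw [neg_add_eq_sub] at h
  rw [quad_lyap _ hP, ← h, sub_mul_mulVec, sub_mul_mulVec]

/-- Every feedback `F` gives an upper bound for the Riccati residual. -/
theorem OdeLti.IsRegular.riccati_le (hG : G.IsRegular) (hQ : Q.PosDef) (hR : R.PosDef)
    {P : Matrix (Fin l) (Fin l) ℝ} (hP : Pᵀ = P) (F : Matrix (Fin k) (Fin l) ℝ) (v : Fin l → ℝ) :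
    v ⬝ᵥ (riccati G Q R P *ᵥ v) ≤ v ⬝ᵥ (lyap (G.A - G.B * F) P *ᵥ v) +
        ((G.C - G.D * F) *ᵥ v) ⬝ᵥ (weight Q R *ᵥ ((G.C - G.D * F) *ᵥ v)) := by
  rw [hG.lyap_closedLoop hQ hR hP F v]
  linarith [(weight_posDef hQ hR).posSemidef.quad_nonneg
    (G.D *ᵥ (gain G Q R P *ᵥ v - F *ᵥ v))]

/-- The gain attains the minimum over the feedbacks. -/
theorem OdeLti.IsRegular.riccati_eq (hG : G.IsRegular) (hQ : Q.PosDef) (hR : R.PosDef)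
    {P : Matrix (Fin l) (Fin l) ℝ} (hP : Pᵀ = P) (v : Fin l → ℝ) :
    v ⬝ᵥ (riccati G Q R P *ᵥ v) = v ⬝ᵥ (lyap (G.A - G.B * gain G Q R P) P *ᵥ v) +
        ((G.C - G.D * gain G Q R P) *ᵥ v) ⬝ᵥ
          (weight Q R *ᵥ ((G.C - G.D * gain G Q R P) *ᵥ v)) := by
  rw [hG.lyap_closedLoop hQ hR hP]
  simp

theorem OdeLti.IsRegular.closedLoop_pos (hG : G.IsRegular) (hQ : Q.PosDef) (hR : R.PosDef)
    (F : Matrix (Fin k) (Fin l) ℝ) {v : Fin l → ℝ} (hv : v ≠ 0) :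
    0 < ((G.C - G.D * F) *ᵥ v) ⬝ᵥ (weight Q R *ᵥ ((G.C - G.D * F) *ᵥ v)) := by
  obtain ⟨c, hc, h⟩ := hG.exists_coercive hQ hR
  have := h v (-(F *ᵥ v))
  rw [← sub_mul_mulVec] at this
  exact (mul_pos hc (dotProduct_self_pos hv)).trans_le this

/-- A symmetric upper solution of the Riccati equation is a strict Lyapunov matrix of its own
closed loop. -/
theorem OdeLti.IsRegular.lyap_neg (hG : G.IsRegular) (hQ : Q.PosDef) (hR : R.PosDef)
    {P : Matrix (Fin l) (Fin l) ℝ} (hP : Pᵀ = P)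
    (hle : ∀ v, v ⬝ᵥ (riccati G Q R P *ᵥ v) ≤ 0) {v : Fin l → ℝ} (hv : v ≠ 0) :
    v ⬝ᵥ (lyap (G.A - G.B * gain G Q R P) P *ᵥ v) < 0 := by
  have h1 := hG.riccati_eq hQ hR hP v
  have h2 := hG.closedLoop_pos hQ hR (gain G Q R P) hv
  linarith [hle v]

/-- The positive definite solution of the Riccati equation is unique: by `riccati_le` the
difference of two solutions has a sign, in both orders. -/
theorem OdeLti.IsRegular.riccati_unique (hG : G.IsRegular) (hQ : Q.PosDef) (hR : R.PosDef)
    {P P' : Matrix (Fin l) (Fin l) ℝ} (hP : P.PosDef) (hP' : P'.PosDef)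
    (h : riccati G Q R P = 0) (h' : riccati G Q R P' = 0) : P = P' := by
  have key : ∀ {P P' : Matrix (Fin l) (Fin l) ℝ}, P.PosDef → P'.PosDef →
      riccati G Q R P = 0 → riccati G Q R P' = 0 →
      ∀ v, v ⬝ᵥ (P' *ᵥ v) ≤ v ⬝ᵥ (P *ᵥ v) := by
    intro P P' hP hP' h h' v
    have hs := hP.posSemidef.transpose_eq
    have hs' := hP'.posSemidef.transpose_eq
    have := quad_nonneg_of_lyap_nonpos (M := G.A - G.B * gain G Q R P) (Y := P - P')
      hP.posSemidef (fun v hv => hG.lyap_neg hQ hR hs (by simp [h]) hv) (by simp [hs, hs'])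
      (fun v => by
        have h1 := hG.riccati_eq hQ hR hs v
        have h2 := hG.riccati_le hQ hR hs' (gain G Q R P) v
        have h3 : lyap (G.A - G.B * gain G Q R P) (P - P') =
            lyap (G.A - G.B * gain G Q R P) P - lyap (G.A - G.B * gain G Q R P) P' := by
          simp only [lyap, Matrix.sub_mul _ _ (G.A - G.B * gain G Q R P), Matrix.mul_sub _ P P']
          abel
        rw [h] at h1
        rw [h'] at h2
        rw [h3, Matrix.sub_mulVec, dotProduct_sub]
        simp only [Matrix.zero_mulVec, dotProduct_zero] at h1 h2
        linarith) v
    rw [Matrix.sub_mulVec, dotProduct_sub] at this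
    linarith
  have hs := hP.posSemidef.transpose_eq
  have hs' := hP'.posSemidef.transpose_eq
  refine sub_eq_zero.1 (eq_zero_of_quad_eq_zero (by simp [hs, hs']) fun v => ?_)
  rw [Matrix.sub_mulVec, dotProduct_sub]
  linarith [key hP hP' h h' v, key hP' hP h' h v]

theorem continuous_gain : Continuous fun P => gain G Q R P := by
  unfold gain
  split_ifs
  · exact continuous_const
  · fun_prop

theorem continuous_riccati : Continuous fun P => riccati G Q R P := by
  have := continuous_gain (G := G) (Q := Q) (R := R)
  unfold riccati
  fun_prop

/-- If the Riccati equation has a positive semidefinite upper solution, then it has a positive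
definite solution. An upper solution of minimal trace is a solution: otherwise a Kleinman step,
which solves a Lyapunov equation of the closed loop, decreases the trace. -/
theorem OdeLti.IsRegular.exists_riccati_of_upper (hG : G.IsRegular) (hQ : Q.PosDef)
    (hR : R.PosDef) {Z : Matrix (Fin l) (Fin l) ℝ} (hZ : Z.PosSemidef)
    (hle : ∀ v, v ⬝ᵥ (riccati G Q R Z *ᵥ v) ≤ 0) :
    ∃ P : Matrix (Fin l) (Fin l) ℝ, P.PosDef ∧ riccati G Q R P = 0 := by
  let U : Set (Matrix (Fin l) (Fin l) ℝ) :=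
    {P | Pᵀ = P ∧ (∀ v, 0 ≤ v ⬝ᵥ (P *ᵥ v)) ∧ (∀ v, v ⬝ᵥ (riccati G Q R P *ᵥ v) ≤ 0) ∧
      P.trace ≤ Z.trace}
  have hquad : ∀ v : Fin l → ℝ, Continuous fun P : Matrix (Fin l) (Fin l) ℝ => v ⬝ᵥ (P *ᵥ v) := by
    intro v; fun_prop
  have hUc : IsClosed U := by
    have h1 : IsClosed {P : Matrix (Fin l) (Fin l) ℝ | Pᵀ = P} :=
      isClosed_eq (by fun_prop) continuous_id
    have h2 : IsClosed (⋂ v, {P : Matrix (Fin l) (Fin l) ℝ | 0 ≤ v ⬝ᵥ (P *ᵥ v)}) :=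
      isClosed_iInter fun v => isClosed_le continuous_const (hquad v)
    have h3 : IsClosed (⋂ v, {P : Matrix (Fin l) (Fin l) ℝ | v ⬝ᵥ (riccati G Q R P *ᵥ v) ≤ 0}) :=
      isClosed_iInter fun v => isClosed_le ((hquad v).comp continuous_riccati) continuous_const
    have h4 : IsClosed {P : Matrix (Fin l) (Fin l) ℝ | P.trace ≤ Z.trace} :=
      isClosed_le (by fun_prop) continuous_const
    convert h1.inter (h2.inter (h3.inter h4)) using 1
    ext P
    simp [U]
  have hcomp : IsCompact U := by
    refine (isCompact_univ_pi fun _ : Fin l => isCompact_univ_pi fun _ : Fin l =>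
      isCompact_Icc (a := -Z.trace) (b := Z.trace)).of_isClosed_subset hUc ?_
    rintro P ⟨hs, hp, -, ht⟩ i - j -
    have := abs_apply_le_trace (posSemidef_of_forall hs hp) i j
    exact abs_le.1 (this.trans ht)
  -- `P` is an upper solution of minimal trace, `M` its closed loop and `P - X` the Kleinman step
  obtain ⟨P, ⟨hs, hp, hr, ht⟩, hmin⟩ := hcomp.exists_isMinOn
    ⟨Z, hZ.transpose_eq, hZ.quad_nonneg, hle, le_rfl⟩ (f := Matrix.trace) (by fun_prop)
  have hPs := posSemidef_of_forall hs hp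
  set M := G.A - G.B * gain G Q R P with hM
  have hneg : ∀ v, v ≠ 0 → v ⬝ᵥ (lyap M P *ᵥ v) < 0 := fun v hv => hG.lyap_neg hQ hR hs hr hv
  obtain ⟨X, hXs, hX⟩ := exists_lyap_eq hPs hneg (riccati_transpose (G := G) hQ hR hs)
  have hX0 : ∀ v, 0 ≤ v ⬝ᵥ (X *ᵥ v) :=
    quad_nonneg_of_lyap_nonpos hPs hneg hXs (fun v => by rw [hX]; exact hr v)
  have hPXs : (P - X)ᵀ = P - X := by simp [hs, hXs]
  have hlin : lyap M (P - X) = lyap M P - lyap M X := by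
    simp only [lyap, Matrix.sub_mul P X M, Matrix.mul_sub _ P X]
    abel
  have hmem : P - X ∈ U := by
    refine ⟨hPXs, quad_nonneg_of_lyap_nonpos hPs hneg hPXs fun v => ?_, fun v => ?_, ?_⟩
    · have h1 := hG.riccati_eq hQ hR hs v
      have h2 := (weight_posDef hQ hR).posSemidef.quad_nonneg
        ((G.C - G.D * gain G Q R P) *ᵥ v)
      rw [hlin, hX, Matrix.sub_mulVec, dotProduct_sub]
      linarith
    · have h1 := hG.riccati_eq hQ hR hs v
      have h2 := hG.riccati_le hQ hR hPXs (gain G Q R P) v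
      rw [← hM, hlin, hX, Matrix.sub_mulVec, dotProduct_sub] at h2
      linarith
    · rw [Matrix.trace_sub]
      linarith [(posSemidef_of_forall hXs hX0).trace_nonneg]
  have htr : X.trace ≤ 0 := by
    have h := hmin hmem
    simp only [Set.mem_ofPred_eq, Matrix.trace_sub] at h
    linarith
  have hX00 : X = 0 := eq_zero_of_quad_eq_zero hXs fun v => le_antisymm
    ((quad_le_trace_mul (posSemidef_of_forall hXs hX0) v).trans
      (mul_nonpos_of_nonpos_of_nonneg htr (zero_le_dotProduct_self v))) (hX0 v)
  refine ⟨P, posDef_of_forall hs fun v hv => quad_pos_of_lyap_neg hPs hneg hv, ?_⟩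
  rw [← hX, hX00]
  simp [lyap]

/-- The system with discount rate `γ`, whose state matrix is `A - γ I`. -/
def OdeLti.discount (G : OdeLti l k n m) (γ : ℝ) : OdeLti l k n m := { G with A := G.A - γ • 1 }

theorem riccati_discount (γ : ℝ) (P : Matrix (Fin l) (Fin l) ℝ) :
    riccati (G.discount γ) Q R P = riccati G Q R P - (2 * γ) • P := by
  have : gain (G.discount γ) Q R P = gain G Q R P := rfl
  simp only [riccati, this]
  simp only [OdeLti.discount, Matrix.mul_sub, Matrix.transpose_sub, Matrix.sub_mul,
    Matrix.transpose_smul, Matrix.transpose_one, Matrix.smul_mul, Matrix.mul_smul, Matrix.one_mul,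
    Matrix.mul_one, two_mul, add_smul]
  abel

/-- Existence of the positive definite Riccati solution, given an a priori bound on the traces of
the positive semidefinite lower solutions. Solutions `P` for the discount rates `γ ≥ 0` are lower
solutions of the undiscounted equation, so that they obey the bound, and `2 P` is an upper solution
for rates down to `γ - δ` with a fixed step `δ`. Starting at a large rate, where the identity is an
upper solution, finitely many steps lead to the rate `0`. -/
theorem OdeLti.IsRegular.exists_riccati_of_trace_bound (hG : G.IsRegular) (hQ : Q.PosDef)
    (hR : R.PosDef) {τ : ℝ}
    (hτ : ∀ P : Matrix (Fin l) (Fin l) ℝ, P.PosSemidef →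
      (∀ v, 0 ≤ v ⬝ᵥ (riccati G Q R P *ᵥ v)) → P.trace ≤ τ) :
    ∃ P : Matrix (Fin l) (Fin l) ℝ, P.PosDef ∧ riccati G Q R P = 0 := by
  obtain ⟨c, hc, hcoer⟩ := hG.exists_coercive hQ hR
  have hreg : ∀ γ, (G.discount γ).IsRegular := fun γ => ⟨hG.1, hG.2⟩
  have hcl : ∀ (F : Matrix (Fin k) (Fin l) ℝ) v, c * (v ⬝ᵥ v) ≤
      ((G.C - G.D * F) *ᵥ v) ⬝ᵥ (weight Q R *ᵥ ((G.C - G.D * F) *ᵥ v)) := fun F v => by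
    have := hcoer v (-(F *ᵥ v))
    rwa [← sub_mul_mulVec] at this
  have hqd : ∀ (γ : ℝ) (P : Matrix (Fin l) (Fin l) ℝ) v,
      v ⬝ᵥ (riccati (G.discount γ) Q R P *ᵥ v) =
        v ⬝ᵥ (riccati G Q R P *ᵥ v) - 2 * γ * (v ⬝ᵥ (P *ᵥ v)) := fun γ P v => by
    rw [riccati_discount, Matrix.sub_mulVec, dotProduct_sub, Matrix.smul_mulVec, dotProduct_smul,
      smul_eq_mul]
  set τ' := max τ 1 with hτ'
  have hτ'pos : 0 < τ' := lt_max_of_lt_right one_pos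
  -- `2 P` beats the residual by the coercive closed loop cost, at least `c |v|²`, while a change
  -- of the rate by `δ` costs `4 δ ⟨v, P v⟩ ≤ 4 δ τ' |v|²`
  set δ := c / (4 * τ') with hδ
  have hδpos : 0 < δ := by positivity
  have step : ∀ γ γ' : ℝ, 0 ≤ γ → γ - δ ≤ γ' →
      (∃ P : Matrix (Fin l) (Fin l) ℝ, P.PosDef ∧ riccati (G.discount γ) Q R P = 0) →
      ∃ P : Matrix (Fin l) (Fin l) ℝ, P.PosDef ∧ riccati (G.discount γ') Q R P = 0 := by
    rintro γ γ' hγ hγ' ⟨P, hP, h0⟩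
    have hs := hP.posSemidef.transpose_eq
    have hval : ∀ v, v ⬝ᵥ (riccati G Q R P *ᵥ v) = 2 * γ * (v ⬝ᵥ (P *ᵥ v)) := fun v => by
      have := hqd γ P v
      rw [h0] at this
      simp only [Matrix.zero_mulVec, dotProduct_zero] at this
      linarith
    have htr : P.trace ≤ τ' := (hτ P hP.posSemidef fun v => by
      rw [hval]
      have := hP.posSemidef.quad_nonneg v
      positivity).trans (le_max_left _ _)
    refine (hreg γ').exists_riccati_of_upper hQ hR (Z := (2 : ℝ) • P)
      (hP.posSemidef.smul zero_le_two) fun v => ?_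
    have h2s : ((2 : ℝ) • P)ᵀ = (2 : ℝ) • P := by simp [hs]
    have h1 := hG.riccati_le hQ hR h2s (gain G Q R P) v
    have h2 := hG.riccati_eq hQ hR hs v
    have h3 : lyap (G.A - G.B * gain G Q R P) ((2 : ℝ) • P) =
        (2 : ℝ) • lyap (G.A - G.B * gain G Q R P) P := by
      simp [lyap]
    have h4 := hcl (gain G Q R P) v
    have h5 := hval v
    have h6 : v ⬝ᵥ (P *ᵥ v) ≤ τ' * (v ⬝ᵥ v) :=
      (quad_le_trace_mul hP.posSemidef v).trans
        (mul_le_mul_of_nonneg_right htr (zero_le_dotProduct_self v))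
    have h7 : δ * (v ⬝ᵥ (P *ᵥ v)) ≤ c / 4 * (v ⬝ᵥ v) := by
      have : δ * (τ' * (v ⬝ᵥ v)) = c / 4 * (v ⬝ᵥ v) := by
        rw [hδ]; field_simp
      rw [← this]
      exact mul_le_mul_of_nonneg_left h6 hδpos.le
    have h8 : (γ - δ) * (v ⬝ᵥ (P *ᵥ v)) ≤ γ' * (v ⬝ᵥ (P *ᵥ v)) :=
      mul_le_mul_of_nonneg_right hγ' (hP.posSemidef.quad_nonneg v)
    rw [h3] at h1
    rw [hqd]
    simp only [Matrix.smul_mulVec, dotProduct_smul, smul_eq_mul] at h1 ⊢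
    nlinarith
  obtain ⟨γ₀, hγ₀, hstart⟩ : ∃ γ₀ : ℝ, 0 ≤ γ₀ ∧
      ∃ P : Matrix (Fin l) (Fin l) ℝ, P.PosDef ∧ riccati (G.discount γ₀) Q R P = 0 := by
    obtain ⟨b, hb, hb'⟩ := exists_le_mul_dotProduct (riccati G Q R 1)
    refine ⟨b / 2, by positivity, (hreg _).exists_riccati_of_upper hQ hR
      (Matrix.PosSemidef.one) fun v => ?_⟩
    rw [hqd]
    have := hb' v
    rw [Matrix.one_mulVec]
    linarith
  have hall : ∀ j : ℕ, ∃ P : Matrix (Fin l) (Fin l) ℝ, P.PosDef ∧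
      riccati (G.discount (max 0 (γ₀ - j * δ))) Q R P = 0 := by
    intro j
    induction j with
    | zero => simpa [hγ₀] using hstart
    | succ j ih =>
      refine step _ _ (le_max_left _ _) ?_ ih
      push_cast
      rcases le_total 0 (γ₀ - j * δ) with h | h
      · rw [max_eq_right h]
        exact le_max_of_le_right (by linarith)
      · rw [max_eq_left h]
        exact le_max_of_le_left (by linarith)
  obtain ⟨j, hj⟩ := exists_nat_ge (γ₀ / δ)
  rw [div_le_iff₀ hδpos] at hj
  obtain ⟨P, hP, h0⟩ := hall j
  rw [max_eq_left (by linarith), riccati_discount] at h0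
  exact ⟨P, hP, by simpa using h0⟩

end Riccati

/-! ### Absolutely continuous functions on time intervals -/

section AbsolutelyContinuous

theorem absolutelyContinuousOnInterval_comp_lipschitz {X Y : Type*} [PseudoMetricSpace X]
    [PseudoMetricSpace Y] {g : X → Y} {K : NNReal} (hg : LipschitzWith K g) {f : ℝ → X} {a b : ℝ}
    (hf : AbsolutelyContinuousOnInterval f a b) :
    AbsolutelyContinuousOnInterval (fun t => g (f t)) a b := by
  rw [absolutelyContinuousOnInterval_iff] at hf ⊢
  intro ε hε
  obtain ⟨δ, hδ, h⟩ := hf (ε / (K + 1)) (by positivity)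
  refine ⟨δ, hδ, fun E hE hlt => ?_⟩
  have h1 := h E hE hlt
  have hK : (0 : ℝ) < K + 1 := by positivity
  calc _ ≤ ∑ i ∈ Finset.range E.1, (K + 1 : ℝ) * dist (f (E.2 i).1) (f (E.2 i).2) := by
        refine Finset.sum_le_sum fun i _ => (hg.dist_le_mul _ _).trans ?_
        gcongr
        linarith
    _ = (K + 1) * ∑ i ∈ Finset.range E.1, dist (f (E.2 i).1) (f (E.2 i).2) := by
        rw [Finset.mul_sum]
    _ < (K + 1) * (ε / (K + 1)) := by gcongr
    _ = ε := by field_simp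

theorem absolutelyContinuousOnInterval_congr {X : Type*} [PseudoMetricSpace X]
    {f g : ℝ → X} {a b : ℝ} (hf : AbsolutelyContinuousOnInterval f a b)
    (h : ∀ t ∈ Set.uIcc a b, f t = g t) : AbsolutelyContinuousOnInterval g a b := by
  rw [absolutelyContinuousOnInterval_iff] at hf ⊢
  intro ε hε
  obtain ⟨δ, hδ, hf⟩ := hf ε hε
  refine ⟨δ, hδ, fun E hE hlt => ?_⟩
  have h1 := hf E hE hlt
  rwa [Finset.sum_congr rfl fun i hi => by rw [h _ (hE.1 i hi).1, h _ (hE.1 i hi).2]] at h1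

theorem absolutelyContinuousOnInterval_const {X : Type*} [PseudoMetricSpace X] (x : X) (a b : ℝ) :
    AbsolutelyContinuousOnInterval (fun _ : ℝ => x) a b :=
  ((LipschitzWith.const x).lipschitzOnWith (s := Set.uIcc a b)).absolutelyContinuousOnInterval

theorem absolutelyContinuousOnInterval_sum {F ι : Type*} [SeminormedAddCommGroup F]
    (s : Finset ι) {f : ι → ℝ → F} {a b : ℝ}
    (hf : ∀ i ∈ s, AbsolutelyContinuousOnInterval (f i) a b) :
    AbsolutelyContinuousOnInterval (fun t => ∑ i ∈ s, f i t) a b := by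
  classical
  induction s using Finset.induction_on with
  | empty => simpa using absolutelyContinuousOnInterval_const (0 : F) a b
  | insert i s hi ih =>
    simp only [Finset.sum_insert hi]
    exact (hf i (Finset.mem_insert_self i s)).fun_add
      (ih fun j hj => hf j (Finset.mem_insert_of_mem hj))

/-- Multiplication by a matrix as a continuous linear map. -/
noncomputable def mulVecCLM {ι κ : Type*} [Fintype ι] (M : Matrix κ ι ℝ) :
    (ι → ℝ) →L[ℝ] (κ → ℝ) :=
  LinearMap.toContinuousLinearMap M.mulVecLin

@[simp] theorem mulVecCLM_apply {ι κ : Type*} [Fintype ι] (M : Matrix κ ι ℝ) (v : ι → ℝ) :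
    mulVecCLM M v = M *ᵥ v := rfl

variable {ι κ : Type*} [Fintype ι] [Fintype κ]

theorem absolutelyContinuousOnInterval_clm_apply {E F : Type*} [NormedAddCommGroup E]
    [NormedSpace ℝ E]
    [NormedAddCommGroup F] [NormedSpace ℝ F] (L : E →L[ℝ] F) {f : ℝ → E} {a b : ℝ}
    (hf : AbsolutelyContinuousOnInterval f a b) :
    AbsolutelyContinuousOnInterval (fun t => L (f t)) a b :=
  absolutelyContinuousOnInterval_comp_lipschitz L.lipschitz hf

theorem absolutelyContinuousOnInterval_apply {f : ℝ → ι → ℝ} {a b : ℝ}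
    (hf : AbsolutelyContinuousOnInterval f a b) (i : ι) :
    AbsolutelyContinuousOnInterval (fun t => f t i) a b :=
  absolutelyContinuousOnInterval_clm_apply
    (ContinuousLinearMap.proj (R := ℝ) (φ := fun _ : ι => ℝ) i) hf

theorem absolutelyContinuousOnInterval_pi {f : ℝ → ι → ℝ} {a b : ℝ}
    (hf : ∀ i, AbsolutelyContinuousOnInterval (fun t => f t i) a b) :
    AbsolutelyContinuousOnInterval f a b := by
  classical
  have h := absolutelyContinuousOnInterval_sum Finset.univ
    (f := fun i t => ContinuousLinearMap.toSpanSingleton ℝ (Pi.single i (1 : ℝ) : ι → ℝ) (f t i))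
    fun i _ => absolutelyContinuousOnInterval_clm_apply _ (hf i)
  refine absolutelyContinuousOnInterval_congr h fun t _ => ?_
  ext j
  simp [Finset.sum_apply, Pi.single_apply]

theorem absolutelyContinuousOnInterval_mulVec (M : Matrix κ ι ℝ) {f : ℝ → ι → ℝ} {a b : ℝ}
    (hf : AbsolutelyContinuousOnInterval f a b) :
    AbsolutelyContinuousOnInterval (fun t => M *ᵥ f t) a b :=
  absolutelyContinuousOnInterval_clm_apply (mulVecCLM M) hf

theorem absolutelyContinuousOnInterval_dotProduct {f g : ℝ → ι → ℝ} {a b : ℝ}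
    (hf : AbsolutelyContinuousOnInterval f a b) (hg : AbsolutelyContinuousOnInterval g a b) :
    AbsolutelyContinuousOnInterval (fun t => f t ⬝ᵥ g t) a b :=
  absolutelyContinuousOnInterval_sum _ fun i _ =>
    (absolutelyContinuousOnInterval_apply hf i).mul (absolutelyContinuousOnInterval_apply hg i)

theorem hasDerivAt_mulVec (M : Matrix κ ι ℝ) {f : ℝ → ι → ℝ} {f' : ι → ℝ} {t : ℝ}
    (hf : HasDerivAt f f' t) : HasDerivAt (fun s => M *ᵥ f s) (M *ᵥ f') t :=
  (mulVecCLM M).hasFDerivAt.comp_hasDerivAt t hf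

theorem hasDerivAt_dotProduct {f g : ℝ → ι → ℝ} {f' g' : ι → ℝ} {t : ℝ}
    (hf : HasDerivAt f f' t) (hg : HasDerivAt g g' t) :
    HasDerivAt (fun s => f s ⬝ᵥ g s) (f' ⬝ᵥ g t + f t ⬝ᵥ g') t := by
  simp only [dotProduct, ← Finset.sum_add_distrib]
  exact HasDerivAt.fun_sum fun i _ => (hasDerivAt_pi.1 hf i).mul (hasDerivAt_pi.1 hg i)

theorem absolutelyContinuousOnInterval_intervalIntegral_pi {g : ℝ → ι → ℝ} {a b : ℝ}
    (h : IntervalIntegrable g volume a b) :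
    AbsolutelyContinuousOnInterval (fun t => ∫ s in a..t, g s) a b := by
  refine absolutelyContinuousOnInterval_pi fun i => ?_
  have hi : IntervalIntegrable (fun t => g t i) volume a b :=
    ⟨h.1.eval i, h.2.eval i⟩
  refine absolutelyContinuousOnInterval_congr
    (hi.absolutelyContinuousOnInterval_intervalIntegral Set.left_mem_uIcc) fun t ht => ?_
  have hg : IntervalIntegrable g volume a t :=
    h.mono_set (Set.uIcc_subset_uIcc_left ht)
  exact (ContinuousLinearMap.proj (R := ℝ) (φ := fun _ : ι => ℝ) i).intervalIntegral_comp_comm hg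

/-- The fundamental theorem of calculus for a vector-valued absolutely continuous function. -/
theorem eq_add_integral_of_absolutelyContinuousOnInterval {f g : ℝ → ι → ℝ} {a b : ℝ} (hab : a ≤ b)
    (hf : AbsolutelyContinuousOnInterval f a b) (hg : IntegrableOn g (Set.Icc a b))
    (hd : ∀ᵐ t, t ∈ Set.Icc a b → HasDerivAt f (g t) t) :
    f b = f a + ∫ s in a..b, g s := by
  have hgi : IntervalIntegrable g volume a b :=
    (intervalIntegrable_iff_integrableOn_Icc_of_le hab).2 hg
  have hac := hf.fun_sub (absolutelyContinuousOnInterval_intervalIntegral_pi hgi)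
  obtain ⟨C, hC⟩ := hac.const_of_ae_hasDerivAt_zero (by
    filter_upwards [hd, hgi.ae_hasDerivAt_integral] with t h1 h2 ht
    rw [Set.uIcc_of_le hab] at ht h2
    simpa using (h1 ht).fun_sub (h2 ht a (Set.left_mem_Icc.2 hab)))
  have h1 := hC a Set.left_mem_uIcc
  have h2 := hC b Set.right_mem_uIcc
  simp only [intervalIntegral.integral_same, sub_zero] at h1
  rw [h1, ← h2, sub_add_cancel]

theorem eq_of_absolutelyContinuousOnInterval_of_deriv_zero {F : Type*} [NormedAddCommGroup F]
    [NormedSpace ℝ F] {f : ℝ → F} {a b : ℝ} (hab : a ≤ b)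
    (hf : AbsolutelyContinuousOnInterval f a b)
    (hd : ∀ᵐ t, t ∈ Set.Icc a b → HasDerivAt f 0 t) : f b = f a := by
  obtain ⟨C, hC⟩ := hf.const_of_ae_hasDerivAt_zero (by rwa [Set.uIcc_of_le hab])
  rw [hC b Set.right_mem_uIcc, hC a Set.left_mem_uIcc]

/-- The converse of the fundamental theorem of calculus, an integral equation. -/
theorem absolutelyContinuousOnInterval_of_integral {f g : ℝ → ι → ℝ} {a b : ℝ} (hab : a ≤ b)
    (hg : IntegrableOn g (Set.Icc a b))
    (h : ∀ t ∈ Set.Icc a b, f t = f a + ∫ s in a..t, g s) :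
    AbsolutelyContinuousOnInterval f a b ∧
      ∀ᵐ t, t ∈ Set.Icc a b → HasDerivAt f (g t) t := by
  have hgi : IntervalIntegrable g volume a b :=
    (intervalIntegrable_iff_integrableOn_Icc_of_le hab).2 hg
  constructor
  · refine absolutelyContinuousOnInterval_congr
      ((absolutelyContinuousOnInterval_const (f a) a b).fun_add
      (absolutelyContinuousOnInterval_intervalIntegral_pi hgi)) fun t ht => ?_
    rw [Set.uIcc_of_le hab] at ht
    exact (h t ht).symm
  · have ha : ∀ᵐ t : ℝ, t ≠ a := by simp [ae_iff, measure_singleton]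
    have hb : ∀ᵐ t : ℝ, t ≠ b := by simp [ae_iff, measure_singleton]
    filter_upwards [hgi.ae_hasDerivAt_integral, ha, hb] with t h2 hta htb ht
    rw [Set.uIcc_of_le hab] at h2
    have h3 := (h2 ht a (Set.left_mem_Icc.2 hab)).const_add (f a)
    refine h3.congr_of_eventuallyEq ?_
    filter_upwards [Icc_mem_nhds (lt_of_le_of_ne ht.1 hta.symm) (lt_of_le_of_ne ht.2 htb)]
      with s hs using h s hs

end AbsolutelyContinuous

section TimeInterval

variable {I : Set ℝ}

/-- A time interval is exhausted by compact subintervals. -/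
theorem IsTimeInterval.exists_Icc (hI : IsTimeInterval I) (N : ℝ) :
    ∃ a b, Set.Icc a b ⊆ I ∧ I ∩ Set.Icc (-N) N ⊆ Set.Icc a b := by
  rcases hI with rfl | ⟨a, rfl⟩ | ⟨a, rfl⟩ | ⟨a, b, -, rfl⟩
  · exact ⟨-N, N, Set.subset_univ _, fun t ht => ht.2⟩
  · exact ⟨a, N, fun t ht => ht.1, fun t ht => ⟨ht.1, ht.2.2⟩⟩
  · exact ⟨-N, a, fun t ht => ht.2, fun t ht => ⟨ht.2.1, ht.1⟩⟩
  · exact ⟨a, b, subset_rfl, fun t ht => ht.1⟩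

theorem IsTimeInterval.isClosed (hI : IsTimeInterval I) : IsClosed I := by
  rcases hI with rfl | ⟨a, rfl⟩ | ⟨a, rfl⟩ | ⟨a, b, -, rfl⟩
  exacts [isClosed_univ, isClosed_Ici, isClosed_Iic, isClosed_Icc]

theorem IsTimeInterval.ordConnected (hI : IsTimeInterval I) : I.OrdConnected := by
  rcases hI with rfl | ⟨a, rfl⟩ | ⟨a, rfl⟩ | ⟨a, b, -, rfl⟩
  exacts [Set.ordConnected_univ, Set.ordConnected_Ici, Set.ordConnected_Iic, Set.ordConnected_Icc]

theorem IsTimeInterval.subset_closure_interior (hI : IsTimeInterval I) :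
    I ⊆ closure (interior I) := by
  rcases hI with rfl | ⟨a, rfl⟩ | ⟨a, rfl⟩ | ⟨a, b, hab, rfl⟩
  · simp
  · simp
  · simp
  · simp [closure_Ioo hab.ne]

theorem isTimeInterval_Ici (a : ℝ) : IsTimeInterval (Set.Ici a) := .inr (.inl ⟨a, rfl⟩)

theorem isTimeInterval_Icc {a b : ℝ} (h : a < b) : IsTimeInterval (Set.Icc a b) :=
  .inr (.inr (.inr ⟨a, b, h, rfl⟩))

theorem IsTimeInterval.ae_of_forall_Icc (hI : IsTimeInterval I) {p : ℝ → Prop}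
    (h : ∀ a b, Set.Icc a b ⊆ I → ∀ᵐ t, t ∈ Set.Icc a b → p t) :
    ∀ᵐ t ∂(volume.restrict I), p t := by
  rw [ae_restrict_iff' hI.isClosed.measurableSet]
  choose a b hab hcov using fun N : ℕ => hI.exists_Icc N
  filter_upwards [ae_all_iff.2 fun N => h (a N) (b N) (hab N)] with t ht htI
  obtain ⟨N, hN⟩ := exists_nat_ge |t|
  exact ht N (hcov N ⟨htI, abs_le.1 hN⟩)

theorem IsTimeInterval.locallyIntegrableOn_iff {F : Type*} [NormedAddCommGroup F]
    (hI : IsTimeInterval I) {f : ℝ → F} :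
    LocallyIntegrableOn f I ↔ ∀ a b, Set.Icc a b ⊆ I → IntegrableOn f (Set.Icc a b) := by
  refine ⟨fun h a b hab => h.integrableOn_compact_subset hab isCompact_Icc, fun h => ?_⟩
  rw [MeasureTheory.locallyIntegrableOn_iff hI.isClosed.isLocallyClosed]
  intro k hk hc
  obtain ⟨N, hN⟩ := hc.isBounded.exists_norm_le
  obtain ⟨a, b, hab, hcov⟩ := hI.exists_Icc N
  exact (h a b hab).mono_set fun t ht => hcov ⟨hk ht, abs_le.1 (hN t ht)⟩

theorem IsTimeInterval.continuousOn_of_Icc {F : Type*} [TopologicalSpace F]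
    (hI : IsTimeInterval I) {f : ℝ → F}
    (h : ∀ a b, a ≤ b → Set.Icc a b ⊆ I → ContinuousOn f (Set.Icc a b)) : ContinuousOn f I := by
  intro t ht
  obtain ⟨a, b, hab, hcov⟩ := hI.exists_Icc (|t| + 1)
  have hmem : Set.Icc a b ∈ 𝓝[I] t := by
    refine mem_of_superset (inter_mem self_mem_nhdsWithin (mem_nhdsWithin_of_mem_nhds
      (Icc_mem_nhds (a := -(|t| + 1)) (b := |t| + 1) ?_ ?_))) hcov
    · linarith [neg_abs_le t]
    · linarith [le_abs_self t]
  have htab : t ∈ Set.Icc a b := mem_of_mem_nhdsWithin ht hmem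
  exact (h a b (htab.1.trans htab.2) hab t htab).mono_of_mem_nhdsWithin hmem

theorem LocallyAC.continuousOn {d : ℕ} {f : ℝ → Fin d → ℝ} (hI : IsTimeInterval I)
    (hf : LocallyAC f I) : ContinuousOn f I :=
  hI.continuousOn_of_Icc fun a b hab h => by
    simpa [Set.uIcc_of_le hab] using (hf a b hab h).continuousOn

theorem LocallyAC.mono {d : ℕ} {f : ℝ → Fin d → ℝ} {J : Set ℝ} (hf : LocallyAC f I) (h : J ⊆ I) :
    LocallyAC f J := fun a b hab hJ => hf a b hab (hJ.trans h)

theorem LocallyAC.mulVec {d e : ℕ} {f : ℝ → Fin d → ℝ} (M : Matrix (Fin e) (Fin d) ℝ)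
    (hf : LocallyAC f I) : LocallyAC (fun t => M *ᵥ f t) I :=
  fun a b hab h => absolutelyContinuousOnInterval_mulVec M (hf a b hab h)

/-- The differential and the integral form of `ḟ = g` on a time interval. -/
theorem IsTimeInterval.locallyAC_iff_integral {d : ℕ} (hI : IsTimeInterval I)
    {f g : ℝ → Fin d → ℝ} (hg : LocallyIntegrableOn g I) :
    (LocallyAC f I ∧ ∀ᵐ t ∂(volume.restrict I), HasDerivAt f (g t) t) ↔
      ∀ a ∈ I, ∀ b ∈ I, a ≤ b → f b = f a + ∫ s in a..b, g s := by
  constructor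
  · rintro ⟨hf, hd⟩ a ha b hb hab
    have hsub : Set.Icc a b ⊆ I := hI.ordConnected.out ha hb
    refine eq_add_integral_of_absolutelyContinuousOnInterval hab (hf a b hab hsub)
      (hI.locallyIntegrableOn_iff.1 hg a b hsub) ?_
    rw [ae_restrict_iff' hI.isClosed.measurableSet] at hd
    filter_upwards [hd] with t ht hmem using ht (hsub hmem)
  · intro h
    have key : ∀ a b, a ≤ b → Set.Icc a b ⊆ I → AbsolutelyContinuousOnInterval f a b ∧
        ∀ᵐ t, t ∈ Set.Icc a b → HasDerivAt f (g t) t := fun a b hab hsub =>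
      absolutelyContinuousOnInterval_of_integral hab (hI.locallyIntegrableOn_iff.1 hg a b hsub)
        fun t ht => h a (hsub (Set.left_mem_Icc.2 hab)) t (hsub ht) ht.1
    refine ⟨fun a b hab hsub => (key a b hab hsub).1, hI.ae_of_forall_Icc fun a b hsub => ?_⟩
    rcases le_or_gt a b with hab | hab
    · exact (key a b hab hsub).2
    · simp [Set.Icc_eq_empty_of_lt hab]

theorem locallyIntegrableOn_mulVec {ι κ : Type*} [Fintype ι] [Fintype κ] (M : Matrix κ ι ℝ)
    {f : ℝ → ι → ℝ} (hI : IsTimeInterval I) (hf : LocallyIntegrableOn f I) :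
    LocallyIntegrableOn (fun t => M *ᵥ f t) I :=
  hI.locallyIntegrableOn_iff.2 fun a b hab =>
    (mulVecCLM M).integrable_comp (hI.locallyIntegrableOn_iff.1 hf a b hab)

end TimeInterval

/-! ### Linear control systems: existence, duality and smooth steering -/

section LinearSystems

variable {r k : ℕ}

/-- The inhomogeneous linear equation with continuous right-hand side has a solution. -/
theorem exists_hasDerivAt_linear (M : Matrix (Fin r) (Fin r) ℝ) {g : ℝ → Fin r → ℝ}
    (hg : Continuous g) (p₀ : Fin r → ℝ) :
    ∃ p : ℝ → Fin r → ℝ, p 0 = p₀ ∧ ∀ t, HasDerivAt p (M *ᵥ p t + g t) t := by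
  set L : (Fin r → ℝ) →L[ℝ] (Fin r → ℝ) := mulVecCLM M with hL
  let Φ : ℝ → (Fin r → ℝ) →L[ℝ] (Fin r → ℝ) := fun t => NormedSpace.exp (t • L)
  have hΦ : ∀ t, HasDerivAt Φ (L * Φ t) t := fun t => hasDerivAt_exp_smul_const' L t
  let _ : NormedAlgebra ℚ ((Fin r → ℝ) →L[ℝ] (Fin r → ℝ)) := NormedAlgebra.restrictScalars ℚ ℝ _
  have hinv : ∀ t v, Φ t (Φ (-t) v) = v := fun t v => by
    have h := NormedSpace.exp_add_of_commute (x := t • L) (y := (-t) • L)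
      (((Commute.refl L).smul_left t).smul_right (-t))
    rw [← add_smul, add_neg_cancel, zero_smul, NormedSpace.exp_zero] at h
    exact (DFunLike.congr_fun h v).symm
  have hΦc : Continuous Φ := continuous_iff_continuousAt.2 fun t => (hΦ t).continuousAt
  have hint : Continuous fun s => Φ (-s) (g s) := (hΦc.comp continuous_neg).clm_apply hg
  refine ⟨fun t => Φ t (p₀ + ∫ s in (0 : ℝ)..t, Φ (-s) (g s)), ?_, fun t => ?_⟩
  · simp [Φ]
  · have h1 : HasDerivAt (fun t => p₀ + ∫ s in (0 : ℝ)..t, Φ (-s) (g s)) (Φ (-t) (g t)) t :=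
      (hint.integral_hasStrictDerivAt 0 t).hasDerivAt.const_add p₀
    have h2 := (hΦ t).clm_apply h1
    rw [hinv] at h2
    exact h2

/-- The homogeneous linear equation with a prescribed value at time `t₀` has a solution. -/
theorem exists_hasDerivAt_linear_at (M : Matrix (Fin r) (Fin r) ℝ) (t₀ : ℝ) (p₀ : Fin r → ℝ) :
    ∃ p : ℝ → Fin r → ℝ, p t₀ = p₀ ∧ ∀ t, HasDerivAt p (M *ᵥ p t) t := by
  obtain ⟨p, h0, h⟩ := exists_hasDerivAt_linear M (g := fun _ => 0) continuous_const p₀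
  refine ⟨fun t => p (t - t₀), by simpa using h0, fun t => ?_⟩
  have := (h (t - t₀)).scomp t ((hasDerivAt_id t).sub_const t₀)
  simpa [Function.comp_def] using this

variable (A : Matrix (Fin r) (Fin r) ℝ) (B : Matrix (Fin r) (Fin k) ℝ)

/-- `φ` solves the adjoint equation `φ̇ = -Aᵀ φ`. -/
def IsAdjoint (φ : ℝ → Fin r → ℝ) : Prop := ∀ t, HasDerivAt φ (-(Aᵀ *ᵥ φ t)) t

theorem exists_isAdjoint (T : ℝ) (ζ : Fin r → ℝ) : ∃ φ, IsAdjoint A φ ∧ φ T = ζ := by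
  obtain ⟨φ, h0, h⟩ := exists_hasDerivAt_linear_at (-Aᵀ) T ζ
  exact ⟨φ, fun t => by simpa [Matrix.neg_mulVec] using h t, h0⟩

variable {A B}

theorem IsAdjoint.continuous {φ : ℝ → Fin r → ℝ} (hφ : IsAdjoint A φ) : Continuous φ :=
  continuous_iff_continuousAt.2 fun t => (hφ t).continuousAt

theorem IsAdjoint.hasDerivAt_dotProduct {φ p : ℝ → Fin r → ℝ} (hφ : IsAdjoint A φ) {w : Fin k → ℝ}
    {t : ℝ} (hp : HasDerivAt p (A *ᵥ p t + B *ᵥ w) t) :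
    HasDerivAt (fun s => φ s ⬝ᵥ p s) ((Bᵀ *ᵥ φ t) ⬝ᵥ w) t := by
  have h := DaeLQ.hasDerivAt_dotProduct (hφ t) hp
  have e1 : (Aᵀ *ᵥ φ t) ⬝ᵥ p t = φ t ⬝ᵥ (A *ᵥ p t) := by
    rw [← dotProduct_transpose_mulVec, Matrix.transpose_transpose]
  have e2 : (Bᵀ *ᵥ φ t) ⬝ᵥ w = φ t ⬝ᵥ (B *ᵥ w) := by
    rw [← dotProduct_transpose_mulVec, Matrix.transpose_transpose]
  convert h using 1
  rw [neg_dotProduct, e1, e2, dotProduct_add]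
  ring

theorem absolutelyContinuousOnInterval_of_hasDerivAt {F : Type*} [NormedAddCommGroup F]
    [NormedSpace ℝ F] {f f' : ℝ → F} (h : ∀ t, HasDerivAt f (f' t) t) (hf' : Continuous f')
    (a b : ℝ) : AbsolutelyContinuousOnInterval f a b := by
  have hd : deriv f = f' := funext fun t => (h t).deriv
  have : ContDiff ℝ 1 f := contDiff_one_iff_deriv.2
    ⟨fun t => (h t).differentiableAt, by rwa [hd]⟩
  exact this.contDiffOn.absolutelyContinuousOnInterval

theorem IsAdjoint.absolutelyContinuous {φ : ℝ → Fin r → ℝ} (hφ : IsAdjoint A φ) (a b : ℝ) :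
    AbsolutelyContinuousOnInterval φ a b :=
  absolutelyContinuousOnInterval_of_hasDerivAt hφ
    (((mulVecCLM Aᵀ).continuous.comp hφ.continuous).neg) a b

/-- An adjoint solution not seen by the inputs is constant along the trajectories. -/
theorem IsAdjoint.dotProduct_eq {φ p : ℝ → Fin r → ℝ} {q : ℝ → Fin k → ℝ} (hφ : IsAdjoint A φ)
    {T : ℝ} (hT : 0 ≤ T) (hB : ∀ t ∈ Set.Icc 0 T, Bᵀ *ᵥ φ t = 0)
    (hp : AbsolutelyContinuousOnInterval p 0 T)
    (hd : ∀ᵐ t, t ∈ Set.Icc 0 T → HasDerivAt p (A *ᵥ p t + B *ᵥ q t) t) :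
    φ T ⬝ᵥ p T = φ 0 ⬝ᵥ p 0 := by
  refine eq_of_absolutelyContinuousOnInterval_of_deriv_zero (f := fun t => φ t ⬝ᵥ p t) hT
    (absolutelyContinuousOnInterval_dotProduct (hφ.absolutelyContinuous 0 T) hp) ?_
  filter_upwards [hd] with t ht hmem
  simpa [hB t hmem] using hφ.hasDerivAt_dotProduct (ht hmem)

/-- An absolutely continuous solution of `ṗ = A p` that starts at zero vanishes. -/
theorem eq_zero_of_linear {p : ℝ → Fin r → ℝ} {T : ℝ} (hT : 0 ≤ T)
    (hp : AbsolutelyContinuousOnInterval p 0 T)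
    (hd : ∀ᵐ t, t ∈ Set.Icc 0 T → HasDerivAt p (A *ᵥ p t) t) (h0 : p 0 = 0) : p T = 0 := by
  obtain ⟨φ, hφ, hφT⟩ := exists_isAdjoint A T (p T)
  have h := hφ.dotProduct_eq (B := (0 : Matrix (Fin r) (Fin 1) ℝ)) (q := 0) hT (by simp) hp
    (by simpa using hd)
  rw [hφT, h0, dotProduct_zero] at h
  exact dotProduct_self_eq_zero.1 h

variable (A B) in
/-- `p` is a trajectory on `ℝ` with the continuous input `q`. -/
structure IsSmoothTrajectory (p : ℝ → Fin r → ℝ) (q : ℝ → Fin k → ℝ) : Prop where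
  continuous_input : Continuous q
  hasDerivAt : ∀ t, HasDerivAt p (A *ᵥ p t + B *ᵥ q t) t

theorem IsSmoothTrajectory.continuous {p : ℝ → Fin r → ℝ} {q : ℝ → Fin k → ℝ}
    (h : IsSmoothTrajectory A B p q) : Continuous p :=
  continuous_iff_continuousAt.2 fun t => (h.hasDerivAt t).continuousAt

theorem IsSmoothTrajectory.continuous_deriv {p : ℝ → Fin r → ℝ} {q : ℝ → Fin k → ℝ}
    (h : IsSmoothTrajectory A B p q) : Continuous fun t => A *ᵥ p t + B *ᵥ q t :=
  ((mulVecCLM A).continuous.comp h.continuous).add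
    ((mulVecCLM B).continuous.comp h.continuous_input)

theorem IsSmoothTrajectory.absolutelyContinuous {p : ℝ → Fin r → ℝ} {q : ℝ → Fin k → ℝ}
    (h : IsSmoothTrajectory A B p q) (a b : ℝ) : AbsolutelyContinuousOnInterval p a b :=
  absolutelyContinuousOnInterval_of_hasDerivAt h.hasDerivAt h.continuous_deriv a b

theorem IsSmoothTrajectory.add {p p' : ℝ → Fin r → ℝ} {q q' : ℝ → Fin k → ℝ}
    (h : IsSmoothTrajectory A B p q) (h' : IsSmoothTrajectory A B p' q') :
    IsSmoothTrajectory A B (fun t => p t + p' t) (fun t => q t + q' t) where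
  continuous_input := h.continuous_input.add h'.continuous_input
  hasDerivAt t := by
    refine ((h.hasDerivAt t).fun_add (h'.hasDerivAt t)).congr_deriv ?_
    simp only [Matrix.mulVec_add]
    abel

theorem IsSmoothTrajectory.const_smul {p : ℝ → Fin r → ℝ} {q : ℝ → Fin k → ℝ} (c : ℝ)
    (h : IsSmoothTrajectory A B p q) :
    IsSmoothTrajectory A B (fun t => c • p t) (fun t => c • q t) where
  continuous_input := h.continuous_input.const_smul c
  hasDerivAt t := by
    refine ((h.hasDerivAt t).fun_const_smul c).congr_deriv ?_
    simp only [Matrix.mulVec_smul, smul_add]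

theorem exists_isSmoothTrajectory {q : ℝ → Fin k → ℝ} (hq : Continuous q) (p₀ : Fin r → ℝ) :
    ∃ p, IsSmoothTrajectory A B p q ∧ p 0 = p₀ := by
  obtain ⟨p, h0, h⟩ := exists_hasDerivAt_linear A ((mulVecCLM B).continuous.comp hq) p₀
  exact ⟨p, ⟨hq, h⟩, h0⟩

variable (A B) in
/-- The states reached from zero in time `T` with continuous inputs. -/
def reachable (T : ℝ) : Submodule ℝ (Fin r → ℝ) where
  carrier := {d | ∃ p q, IsSmoothTrajectory A B p q ∧ p 0 = 0 ∧ p T = d}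
  add_mem' := by
    rintro _ _ ⟨p, q, h, h0, rfl⟩ ⟨p', q', h', h0', rfl⟩
    exact ⟨_, _, h.add h', by simp [h0, h0'], rfl⟩
  zero_mem' := ⟨fun _ => 0, fun _ => 0,
    ⟨continuous_const, fun t => by simpa using hasDerivAt_const t (0 : Fin r → ℝ)⟩, rfl, rfl⟩
  smul_mem' := by
    rintro c _ ⟨p, q, h, h0, rfl⟩
    exact ⟨_, _, h.const_smul c, by simp [h0], rfl⟩

/-- A state is reachable when it is annihilated by the end values of all adjoint solutions that
the inputs do not see. A functional `ζ` vanishing on the reachable states yields such an adjoint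
solution `φ`: applied to the state reached with the input `Bᵀ φ` it gives `∫ |Bᵀ φ|²`. -/
theorem mem_reachable {T : ℝ} (hT : 0 < T) {d : Fin r → ℝ}
    (h : ∀ φ, IsAdjoint A φ → (∀ t ∈ Set.Icc 0 T, Bᵀ *ᵥ φ t = 0) → φ T ⬝ᵥ d = 0) :
    d ∈ reachable A B T := by
  by_contra hd
  obtain ⟨f, hfd, hf⟩ := Submodule.exists_le_ker_of_notMem hd
  obtain ⟨ζ, hζ⟩ : ∃ ζ : Fin r → ℝ, ∀ v, f v = ζ ⬝ᵥ v := by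
    refine ⟨(dotProductEquiv ℝ (Fin r)).symm f, fun v => ?_⟩
    conv_lhs => rw [← (dotProductEquiv ℝ (Fin r)).apply_symm_apply f]
    rfl
  obtain ⟨φ, hφ, hφT⟩ := exists_isAdjoint A T ζ
  have hq : Continuous fun t => Bᵀ *ᵥ φ t := (mulVecCLM Bᵀ).continuous.comp hφ.continuous
  obtain ⟨p, hp, hp0⟩ := exists_isSmoothTrajectory (A := A) (B := B) hq 0
  have hmem : p T ∈ reachable A B T := ⟨p, _, hp, hp0, rfl⟩
  have h1 : ζ ⬝ᵥ p T = 0 := by rw [← hζ]; exact hf hmem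
  have hcont : Continuous fun t => (Bᵀ *ᵥ φ t) ⬝ᵥ (Bᵀ *ᵥ φ t) := by
    simp only [dotProduct]
    fun_prop
  have h2 : ∫ t in (0 : ℝ)..T, (Bᵀ *ᵥ φ t) ⬝ᵥ (Bᵀ *ᵥ φ t) = 0 := by
    rw [intervalIntegral.integral_eq_sub_of_hasDerivAt
      (fun t _ => hφ.hasDerivAt_dotProduct (hp.hasDerivAt t)) (hcont.intervalIntegrable 0 T),
      hφT, h1, hp0, dotProduct_zero, sub_zero]
  have h3 : ∀ t ∈ Set.Icc 0 T, Bᵀ *ᵥ φ t = 0 := by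
    intro t ht
    by_contra hne
    exact (intervalIntegral.integral_pos hT hcont.continuousOn
      (fun s _ => zero_le_dotProduct_self _) ⟨t, ht, dotProduct_self_pos hne⟩).ne' h2
  exact hfd (by rw [hζ, ← hφT]; exact h φ hφ h3)

/-- An integrable input can be replaced by a continuous one with the same effect at the end. -/
theorem exists_smooth_same_endpoint {p : ℝ → Fin r → ℝ} {q : ℝ → Fin k → ℝ} {T : ℝ} (hT : 0 < T)
    (hp : AbsolutelyContinuousOnInterval p 0 T)
    (hd : ∀ᵐ t, t ∈ Set.Icc 0 T → HasDerivAt p (A *ᵥ p t + B *ᵥ q t) t) :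
    ∃ p' q', IsSmoothTrajectory A B p' q' ∧ p' 0 = p 0 ∧ p' T = p T := by
  obtain ⟨p₁, h₁, h₁0⟩ := exists_isSmoothTrajectory (A := A) (B := B)
    (continuous_const (y := (0 : Fin k → ℝ))) (p 0)
  obtain ⟨p₂, q₂, h₂, h₂0, h₂T⟩ : p T - p₁ T ∈ reachable A B T := by
    refine mem_reachable hT fun φ hφ hB => ?_
    rw [dotProduct_sub, hφ.dotProduct_eq hT.le hB hp hd,
      hφ.dotProduct_eq hT.le hB (h₁.absolutelyContinuous 0 T)
        (Eventually.of_forall fun t _ => h₁.hasDerivAt t), h₁0, sub_self]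
  exact ⟨_, _, h₁.add h₂, by simp [h₁0, h₂0], by simp [h₂T]⟩

/-- The states in the range of `B` are steered to zero in finite time. -/
theorem exists_smooth_steer_zero (w : Fin k → ℝ) :
    ∃ p q, IsSmoothTrajectory A B p q ∧ p 0 = B *ᵥ w ∧ p 1 = 0 := by
  obtain ⟨p₁, h₁, h₁0⟩ := exists_isSmoothTrajectory (A := A) (B := B)
    (continuous_const (y := (0 : Fin k → ℝ))) (B *ᵥ w)
  obtain ⟨p₂, q₂, h₂, h₂0, h₂T⟩ : -p₁ 1 ∈ reachable A B 1 := by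
    refine mem_reachable one_pos fun φ hφ hB => ?_
    rw [dotProduct_neg, hφ.dotProduct_eq zero_le_one hB (h₁.absolutelyContinuous 0 1)
        (Eventually.of_forall fun t _ => h₁.hasDerivAt t), h₁0]
    have := dotProduct_transpose_mulVec Bᵀ (φ 0) w
    rw [Matrix.transpose_transpose, hB 0 (by simp)] at this
    simp [this]
  exact ⟨_, _, h₁.add h₂, by simp [h₁0, h₂0], by simp [h₂T]⟩

end LinearSystems

/-! ### Trajectories of an ODE-LTI -/

section Trajectories

variable {r k n m : ℕ} {S : OdeLti r k n m} {I : Set ℝ} {p p' : ℝ → Fin r → ℝ}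
  {q q' : ℝ → Fin k → ℝ}

theorem OdeLti.IsTrajectory.mono (h : S.IsTrajectory I p q) {J : Set ℝ} (hJ : J ⊆ I) :
    S.IsTrajectory J p q :=
  ⟨h.1.mono hJ, h.2.1.mono_set hJ, ae_restrict_of_ae_restrict_of_subset hJ h.2.2⟩

theorem OdeLti.IsTrajectory.ae_Icc (h : S.IsTrajectory I p q) {a b : ℝ} (hab : Set.Icc a b ⊆ I) :
    ∀ᵐ t, t ∈ Set.Icc a b → HasDerivAt p (S.A *ᵥ p t + S.B *ᵥ q t) t :=
  (ae_restrict_iff' measurableSet_Icc).1 (h.mono hab).2.2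

theorem OdeLti.IsTrajectory.add (h : S.IsTrajectory I p q) (h' : S.IsTrajectory I p' q') :
    S.IsTrajectory I (fun t => p t + p' t) (fun t => q t + q' t) := by
  refine ⟨fun a b hab hI => (h.1 a b hab hI).fun_add (h'.1 a b hab hI), h.2.1.add h'.2.1, ?_⟩
  filter_upwards [h.2.2, h'.2.2] with t ht ht'
  refine (ht.fun_add ht').congr_deriv ?_
  simp only [Matrix.mulVec_add]
  abel

theorem OdeLti.IsTrajectory.const_smul (c : ℝ) (h : S.IsTrajectory I p q) :
    S.IsTrajectory I (fun t => c • p t) (fun t => c • q t) := by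
  refine ⟨fun a b hab hI => (h.1 a b hab hI).const_smul c, h.2.1.smul c, ?_⟩
  filter_upwards [h.2.2] with t ht
  refine (ht.fun_const_smul c).congr_deriv ?_
  simp only [Matrix.mulVec_smul, smul_add]

theorem OdeLti.IsTrajectory.locallyIntegrableOn_rhs (hI : IsTimeInterval I)
    (h : S.IsTrajectory I p q) :
    LocallyIntegrableOn (fun t => S.A *ᵥ p t + S.B *ᵥ q t) I :=
  (locallyIntegrableOn_mulVec S.A hI
    ((h.1.continuousOn hI).locallyIntegrableOn hI.isClosed.measurableSet)).add
    (locallyIntegrableOn_mulVec S.B hI h.2.1)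

theorem OdeLti.IsTrajectory.integral_eq (hI : IsTimeInterval I) (h : S.IsTrajectory I p q) :
    ∀ a ∈ I, ∀ b ∈ I, a ≤ b → p b = p a + ∫ s in a..b, (S.A *ᵥ p s + S.B *ᵥ q s) :=
  (hI.locallyAC_iff_integral (h.locallyIntegrableOn_rhs hI)).1 ⟨h.1, h.2.2⟩

theorem OdeLti.IsTrajectory.shift (h : S.IsTrajectory (Set.Ici 0) p q) {s : ℝ} (hs : 0 ≤ s) :
    S.IsTrajectory (Set.Ici 0) (fun t => p (t + s)) (fun t => q (t + s)) := by
  have hI := isTimeInterval_Ici 0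
  have hsub : ∀ {a b : ℝ}, Set.Icc a b ⊆ Set.Ici 0 → Set.Icc (a + s) (b + s) ⊆ Set.Ici 0 := by
    intro a b hab t ht
    have : t - s ∈ Set.Icc a b := ⟨by linarith [ht.1], by linarith [ht.2]⟩
    have := hab this
    simp only [Set.mem_Ici] at this ⊢
    linarith
  have hq : LocallyIntegrableOn (fun t => q (t + s)) (Set.Ici 0) := by
    refine hI.locallyIntegrableOn_iff.2 fun a b hab => ?_
    have h1 := hI.locallyIntegrableOn_iff.1 h.2.1 _ _ (hsub hab)
    have h2 := ((measurePreserving_add_right volume s).integrableOn_comp_preimage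
      (measurableEmbedding_addRight s) (f := q) (s := Set.Icc (a + s) (b + s))).2 h1
    simpa [Function.comp_def] using h2
  have hpc : ContinuousOn (fun t => p (t + s)) (Set.Ici 0) :=
    (h.1.continuousOn hI).comp (by fun_prop) fun t ht => by
      simp only [Set.mem_Ici] at ht ⊢
      linarith
  have hrhs : LocallyIntegrableOn (fun t => S.A *ᵥ p (t + s) + S.B *ᵥ q (t + s)) (Set.Ici 0) :=
    (locallyIntegrableOn_mulVec S.A hI (hpc.locallyIntegrableOn measurableSet_Ici)).add
      (locallyIntegrableOn_mulVec S.B hI hq)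
  obtain ⟨h1, h2⟩ := (hI.locallyAC_iff_integral (f := fun t => p (t + s)) hrhs).2
    fun a ha b hb hab => by
      simp only [Set.mem_Ici] at ha hb
      rw [intervalIntegral.integral_comp_add_right (fun t => S.A *ᵥ p t + S.B *ᵥ q t) s]
      exact h.integral_eq hI _ (add_nonneg ha hs) _ (add_nonneg hb hs) (by linarith)
  exact ⟨h1, hq, h2⟩

theorem IsSmoothTrajectory.isTrajectory (h : IsSmoothTrajectory S.A S.B p q) (I : Set ℝ) :
    S.IsTrajectory I p q :=
  ⟨fun a b _ _ => h.absolutelyContinuous a b,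
    h.continuous_input.locallyIntegrable.locallyIntegrableOn I,
    Eventually.of_forall fun t => h.hasDerivAt t⟩

/-- A smooth trajectory that reaches zero at time `1` can be stopped there. -/
theorem IsSmoothTrajectory.isTrajectory_stopped (h : IsSmoothTrajectory S.A S.B p q)
    (h1 : p 1 = 0) :
    S.IsTrajectory (Set.Ici 0) (fun t => p (min t 1)) ((Set.Iio 1).indicator q) := by
  refine ⟨fun a b hab _ => ?_, ?_, ae_restrict_of_ae ?_⟩
  · have hd : deriv p = fun t => S.A *ᵥ p t + S.B *ᵥ q t := funext fun t => (h.hasDerivAt t).deriv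
    have hC : ContDiff ℝ 1 p := contDiff_one_iff_deriv.2
      ⟨fun t => (h.hasDerivAt t).differentiableAt, by rw [hd]; exact h.continuous_deriv⟩
    obtain ⟨K, hK⟩ := hC.contDiffOn.exists_lipschitzOnWith (s := Set.Icc (min a 1) 1) (by decide)
      (convex_Icc _ _) isCompact_Icc
    have hmin : LipschitzWith 1 fun t : ℝ => min t 1 := LipschitzWith.id.min_const 1
    refine (hK.comp (hmin.lipschitzOnWith (s := Set.uIcc a b)) fun t ht => ?_)
      |>.absolutelyContinuousOnInterval
    rw [Set.uIcc_of_le hab] at ht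
    exact ⟨min_le_min_right 1 ht.1, min_le_right _ _⟩
  · exact (h.continuous_input.locallyIntegrable.indicator measurableSet_Iio).locallyIntegrableOn _
  · have hne : ∀ᵐ t : ℝ, t ≠ 1 := by simp [ae_iff, measure_singleton]
    filter_upwards [hne] with t ht
    rcases lt_or_gt_of_ne ht with hlt | hgt
    · rw [Set.indicator_of_mem (Set.mem_Iio.2 hlt), min_eq_left hlt.le]
      refine (h.hasDerivAt t).congr_of_eventuallyEq ?_
      filter_upwards [Iio_mem_nhds hlt] with s hs
      rw [min_eq_left (le_of_lt hs)]
    · rw [Set.indicator_of_notMem (by simpa using hgt.le), min_eq_right hgt.le, h1]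
      simp only [Matrix.mulVec_zero, add_zero]
      refine (hasDerivAt_const t (0 : Fin r → ℝ)).congr_of_eventuallyEq ?_
      filter_upwards [Ioi_mem_nhds hgt] with s hs
      rw [min_eq_right (le_of_lt hs), h1]

end Trajectories

/-! ### The stabilizability subspace and the stabilizable part -/

section Stabilizability

variable {r k n m l l' c : ℕ} {S : OdeLti r k n m}

/-- The stabilizability subspace as a submodule. -/
def stabilizabilitySubmodule (S : OdeLti r k n m) : Submodule ℝ (Fin r → ℝ) where
  carrier := S.stabilizabilitySubspace
  add_mem' := by
    rintro _ _ ⟨p, q, h, rfl, ht⟩ ⟨p', q', h', rfl, ht'⟩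
    exact ⟨_, _, h.add h', rfl, by simpa using ht.add ht'⟩
  zero_mem' := by
    have h : IsSmoothTrajectory S.A S.B (fun _ => 0) (fun _ => 0) :=
      ⟨continuous_const, fun t => by simpa using hasDerivAt_const t (0 : Fin r → ℝ)⟩
    exact ⟨_, _, h.isTrajectory _, rfl, tendsto_const_nhds⟩
  smul_mem' := by
    rintro c _ ⟨p, q, h, rfl, ht⟩
    exact ⟨_, _, h.const_smul c, rfl, by simpa using ht.const_smul c⟩

theorem mem_stabilizabilitySubmodule {p₀ : Fin r → ℝ} :
    p₀ ∈ stabilizabilitySubmodule S ↔ p₀ ∈ S.stabilizabilitySubspace := Iff.rfl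

/-- The range of `B` is stabilizable: its elements are steered to zero in finite time. -/
theorem mulVec_mem_stabilizabilitySubmodule (w : Fin k → ℝ) :
    S.B *ᵥ w ∈ stabilizabilitySubmodule S := by
  obtain ⟨p, q, h, h0, h1⟩ := exists_smooth_steer_zero (A := S.A) (B := S.B) w
  refine ⟨_, _, h.isTrajectory_stopped h1, by simp [h0], tendsto_const_nhds.congr' ?_⟩
  filter_upwards [eventually_ge_atTop 1] with t ht
  rw [min_eq_right ht, h1]

/-- Every subspace is mapped onto a coordinate subspace by some change of basis. -/
theorem exists_isStabilizabilityBasis (S : OdeLti r k n m) :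
    ∃ (l l' : ℕ) (T : Matrix (Fin l ⊕ Fin l') (Fin r) ℝ) (T' : Matrix (Fin r) (Fin l ⊕ Fin l') ℝ),
      S.IsStabilizabilityBasis T T' := by
  obtain ⟨W, hW⟩ := (stabilizabilitySubmodule S).exists_isCompl
  set V := stabilizabilitySubmodule S with hV
  let eV := (Module.finBasis ℝ V).equivFun
  let eW := (Module.finBasis ℝ W).equivFun
  let e : (Fin r → ℝ) ≃ₗ[ℝ] (Fin (Module.finrank ℝ V) ⊕ Fin (Module.finrank ℝ W) → ℝ) :=
    (Submodule.prodEquivOfIsCompl V W hW).symm.trans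
      ((eV.prodCongr eW).trans (LinearEquiv.sumArrowLequivProdArrow _ _ ℝ ℝ).symm)
  have hT : ∀ p, LinearMap.toMatrix' (e : (Fin r → ℝ) →ₗ[ℝ] _) *ᵥ p = e p := fun p =>
    LinearMap.toMatrix'_mulVec _ _
  refine ⟨_, _, LinearMap.toMatrix' (e : (Fin r → ℝ) →ₗ[ℝ] _),
    LinearMap.toMatrix' (e.symm.toLinearMap), ?_, ?_, ?_⟩
  · rw [← LinearMap.toMatrix'_comp]; simp
  · rw [← LinearMap.toMatrix'_comp]; simp
  · have hmem : ∀ p, p ∈ V ↔ ∀ j, e p (Sum.inr j) = 0 := by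
      intro p
      have h1 : ∀ j, e p (Sum.inr j) = eW ((Submodule.prodEquivOfIsCompl V W hW).symm p).2 j :=
        fun j => rfl
      simp only [h1]
      rw [← Submodule.prodEquivOfIsCompl_symm_apply_snd_eq_zero (h := hW)]
      constructor
      · intro h j
        rw [h, map_zero]; rfl
      · intro h
        exact eW.map_eq_zero_iff.1 (funext h)
    ext y
    simp only [hT, Set.mem_image, Set.mem_ofPred_eq]
    constructor
    · rintro ⟨p, hp, rfl⟩
      exact (hmem p).1 hp
    · intro hy
      exact ⟨e.symm y, (hmem _).2 (by simpa using hy), by simp⟩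

variable {T : Matrix (Fin l ⊕ Fin l') (Fin r) ℝ} {T' : Matrix (Fin r) (Fin l ⊕ Fin l') ℝ}

theorem stabilizablePart_A :
    (S.stabilizablePart T T').A = T.toRows₁ * S.A * T'.toCols₁ := rfl

theorem stabilizablePart_B : (S.stabilizablePart T T').B = T.toRows₁ * S.B := rfl

theorem stabilizablePart_C : (S.stabilizablePart T T').C = S.C * T'.toCols₁ := rfl

theorem stabilizablePart_D : (S.stabilizablePart T T').D = S.D := rfl

namespace OdeLti.IsStabilizabilityBasis

theorem toRows₁_mul_toCols₁ (hT : S.IsStabilizabilityBasis T T') :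
    T.toRows₁ * T'.toCols₁ = 1 := by
  ext i j
  have := congrFun (congrFun hT.1 (Sum.inl i)) (Sum.inl j)
  simpa [Matrix.mul_apply, Matrix.one_apply] using this

theorem toRows₂_mul_toCols₁ (hT : S.IsStabilizabilityBasis T T') :
    T.toRows₂ * T'.toCols₁ = 0 := by
  ext i j
  have := congrFun (congrFun hT.1 (Sum.inr i)) (Sum.inl j)
  simpa [Matrix.mul_apply, Matrix.one_apply] using this

theorem decomp (hT : S.IsStabilizabilityBasis T T') :
    T'.toCols₁ * T.toRows₁ + T'.toCols₂ * T.toRows₂ = 1 := by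
  rw [← hT.2.1]
  ext i j
  simp [Matrix.mul_apply]

theorem decomp_mulVec (hT : S.IsStabilizabilityBasis T T') (p : Fin r → ℝ) :
    T'.toCols₁ *ᵥ (T.toRows₁ *ᵥ p) + T'.toCols₂ *ᵥ (T.toRows₂ *ᵥ p) = p := by
  rw [Matrix.mulVec_mulVec, Matrix.mulVec_mulVec, ← Matrix.add_mulVec, hT.decomp,
    Matrix.one_mulVec]

theorem mem_iff (hT : S.IsStabilizabilityBasis T T') (p : Fin r → ℝ) :
    p ∈ stabilizabilitySubmodule S ↔ T.toRows₂ *ᵥ p = 0 := by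
  have h1 : T.toRows₂ *ᵥ p = 0 ↔ T *ᵥ p ∈ {y | ∀ j : Fin l', y (Sum.inr j) = 0} :=
    ⟨fun h j => congrFun h j, fun h => funext h⟩
  rw [h1, ← hT.2.2, mem_stabilizabilitySubmodule]
  constructor
  · exact fun h => ⟨p, h, rfl⟩
  · rintro ⟨p', hp', h⟩
    have h2 := congrArg (T' *ᵥ ·) h
    simp only [Matrix.mulVec_mulVec, hT.2.1, Matrix.one_mulVec] at h2
    exact h2 ▸ hp'

theorem toRows₂_mul_B (hT : S.IsStabilizabilityBasis T T') : T.toRows₂ * S.B = 0 := by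
  refine Matrix.ext_of_mulVec_single fun i => ?_
  rw [← Matrix.mulVec_mulVec, Matrix.zero_mulVec]
  exact (hT.mem_iff _).1 (mulVec_mem_stabilizabilitySubmodule _)

/-- The stabilizability subspace is invariant: it contains the trajectories that tend to zero, and
the derivative of such a trajectory at time zero equals `A p₀` up to the range of `B`. -/
theorem toRows₂_mul_A_mulVec (hT : S.IsStabilizabilityBasis T T') {p₀ : Fin r → ℝ}
    (hp₀ : p₀ ∈ stabilizabilitySubmodule S) : (T.toRows₂ * S.A) *ᵥ p₀ = 0 := by
  obtain ⟨p, q, h, rfl, ht⟩ := hp₀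
  have hI := isTimeInterval_Ici 0
  have hz : ∀ t ∈ Set.Ici (0 : ℝ), T.toRows₂ *ᵥ p t = 0 := fun t h0 =>
    (hT.mem_iff _).1 ⟨_, _, h.shift h0, by simp,
      ht.comp (tendsto_atTop_add_const_right _ t tendsto_id)⟩
  have hae : (fun t => (T.toRows₂ * S.A) *ᵥ p t) =ᵐ[volume.restrict (Set.Ici 0)] fun _ => 0 := by
    -- at the end point `0` nothing is known on the left-hand side
    have hne : ∀ᵐ t ∂volume.restrict (Set.Ici (0 : ℝ)), t ≠ 0 :=
      ae_restrict_of_ae (by simp [ae_iff, measure_singleton])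
    filter_upwards [h.2.2, hne, ae_restrict_mem measurableSet_Ici] with t ht hne hmem
    have h1 := hasDerivAt_mulVec T.toRows₂ ht
    have h2 : HasDerivAt (fun s => T.toRows₂ *ᵥ p s) 0 t := by
      refine (hasDerivAt_const t (0 : Fin l' → ℝ)).congr_of_eventuallyEq ?_
      filter_upwards [Ioi_mem_nhds (lt_of_le_of_ne hmem hne.symm)] with s hs
        using hz s (Set.mem_Ici.2 (le_of_lt hs))
    have h3 := h1.unique h2
    rwa [Matrix.mulVec_add, Matrix.mulVec_mulVec, Matrix.mulVec_mulVec, hT.toRows₂_mul_B,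
      Matrix.zero_mulVec, add_zero] at h3
  have hc : ContinuousOn (fun t => (T.toRows₂ * S.A) *ᵥ p t) (Set.Ici 0) :=
    (mulVecCLM _).continuous.comp_continuousOn (h.1.continuousOn hI)
  exact Measure.eqOn_of_ae_eq hae hc continuousOn_const hI.subset_closure_interior
    (Set.self_mem_Ici)

theorem toRows₂_mul_A_mul_toCols₁ (hT : S.IsStabilizabilityBasis T T') :
    T.toRows₂ * S.A * T'.toCols₁ = 0 := by
  refine Matrix.ext_of_mulVec_single fun i => ?_
  rw [← Matrix.mulVec_mulVec, Matrix.zero_mulVec]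
  refine hT.toRows₂_mul_A_mulVec ((hT.mem_iff _).2 ?_)
  rw [Matrix.mulVec_mulVec, hT.toRows₂_mul_toCols₁, Matrix.zero_mulVec]

theorem toRows₂_mul_A (hT : S.IsStabilizabilityBasis T T') :
    T.toRows₂ * S.A = (T.toRows₂ * S.A * T'.toCols₂) * T.toRows₂ := by
  conv_lhs => rw [← Matrix.mul_one (T.toRows₂ * S.A), ← hT.decomp, Matrix.mul_add,
    ← Matrix.mul_assoc, ← Matrix.mul_assoc, hT.toRows₂_mul_A_mul_toCols₁, Matrix.zero_mul, zero_add]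

theorem toCols₁_mul_A (hT : S.IsStabilizabilityBasis T T') :
    T'.toCols₁ * (S.stabilizablePart T T').A = S.A * T'.toCols₁ := by
  have := congrArg (· * (S.A * T'.toCols₁)) hT.decomp
  simp only [Matrix.add_mul, Matrix.one_mul, Matrix.mul_assoc] at this
  rw [← Matrix.mul_assoc T.toRows₂, hT.toRows₂_mul_A_mul_toCols₁, Matrix.mul_zero, add_zero] at this
  rw [stabilizablePart_A, ← this, Matrix.mul_assoc]

theorem toCols₁_mul_B (hT : S.IsStabilizabilityBasis T T') :
    T'.toCols₁ * (S.stabilizablePart T T').B = S.B := by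
  have := congrArg (· * S.B) hT.decomp
  simp only [Matrix.add_mul, Matrix.one_mul, Matrix.mul_assoc] at this
  rwa [hT.toRows₂_mul_B, Matrix.mul_zero, add_zero] at this

/-- Trajectories of the stabilizable part are trajectories of the system. -/
theorem isTrajectory_toCols₁ (hT : S.IsStabilizabilityBasis T T') {I : Set ℝ}
    {v : ℝ → Fin l → ℝ} {q : ℝ → Fin k → ℝ}
    (h : (S.stabilizablePart T T').IsTrajectory I v q) :
    S.IsTrajectory I (fun t => T'.toCols₁ *ᵥ v t) q := by
  refine ⟨h.1.mulVec _, h.2.1, ?_⟩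
  filter_upwards [h.2.2] with t ht
  refine (hasDerivAt_mulVec T'.toCols₁ ht).congr_deriv ?_
  rw [Matrix.mulVec_add, Matrix.mulVec_mulVec, Matrix.mulVec_mulVec, Matrix.mulVec_mulVec,
    hT.toCols₁_mul_A, hT.toCols₁_mul_B]

/-- The complementary coordinates of a trajectory obey an autonomous equation. -/
theorem hasDerivAt_toRows₂ (hT : S.IsStabilizabilityBasis T T') {p : ℝ → Fin r → ℝ}
    {w : Fin k → ℝ} {t : ℝ} (h : HasDerivAt p (S.A *ᵥ p t + S.B *ᵥ w) t) :
    HasDerivAt (fun s => T.toRows₂ *ᵥ p s)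
      ((T.toRows₂ * S.A * T'.toCols₂) *ᵥ (T.toRows₂ *ᵥ p t)) t := by
  refine (hasDerivAt_mulVec T.toRows₂ h).congr_deriv ?_
  rw [Matrix.mulVec_add, Matrix.mulVec_mulVec, Matrix.mulVec_mulVec, hT.toRows₂_mul_B,
    Matrix.zero_mulVec, add_zero, Matrix.mulVec_mulVec, ← hT.toRows₂_mul_A]

/-- A trajectory that starts in the stabilizability subspace stays there. -/
theorem toRows₂_eq_zero (hT : S.IsStabilizabilityBasis T T') {I : Set ℝ}
    {p : ℝ → Fin r → ℝ} {q : ℝ → Fin k → ℝ} (h : S.IsTrajectory I p q)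
    (h0 : p 0 ∈ stabilizabilitySubmodule S) {t : ℝ} (ht : 0 ≤ t) (hI : Set.Icc 0 t ⊆ I) :
    T.toRows₂ *ᵥ p t = 0 := by
  refine eq_zero_of_linear (A := T.toRows₂ * S.A * T'.toCols₂)
    (p := fun s => T.toRows₂ *ᵥ p s) ht
    (absolutelyContinuousOnInterval_mulVec _ (h.1 0 t ht hI)) ?_ ((hT.mem_iff _).1 h0)
  filter_upwards [h.ae_Icc hI] with s hs hmem using hT.hasDerivAt_toRows₂ (hs hmem)

/-- A trajectory that starts in the stabilizability subspace comes from the stabilizable part. -/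
theorem isTrajectory_toRows₁ (hT : S.IsStabilizabilityBasis T T') {I : Set ℝ}
    (hI : IsTimeInterval I) (hpos : I ⊆ Set.Ici 0) (hmem : (0 : ℝ) ∈ I)
    {p : ℝ → Fin r → ℝ} {q : ℝ → Fin k → ℝ} (h : S.IsTrajectory I p q)
    (h0 : p 0 ∈ stabilizabilitySubmodule S) :
    (S.stabilizablePart T T').IsTrajectory I (fun t => T.toRows₁ *ᵥ p t) q ∧
      ∀ t ∈ I, T'.toCols₁ *ᵥ (T.toRows₁ *ᵥ p t) = p t := by
  have hp : ∀ t ∈ I, T'.toCols₁ *ᵥ (T.toRows₁ *ᵥ p t) = p t := fun t ht => by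
    have h1 := hT.toRows₂_eq_zero h h0 (hpos ht) (hI.ordConnected.out hmem ht)
    have h2 := hT.decomp_mulVec (p t)
    rwa [h1, Matrix.mulVec_zero, add_zero] at h2
  refine ⟨⟨h.1.mulVec _, h.2.1, ?_⟩, hp⟩
  filter_upwards [h.2.2, ae_restrict_mem hI.isClosed.measurableSet] with t ht htI
  refine (hasDerivAt_mulVec T.toRows₁ ht).congr_deriv ?_
  rw [Matrix.mulVec_add, stabilizablePart_A, stabilizablePart_B, ← Matrix.mulVec_mulVec,
    hp t htI, Matrix.mulVec_mulVec, Matrix.mulVec_mulVec]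

/-- Every state of the stabilizable part is steered to zero by some input. -/
theorem exists_tendsto_zero (hT : S.IsStabilizabilityBasis T T') (v₀ : Fin l → ℝ) :
    ∃ v q, (S.stabilizablePart T T').IsTrajectory (Set.Ici 0) v q ∧ v 0 = v₀ ∧
      Tendsto v atTop (𝓝 0) := by
  have hmem : T'.toCols₁ *ᵥ v₀ ∈ stabilizabilitySubmodule S := by
    rw [hT.mem_iff, Matrix.mulVec_mulVec, hT.toRows₂_mul_toCols₁, Matrix.zero_mulVec]
  obtain ⟨p, q, h, h0, ht⟩ := id hmem
  rw [← h0] at hmem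
  refine ⟨_, q, (hT.isTrajectory_toRows₁ (isTimeInterval_Ici 0) subset_rfl Set.self_mem_Ici h
    hmem).1, ?_, ?_⟩
  · rw [h0, Matrix.mulVec_mulVec, hT.toRows₁_mul_toCols₁, Matrix.one_mulVec]
  · simpa [Function.comp_def] using ((mulVecCLM T.toRows₁).continuous.tendsto 0).comp ht

end OdeLti.IsStabilizabilityBasis

variable {E A : Matrix (Fin c) (Fin n) ℝ} {B : Matrix (Fin c) (Fin m) ℝ}

theorem fromCols_zero_mul {ι κ : Type*} [Fintype ι] (X : Matrix κ (Fin n) ℝ)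
    (Y : Matrix (Fin n ⊕ Fin m) ι ℝ) :
    Matrix.fromCols X (0 : Matrix κ (Fin m) ℝ) * Y = X * Y.toRows₁ := by
  conv_lhs => rw [← Matrix.fromRows_toRows Y]
  rw [Matrix.fromCols_mul_fromRows, Matrix.zero_mul, add_zero]

theorem OdeLti.IsAssociated.stateMap_mul (hS : S.IsAssociated E A B) :
    stateMap E S * (E * S.C.toRows₁) = 1 := pinv_mul_self _ hS.rank_output

theorem exists_left_inverse_of_rank_eq {ι : Type*} [Fintype ι] [DecidableEq ι] {k : ℕ}
    {D : Matrix ι (Fin k) ℝ} (h : D.rank = k) : ∃ Δ : Matrix (Fin k) ι ℝ, Δ * D = 1 := by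
  have hker : D.mulVecLin.ker = ⊥ := by
    have := D.mulVecLin.finrank_range_add_finrank_ker
    rw [Module.finrank_fin_fun, show Module.finrank ℝ D.mulVecLin.range = k from h] at this
    exact Submodule.finrank_eq_zero.1 (by omega)
  obtain ⟨g, hg⟩ := LinearMap.exists_leftInverse_of_injective D.mulVecLin hker
  refine ⟨LinearMap.toMatrix' g, Matrix.ext_of_mulVec_single fun i => ?_⟩
  rw [← Matrix.mulVec_mulVec, LinearMap.toMatrix'_mulVec, Matrix.one_mulVec]
  exact LinearMap.congr_fun hg _

theorem OdeLti.IsAssociated.feedthrough_or (hS : S.IsAssociated E A B) :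
    (S.D = 0 ∧ S.B = 0) ∨ ∀ w, S.D *ᵥ w = 0 → w = 0 := by
  rcases hS.feedthrough with h | h
  · exact .inl ⟨h.1, h.2.1⟩
  · obtain ⟨Δ, hΔ⟩ := exists_left_inverse_of_rank_eq h
    exact .inr fun w hw => by rw [← Matrix.one_mulVec w, ← hΔ, ← Matrix.mulVec_mulVec, hw,
      Matrix.mulVec_zero]

theorem OdeLti.IsAssociated.isRegular (hS : S.IsAssociated E A B) : S.IsRegular := by
  refine ⟨⟨Matrix.fromCols (stateMap E S * E) 0, ?_, ?_⟩, hS.feedthrough_or⟩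
  · rw [fromCols_zero_mul, Matrix.mul_assoc, hS.stateMap_mul]
  · rw [fromCols_zero_mul, Matrix.mul_assoc, hS.mul_feedthrough, Matrix.mul_zero]

theorem stabilizableStateMap_eq : stabilizableStateMap E S T = T.toRows₁ * stateMap E S := rfl

/-- The stabilizable state map recovers the state from `E x`, whatever the input. -/
theorem OdeLti.IsAssociated.stabilizableStateMap_mul (hS : S.IsAssociated E A B)
    (hT : S.IsStabilizabilityBasis T T') :
    stabilizableStateMap E S T * (E * (S.stabilizablePart T T').C.toRows₁) = 1 := by
  have : (S.stabilizablePart T T').C.toRows₁ = S.C.toRows₁ * T'.toCols₁ := rfl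
  rw [this, stabilizableStateMap_eq, ← Matrix.mul_assoc E, Matrix.mul_assoc,
    ← Matrix.mul_assoc (stateMap E S), hS.stateMap_mul, Matrix.one_mul, hT.toRows₁_mul_toCols₁]

theorem OdeLti.IsAssociated.isRegular_stabilizablePart (hS : S.IsAssociated E A B)
    (hT : S.IsStabilizabilityBasis T T') : (S.stabilizablePart T T').IsRegular := by
  refine ⟨⟨Matrix.fromCols (stabilizableStateMap E S T * E) 0, ?_, ?_⟩, ?_⟩
  · rw [fromCols_zero_mul, Matrix.mul_assoc, hS.stabilizableStateMap_mul hT]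
  · rw [fromCols_zero_mul, Matrix.mul_assoc, stabilizablePart_D, hS.mul_feedthrough,
      Matrix.mul_zero]
  · rcases hS.feedthrough_or with h | h
    · exact .inl ⟨h.1, by rw [stabilizablePart_B, h.2, Matrix.mul_zero]⟩
    · exact .inr h

end Stabilizability

/-! ### The value inequality and solvability of the Riccati equation -/

section Value

variable {l k n m : ℕ} {G : OdeLti l k n m} {Q : Matrix (Fin n) (Fin n) ℝ}
  {R : Matrix (Fin m) (Fin m) ℝ}

/-- The running cost as a function of the state and the input of an ODE-LTI. -/
def runningCost (G : OdeLti l k n m) (Q : Matrix (Fin n) (Fin n) ℝ) (R : Matrix (Fin m) (Fin m) ℝ)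
    (v : Fin l → ℝ) (w : Fin k → ℝ) : ℝ :=
  (G.C *ᵥ v + G.D *ᵥ w) ⬝ᵥ (weight Q R *ᵥ (G.C *ᵥ v + G.D *ᵥ w))

theorem runningCost_nonneg (hQ : Q.PosDef) (hR : R.PosDef) (v : Fin l → ℝ) (w : Fin k → ℝ) :
    0 ≤ runningCost G Q R v w := (weight_posDef hQ hR).posSemidef.quad_nonneg _

theorem ofReal_integral_le_lintegral_ofReal {α : Type*} [MeasurableSpace α] {μ : Measure α}
    {f : α → ℝ} (hf : Integrable f μ) :
    ENNReal.ofReal (∫ x, f x ∂μ) ≤ ∫⁻ x, ENNReal.ofReal (f x) ∂μ := by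
  have h1 : Integrable (fun x => max (f x) 0) μ := hf.pos_part
  calc ENNReal.ofReal (∫ x, f x ∂μ) ≤ ENNReal.ofReal (∫ x, max (f x) 0 ∂μ) :=
        ENNReal.ofReal_le_ofReal (integral_mono hf h1 fun x => le_max_left _ _)
    _ = ∫⁻ x, ENNReal.ofReal (max (f x) 0) ∂μ :=
        ofReal_integral_eq_lintegral_ofReal h1 (Eventually.of_forall fun x => le_max_right _ _)
    _ = ∫⁻ x, ENNReal.ofReal (f x) ∂μ := by simp

theorem absolutelyContinuousOnInterval_quad (P : Matrix (Fin l) (Fin l) ℝ) {v : ℝ → Fin l → ℝ}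
    {a b : ℝ} (hv : AbsolutelyContinuousOnInterval v a b) :
    AbsolutelyContinuousOnInterval (fun t => v t ⬝ᵥ (P *ᵥ v t)) a b :=
  absolutelyContinuousOnInterval_dotProduct hv (absolutelyContinuousOnInterval_mulVec P hv)

theorem hasDerivAt_quad {P : Matrix (Fin l) (Fin l) ℝ} (hP : Pᵀ = P) {v : ℝ → Fin l → ℝ}
    {v' : Fin l → ℝ} {t : ℝ} (hv : HasDerivAt v v' t) :
    HasDerivAt (fun s => v s ⬝ᵥ (P *ᵥ v s)) (2 * ((P *ᵥ v t) ⬝ᵥ v')) t := by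
  refine (hasDerivAt_dotProduct hv (hasDerivAt_mulVec P hv)).congr_deriv ?_
  rw [dotProduct_mulVec_symm hP (v t) v', dotProduct_comm v']
  ring

/-- For a lower solution `P` of the Riccati equation, `⟨v, P v⟩` drops along a trajectory by at
most the running cost spent, whether or not the latter is finite. -/
theorem OdeLti.IsRegular.value_le (hG : G.IsRegular) (hQ : Q.PosDef) (hR : R.PosDef)
    {P : Matrix (Fin l) (Fin l) ℝ} (hP : Pᵀ = P) (hric : ∀ v, 0 ≤ v ⬝ᵥ (riccati G Q R P *ᵥ v))
    {v : ℝ → Fin l → ℝ} {q : ℝ → Fin k → ℝ} {T : ℝ} (hT : 0 ≤ T)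
    (hv : AbsolutelyContinuousOnInterval v 0 T)
    (hd : ∀ᵐ t, t ∈ Set.Icc 0 T → HasDerivAt v (G.A *ᵥ v t + G.B *ᵥ q t) t) :
    ENNReal.ofReal (v 0 ⬝ᵥ (P *ᵥ v 0)) ≤ ENNReal.ofReal (v T ⬝ᵥ (P *ᵥ v T)) +
      ∫⁻ s in Set.Icc 0 T, ENNReal.ofReal (runningCost G Q R (v s) (q s)) := by
  have hf := absolutelyContinuousOnInterval_quad P hv
  set f : ℝ → ℝ := fun t => v t ⬝ᵥ (P *ᵥ v t) with hfdef
  have hint : IntegrableOn (fun t => -deriv f t) (Set.Icc 0 T) :=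
    ((intervalIntegrable_iff_integrableOn_Icc_of_le hT).1 hf.intervalIntegrable_deriv).neg
  have hftc : f 0 = f T + ∫ s in Set.Icc 0 T, -deriv f s := by
    have h1 := hf.integral_deriv_eq_sub
    rw [intervalIntegral.integral_of_le hT, ← integral_Icc_eq_integral_Ioc] at h1
    rw [integral_neg, h1]
    ring
  have hle : ∀ᵐ s ∂volume.restrict (Set.Icc 0 T),
      ENNReal.ofReal (-deriv f s) ≤ ENNReal.ofReal (runningCost G Q R (v s) (q s)) := by
    rw [ae_restrict_iff' measurableSet_Icc]
    filter_upwards [hd] with s hs hmem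
    refine ENNReal.ofReal_le_ofReal ?_
    rw [(hasDerivAt_quad hP (hs hmem)).deriv]
    have h1 := hG.complete_square hQ hR hP (v s) (q s)
    have h2 := (weight_posDef hQ hR).posSemidef.quad_nonneg
      (G.D *ᵥ (q s + gain G Q R P *ᵥ v s))
    rw [runningCost]
    linarith [hric (v s)]
  calc ENNReal.ofReal (f 0) ≤ ENNReal.ofReal (f T) +
        ENNReal.ofReal (∫ s in Set.Icc 0 T, -deriv f s) := by
        rw [hftc]; exact ENNReal.ofReal_add_le
    _ ≤ _ := by
        gcongr
        exact (ofReal_integral_le_lintegral_ofReal hint).trans (lintegral_mono_ae hle)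

theorem continuous_runningCost {v : ℝ → Fin l → ℝ} {q : ℝ → Fin k → ℝ} (hv : Continuous v)
    (hq : Continuous q) : Continuous fun t => runningCost G Q R (v t) (q t) := by
  unfold runningCost
  fun_prop

/-- A priori bound for the lower solutions of the Riccati equation of a stabilizable system: steer
the coordinate vectors close to zero with finite cost and apply the value inequality. -/
theorem OdeLti.IsRegular.exists_trace_bound (hG : G.IsRegular) (hQ : Q.PosDef) (hR : R.PosDef)
    (hstab : ∀ v₀, ∃ v q, G.IsTrajectory (Set.Ici 0) v q ∧ v 0 = v₀ ∧ Tendsto v atTop (𝓝 0)) :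
    ∃ τ : ℝ, ∀ P : Matrix (Fin l) (Fin l) ℝ, P.PosSemidef →
      (∀ v, 0 ≤ v ⬝ᵥ (riccati G Q R P *ᵥ v)) → P.trace ≤ τ := by
  choose v q htraj h0 hlim using fun i : Fin l => hstab (Pi.single i 1)
  have hsum : Tendsto (fun t => ∑ i, v i t ⬝ᵥ v i t) atTop (𝓝 0) := by
    have h1 : ∀ i, Tendsto (fun t => v i t ⬝ᵥ v i t) atTop (𝓝 0) := fun i => by
      have hc : Continuous fun w : Fin l → ℝ => w ⬝ᵥ w := by fun_prop
      simpa [Function.comp_def] using (hc.tendsto 0).comp (hlim i)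
    simpa using tendsto_finsetSum Finset.univ fun i _ => h1 i
  obtain ⟨T, hT, hTpos⟩ := ((hsum.eventually (gt_mem_nhds (show (0 : ℝ) < 1 / 2 by norm_num))).and
    (eventually_gt_atTop 0)).exists
  have hsub : Set.Icc 0 T ⊆ Set.Ici (0 : ℝ) := Set.Icc_subset_Ici_self
  -- continuous inputs have a finite cost
  choose p w hs hp0 hpT using fun i => exists_smooth_same_endpoint hTpos
    ((htraj i).1 0 T hTpos.le hsub) ((htraj i).ae_Icc hsub)
  let C : Fin l → ℝ := fun i =>
    (∫⁻ s in Set.Icc 0 T, ENNReal.ofReal (runningCost G Q R (p i s) (w i s))).toReal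
  refine ⟨2 * ∑ i, C i, fun P hP hric => ?_⟩
  have hdiag : ∀ i, P i i ≤ P.trace * (v i T ⬝ᵥ v i T) + C i := fun i => by
    have h1 := hG.value_le hQ hR hP.transpose_eq hric hTpos.le ((hs i).absolutelyContinuous 0 T)
      (Eventually.of_forall fun t _ => (hs i).hasDerivAt t)
    have hfin : ∫⁻ s in Set.Icc 0 T, ENNReal.ofReal (runningCost G Q R (p i s) (w i s)) ≠ ⊤ :=
      ((continuous_runningCost (hs i).continuous (hs i).continuous_input).integrableOn_Icc
        |>.lintegral_lt_top).ne
    rw [← ENNReal.ofReal_toReal hfin, ← ENNReal.ofReal_add (hP.quad_nonneg _)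
      ENNReal.toReal_nonneg, ENNReal.ofReal_le_ofReal_iff
      (add_nonneg (hP.quad_nonneg _) ENNReal.toReal_nonneg), hpT, hp0, h0] at h1
    have h2 := quad_le_trace_mul hP (v i T)
    have h3 : (Pi.single i 1 : Fin l → ℝ) ⬝ᵥ (P *ᵥ Pi.single i 1) = P i i := by simp
    rw [h3] at h1
    exact h1.trans (by gcongr)
  have htr : P.trace ≤ P.trace * ∑ i, v i T ⬝ᵥ v i T + ∑ i, C i := by
    rw [Finset.mul_sum, ← Finset.sum_add_distrib]
    exact Finset.sum_le_sum fun i _ => hdiag i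
  -- `T` is such that the sum on the right-hand side is below `1 / 2`
  nlinarith [hP.trace_nonneg]

/-- A stabilizable regular system has exactly one positive definite Riccati solution. -/
theorem OdeLti.IsRegular.existsUnique_riccati (hG : G.IsRegular) (hQ : Q.PosDef) (hR : R.PosDef)
    (hstab : ∀ v₀, ∃ v q, G.IsTrajectory (Set.Ici 0) v q ∧ v 0 = v₀ ∧ Tendsto v atTop (𝓝 0)) :
    ∃! P : Matrix (Fin l) (Fin l) ℝ, P.PosDef ∧ IsRiccatiSolution G Q R P := by
  obtain ⟨τ, hτ⟩ := hG.exists_trace_bound hQ hR hstab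
  obtain ⟨P, hP, h⟩ := hG.exists_riccati_of_trace_bound hQ hR hτ
  exact ⟨P, ⟨hP, h⟩, fun P' hP' => hG.riccati_unique hQ hR hP'.1 hP hP'.2 h⟩

/-- Cost lower bound: over a horizon `t` every trajectory costs at least a fraction `t / (κ + t)`
of the value `⟨v₀, P v₀⟩`, because the mean over the horizon of the value of the state is at most
`κ / t` times the cost. -/
theorem OdeLti.IsRegular.exists_cost_lower_bound (hG : G.IsRegular) (hQ : Q.PosDef)
    (hR : R.PosDef) {P : Matrix (Fin l) (Fin l) ℝ} (hP : P.PosDef) (hric : riccati G Q R P = 0) :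
    ∃ κ : ℝ, 0 < κ ∧ ∀ (t : ℝ) (v : ℝ → Fin l → ℝ) (q : ℝ → Fin k → ℝ), 0 < t →
      G.IsTrajectory (Set.Icc 0 t) v q →
      ENNReal.ofReal ((v 0 ⬝ᵥ (P *ᵥ v 0)) * (t / (κ + t))) ≤
        ∫⁻ s in Set.Icc 0 t, ENNReal.ofReal (runningCost G Q R (v s) (q s)) := by
  obtain ⟨c, hc, hcoer⟩ := hG.exists_coercive hQ hR
  obtain ⟨b, hb, hbP⟩ := exists_le_mul_dotProduct P
  refine ⟨b / c, by positivity, fun t v q ht h => ?_⟩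
  have hPs := hP.posSemidef
  set L := ∫⁻ s in Set.Icc 0 t, ENNReal.ofReal (runningCost G Q R (v s) (q s)) with hL
  have hpt : ∀ s ∈ Set.Icc 0 t, ENNReal.ofReal (v 0 ⬝ᵥ (P *ᵥ v 0)) ≤
      ENNReal.ofReal (b / c) * ENNReal.ofReal (runningCost G Q R (v s) (q s)) + L := by
    intro s hs
    have hsub : Set.Icc 0 s ⊆ Set.Icc 0 t := Set.Icc_subset_Icc_right hs.2
    refine (hG.value_le hQ hR hPs.transpose_eq (fun v => by simp [hric]) hs.1 (h.1 0 s hs.1 hsub)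
      (h.ae_Icc hsub)).trans (add_le_add ?_ (lintegral_mono_set hsub))
    rw [← ENNReal.ofReal_mul (by positivity)]
    refine ENNReal.ofReal_le_ofReal ((hbP _).trans ?_)
    have := hcoer (v s) (q s)
    rw [div_mul_eq_mul_div, le_div_iff₀ hc, mul_assoc]
    refine mul_le_mul_of_nonneg_left ?_ hb.le
    rw [mul_comm]
    exact this
  have hint : ENNReal.ofReal (v 0 ⬝ᵥ (P *ᵥ v 0)) * ENNReal.ofReal t ≤
      ENNReal.ofReal (b / c) * L + L * ENNReal.ofReal t := by
    have h1 : ∫⁻ _ in Set.Icc 0 t, ENNReal.ofReal (v 0 ⬝ᵥ (P *ᵥ v 0)) ≤ ∫⁻ s in Set.Icc 0 t,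
        (ENNReal.ofReal (b / c) * ENNReal.ofReal (runningCost G Q R (v s) (q s)) + L) :=
      setLIntegral_mono' measurableSet_Icc hpt
    rw [lintegral_add_right _ measurable_const, lintegral_const_mul' _ _ ENNReal.ofReal_ne_top,
      setLIntegral_const, setLIntegral_const, Real.volume_Icc, sub_zero] at h1
    exact h1
  have hpos : 0 < b / c + t := by positivity
  rw [← ENNReal.ofReal_mul (hPs.quad_nonneg _), mul_comm L, ← add_mul,
    ← ENNReal.ofReal_add (by positivity) ht.le, mul_comm _ L,
    ← ENNReal.div_le_iff (by simpa using hpos) ENNReal.ofReal_ne_top,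
    ← ENNReal.ofReal_div_of_pos hpos] at hint
  rwa [← mul_div_assoc]

end Value

/-! ### Asymptotics of the closed loop -/

section ClosedLoop

variable {l l' k n m : ℕ} {G : OdeLti l k n m} {Q : Matrix (Fin n) (Fin n) ℝ}
  {R : Matrix (Fin m) (Fin m) ℝ}

theorem tendsto_zero_of_dotProduct_self {α ι : Type*} [Fintype ι] {F : Filter α}
    {v : α → ι → ℝ} (h : Tendsto (fun t => v t ⬝ᵥ v t) F (𝓝 0)) : Tendsto v F (𝓝 0) := by
  refine tendsto_pi_nhds.2 fun i => ?_
  have hs : Tendsto (fun t => √(v t ⬝ᵥ v t)) F (𝓝 0) := by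
    simpa [Function.comp_def] using (Real.continuous_sqrt.tendsto 0).comp h
  refine squeeze_zero_norm (fun t => ?_) hs
  rw [Real.norm_eq_abs]
  refine Real.abs_le_sqrt ?_
  rw [pow_two]
  exact Finset.single_le_sum (f := fun i => v t i * v t i) (fun _ _ => mul_self_nonneg _)
    (Finset.mem_univ i)

/-- A square integrable solution of a linear equation tends to zero, since the derivative of its
squared length is integrable, too. -/
theorem tendsto_zero_of_linear {M : Matrix (Fin l) (Fin l) ℝ} {v : ℝ → Fin l → ℝ}
    (hv : ∀ t, HasDerivAt v (M *ᵥ v t) t) {C : ℝ}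
    (hC : ∀ T, 0 ≤ T → ∫ s in (0 : ℝ)..T, v s ⬝ᵥ v s ≤ C) : Tendsto v atTop (𝓝 0) := by
  have hvc : Continuous v := continuous_iff_continuousAt.2 fun t => (hv t).continuousAt
  have hc : Continuous fun s => v s ⬝ᵥ v s := by fun_prop
  have hc' : Continuous fun s => v s ⬝ᵥ (M *ᵥ v s) := by fun_prop
  have hint : IntegrableOn (fun s => v s ⬝ᵥ v s) (Set.Ioi 0) := by
    refine integrableOn_Ioi_of_intervalIntegral_norm_bounded (l := atTop) (b := fun t => t) C 0
      (fun T => hc.integrableOn_Ioc) tendsto_id ?_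
    filter_upwards [eventually_ge_atTop 0] with T hT
    simpa only [Real.norm_of_nonneg (zero_le_dotProduct_self _)] using hC T hT
  obtain ⟨b, hb, hbM⟩ := exists_le_mul_dotProduct M
  obtain ⟨b', hb', hbM'⟩ := exists_le_mul_dotProduct (-M)
  have hd : ∀ t ∈ Set.Ioi (0 : ℝ), HasDerivAt (fun s => v s ⬝ᵥ v s) (2 * (v t ⬝ᵥ (M *ᵥ v t))) t :=
    fun t _ => by
      refine (hasDerivAt_dotProduct (hv t) (hv t)).congr_deriv ?_
      rw [dotProduct_comm (M *ᵥ v t)]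
      ring
  have hint' : IntegrableOn (fun t => 2 * (v t ⬝ᵥ (M *ᵥ v t))) (Set.Ioi 0) := by
    refine ((hint.const_mul (b + b')).mono' hc'.aestronglyMeasurable
      (Eventually.of_forall fun t => ?_)).const_mul 2
    have h1 := hbM (v t)
    have h2 := hbM' (v t)
    have h3 := zero_le_dotProduct_self (v t)
    rw [Matrix.neg_mulVec, dotProduct_neg] at h2
    rw [Real.norm_eq_abs, abs_le]
    constructor <;> nlinarith [mul_nonneg hb.le h3, mul_nonneg hb'.le h3]
  exact tendsto_zero_of_dotProduct_self
    (tendsto_zero_of_hasDerivAt_of_integrableOn_Ioi hd hint' hint)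

/-- Young's inequality for the dot product. -/
theorem two_mul_dotProduct_le {ι : Type*} [Fintype ι] {α : ℝ} (hα : 0 < α) (v w : ι → ℝ) :
    2 * (v ⬝ᵥ w) ≤ α * (v ⬝ᵥ v) + α⁻¹ * (w ⬝ᵥ w) := by
  have h := zero_le_dotProduct_self (α • v - w)
  simp only [sub_dotProduct, dotProduct_sub, smul_dotProduct, dotProduct_smul, smul_eq_mul,
    dotProduct_comm w v] at h
  have h2 : α * (2 * (v ⬝ᵥ w)) ≤ α * (α * (v ⬝ᵥ v) + α⁻¹ * (w ⬝ᵥ w)) := by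
    rw [mul_add, mul_inv_cancel_left₀ hα.ne']
    linarith
  exact le_of_mul_le_mul_left h2 hα

/-- The optimal closed loop turns a square integrable disturbance into a square integrable state. -/
theorem OdeLti.IsRegular.exists_integral_bound (hG : G.IsRegular) (hQ : Q.PosDef) (hR : R.PosDef)
    {P : Matrix (Fin l) (Fin l) ℝ} (hP : P.PosDef) (hric : riccati G Q R P = 0)
    (N : Matrix (Fin l) (Fin l') ℝ) {v : ℝ → Fin l → ℝ} {y : ℝ → Fin l' → ℝ} (hy : Continuous y)
    (hv : ∀ t, HasDerivAt v ((G.A - G.B * gain G Q R P) *ᵥ v t + N *ᵥ y t) t)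
    {C : ℝ} (hC : ∀ T, 0 ≤ T → ∫ s in (0 : ℝ)..T, y s ⬝ᵥ y s ≤ C) :
    ∃ C', ∀ T, 0 ≤ T → ∫ s in (0 : ℝ)..T, v s ⬝ᵥ v s ≤ C' := by
  obtain ⟨c, hc, hcoer⟩ := hG.exists_coercive hQ hR
  obtain ⟨b, hb, hbN⟩ := exists_le_mul_dotProduct ((P * N)ᵀ * (P * N))
  have hPs := hP.posSemidef.transpose_eq
  have hvc : Continuous v := continuous_iff_continuousAt.2 fun t => (hv t).continuousAt
  have hd : ∀ t, HasDerivAt (fun s => v s ⬝ᵥ (P *ᵥ v s))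
      (2 * ((P *ᵥ v t) ⬝ᵥ ((G.A - G.B * gain G Q R P) *ᵥ v t + N *ᵥ y t))) t :=
    fun t => hasDerivAt_quad hPs (hv t)
  have hle : ∀ t, 2 * ((P *ᵥ v t) ⬝ᵥ ((G.A - G.B * gain G Q R P) *ᵥ v t + N *ᵥ y t)) ≤
      -(c / 2) * (v t ⬝ᵥ v t) + (c / 2)⁻¹ * b * (y t ⬝ᵥ y t) := fun t => by
    have h1 := hG.complete_square hQ hR hPs (v t) (-(gain G Q R P *ᵥ v t))
    have h2 := hcoer (v t) (-(gain G Q R P *ᵥ v t))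
    have h3 := two_mul_dotProduct_le (half_pos hc) (v t) (P *ᵥ (N *ᵥ y t))
    have h4 := hbN (y t)
    rw [← Matrix.mulVec_mulVec, dotProduct_transpose_mulVec, ← Matrix.mulVec_mulVec] at h4
    have h5 := mul_le_mul_of_nonneg_left h4 (inv_pos.2 (half_pos hc)).le
    rw [hric, ← sub_mul_mulVec, neg_add_cancel] at h1
    simp only [Matrix.zero_mulVec, Matrix.mulVec_zero, dotProduct_zero, add_zero] at h1
    rw [dotProduct_add, ← dotProduct_mulVec_symm hPs (v t) (N *ᵥ y t), mul_add]
    linarith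
  refine ⟨2 / c * (v 0 ⬝ᵥ (P *ᵥ v 0) + (c / 2)⁻¹ * b * C), fun T hT => ?_⟩
  have hc1 : Continuous fun s => v s ⬝ᵥ v s := by fun_prop
  have hc2 : Continuous fun s => y s ⬝ᵥ y s := by fun_prop
  have hc3 : Continuous fun t =>
      2 * ((P *ᵥ v t) ⬝ᵥ ((G.A - G.B * gain G Q R P) *ᵥ v t + N *ᵥ y t)) := by fun_prop
  have hc4 : Continuous fun t =>
      -(c / 2) * (v t ⬝ᵥ v t) + (c / 2)⁻¹ * b * (y t ⬝ᵥ y t) := by fun_prop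
  have h1 := intervalIntegral.integral_mono_on (μ := volume) hT (hc3.intervalIntegrable 0 T)
    (hc4.intervalIntegrable 0 T) fun t _ => hle t
  rw [intervalIntegral.integral_eq_sub_of_hasDerivAt (fun t _ => hd t) (hc3.intervalIntegrable 0 T),
    intervalIntegral.integral_add ((hc1.const_mul _).intervalIntegrable 0 T)
      ((hc2.const_mul _).intervalIntegrable 0 T), intervalIntegral.integral_const_mul,
    intervalIntegral.integral_const_mul] at h1
  have h2 := mul_le_mul_of_nonneg_left (hC T hT)
    (show 0 ≤ (c / 2)⁻¹ * b by positivity)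
  have h3 := hP.posSemidef.quad_nonneg (v T)
  rw [div_mul_eq_mul_div, le_div_iff₀ hc]
  linarith

theorem exists_isClosedLoop (G : OdeLti l k n m) (K : Matrix (Fin k) (Fin l) ℝ)
    (v₀ : Fin l → ℝ) : ∃ v, IsClosedLoop G K v₀ v := by
  obtain ⟨v, h0, h⟩ := exists_hasDerivAt_linear_at (G.A - G.B * K) 0 v₀
  exact ⟨v, h0, fun t _ => (h t).hasDerivWithinAt⟩

/-- A closed loop solution on `[0, ∞)` extends to a solution on `ℝ`. -/
theorem IsClosedLoop.exists_extension {K : Matrix (Fin k) (Fin l) ℝ} {v₀ : Fin l → ℝ}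
    {v : ℝ → Fin l → ℝ} (h : IsClosedLoop G K v₀ v) :
    ∃ w : ℝ → Fin l → ℝ, w 0 = v₀ ∧ (∀ t, HasDerivAt w ((G.A - G.B * K) *ᵥ w t) t) ∧
      ∀ t, 0 ≤ t → v t = w t := by
  obtain ⟨w, h0, hw⟩ := exists_hasDerivAt_linear_at (G.A - G.B * K) 0 v₀
  refine ⟨w, h0, hw, fun t ht => ?_⟩
  have := ODE_solution_unique_of_mem_Icc_right (a := 0) (b := t) (f := v) (g := w)
    (v := fun _ => mulVecCLM (G.A - G.B * K)) (s := fun _ => Set.univ)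
    (fun _ _ => (mulVecCLM (G.A - G.B * K)).lipschitz.lipschitzOnWith)
    (fun s hs => ((h.2 s hs.1).continuousWithinAt).mono Set.Icc_subset_Ici_self)
    (fun s hs => (h.2 s hs.1).mono (Set.Ici_subset_Ici.2 hs.1)) (fun _ _ => Set.mem_univ _)
    (fun s _ => (hw s).continuousAt.continuousWithinAt)
    (fun s _ => (hw s).hasDerivWithinAt) (fun _ _ => Set.mem_univ _) (h.1.trans h0.symm)
  exact this ⟨ht, le_rfl⟩

/-- The optimal closed loop is asymptotically stable. -/
theorem OdeLti.IsRegular.tendsto_zero (hG : G.IsRegular) (hQ : Q.PosDef) (hR : R.PosDef)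
    {P : Matrix (Fin l) (Fin l) ℝ} (hP : P.PosDef) (hric : riccati G Q R P = 0)
    {v : ℝ → Fin l → ℝ} (hv : ∀ t, HasDerivAt v ((G.A - G.B * gain G Q R P) *ᵥ v t) t) :
    Tendsto v atTop (𝓝 0) := by
  obtain ⟨C, hC⟩ := hG.exists_integral_bound hQ hR hP hric (0 : Matrix (Fin l) (Fin 0) ℝ)
    (y := fun _ => 0) continuous_const (by simpa using hv) (C := 0) (by simp)
  exact tendsto_zero_of_linear hv hC

/-- The cost of the optimal closed loop on `[0, t]` is the decrease of `⟨v, P v⟩`. -/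
theorem OdeLti.IsRegular.lintegral_closedLoop (hG : G.IsRegular) (hQ : Q.PosDef) (hR : R.PosDef)
    {P : Matrix (Fin l) (Fin l) ℝ} (hP : P.PosDef) (hric : riccati G Q R P = 0)
    {v : ℝ → Fin l → ℝ} (hv : ∀ t, HasDerivAt v ((G.A - G.B * gain G Q R P) *ᵥ v t) t)
    {T : ℝ} (hT : 0 ≤ T) :
    ∫⁻ s in Set.Icc 0 T, ENNReal.ofReal (runningCost G Q R (v s) (-(gain G Q R P *ᵥ v s))) =
      ENNReal.ofReal (v 0 ⬝ᵥ (P *ᵥ v 0) - v T ⬝ᵥ (P *ᵥ v T)) := by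
  have hPs := hP.posSemidef.transpose_eq
  have hvc : Continuous v := continuous_iff_continuousAt.2 fun t => (hv t).continuousAt
  have hd : ∀ t, HasDerivAt (fun s => v s ⬝ᵥ (P *ᵥ v s))
      (-runningCost G Q R (v t) (-(gain G Q R P *ᵥ v t))) t := fun t => by
    refine (hasDerivAt_quad hPs (hv t)).congr_deriv ?_
    have h1 := hG.complete_square hQ hR hPs (v t) (-(gain G Q R P *ᵥ v t))
    rw [hric, neg_add_cancel] at h1
    simp only [Matrix.zero_mulVec, Matrix.mulVec_zero, dotProduct_zero, add_zero] at h1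
    rw [sub_mul_mulVec, runningCost]
    linarith
  have hc : Continuous fun s => runningCost G Q R (v s) (-(gain G Q R P *ᵥ v s)) :=
    continuous_runningCost hvc (by fun_prop)
  rw [← ofReal_integral_eq_lintegral_ofReal hc.integrableOn_Icc
    (Eventually.of_forall fun s => runningCost_nonneg hQ hR _ _)]
  congr 1
  have h1 := intervalIntegral.integral_eq_sub_of_hasDerivAt (fun t _ => hd t)
    (hc.neg.intervalIntegrable 0 T)
  rw [intervalIntegral.integral_neg, intervalIntegral.integral_of_le hT,
    ← integral_Icc_eq_integral_Ioc] at h1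
  linarith

end ClosedLoop

/-! ### Solutions of the DAE-LTI and trajectories of an associated ODE-LTI -/

section Correspondence

variable {c r k n m l l' : ℕ} {E A : Matrix (Fin c) (Fin n) ℝ} {B : Matrix (Fin c) (Fin m) ℝ}
  {S : OdeLti r k n m} {I : Set ℝ} {x x' : ℝ → Fin n → ℝ} {u u' : ℝ → Fin m → ℝ}

theorem locallyIntegrableOn_congr_ae {F : Type*} [NormedAddCommGroup F] (hI : IsTimeInterval I)
    {f g : ℝ → F} (hf : LocallyIntegrableOn f I) (h : ∀ᵐ t ∂(volume.restrict I), f t = g t) :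
    LocallyIntegrableOn g I :=
  hI.locallyIntegrableOn_iff.2 fun a b hab =>
    (hI.locallyIntegrableOn_iff.1 hf a b hab).congr_fun_ae
      (ae_restrict_of_ae_restrict_of_subset hab h)

/-- A solution may be modified on a null set as long as `E x` stays continuous. -/
theorem IsSolution.congr_ae (hI : IsTimeInterval I) (h : IsSolution E A B I x u)
    (hx : ∀ᵐ t ∂(volume.restrict I), x t = x' t) (hu : ∀ᵐ t ∂(volume.restrict I), u t = u' t)
    (hc : ContinuousOn (fun t => E *ᵥ x' t) I) : IsSolution E A B I x' u' := by
  have heq : Set.EqOn (fun t => E *ᵥ x t) (fun t => E *ᵥ x' t) I :=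
    Measure.eqOn_of_ae_eq (hx.mono fun t ht => by simp only [ht])
      (h.absolutelyContinuous.continuousOn hI) hc hI.subset_closure_interior
  refine ⟨locallyIntegrableOn_congr_ae hI h.1 hx, locallyIntegrableOn_congr_ae hI h.2 hu,
    fun a b hab hsub => ?_, fun a ha b hb hab => ?_⟩
  · refine absolutelyContinuousOnInterval_congr (h.3 a b hab hsub) fun t ht => ?_
    rw [Set.uIcc_of_le hab] at ht
    exact heq (hsub ht)
  · have hsub : Set.Ioc a b ⊆ I := Set.Ioc_subset_Icc_self.trans (hI.ordConnected.out ha hb)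
    have ea : E *ᵥ x a = E *ᵥ x' a := heq ha
    have eb : E *ᵥ x b = E *ᵥ x' b := heq hb
    rw [← ea, ← eb, h.4 a ha b hb hab, intervalIntegral.integral_of_le hab,
      intervalIntegral.integral_of_le hab]
    congr 1
    refine integral_congr_ae ?_
    filter_upwards [ae_restrict_of_ae_restrict_of_subset hsub hx,
      ae_restrict_of_ae_restrict_of_subset hsub hu] with t h1 h2
    rw [h1, h2]

theorem sumElim_mulVec_add (C : Matrix (Fin n ⊕ Fin m) (Fin r) ℝ)
    (D : Matrix (Fin n ⊕ Fin m) (Fin k) ℝ) (p : Fin r → ℝ) (w : Fin k → ℝ) :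
    Sum.elim (C.toRows₁ *ᵥ p + D.toRows₁ *ᵥ w) (C.toRows₂ *ᵥ p + D.toRows₂ *ᵥ w) =
      C *ᵥ p + D *ᵥ w := by
  ext (i | i) <;> rfl

theorem sumElim_eq_iff (C : Matrix (Fin n ⊕ Fin m) (Fin r) ℝ)
    (D : Matrix (Fin n ⊕ Fin m) (Fin k) ℝ) (p : Fin r → ℝ) (w : Fin k → ℝ)
    (x : Fin n → ℝ) (u : Fin m → ℝ) :
    Sum.elim x u = C *ᵥ p + D *ᵥ w ↔
      x = C.toRows₁ *ᵥ p + D.toRows₁ *ᵥ w ∧ u = C.toRows₂ *ᵥ p + D.toRows₂ *ᵥ w := by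
  rw [← sumElim_mulVec_add]
  constructor
  · intro h
    exact ⟨funext fun i => congrFun h (Sum.inl i), funext fun i => congrFun h (Sum.inr i)⟩
  · rintro ⟨rfl, rfl⟩
    rfl

theorem OdeLti.IsAssociated.mul_output (hS : S.IsAssociated E A B) (p : Fin r → ℝ)
    (w : Fin k → ℝ) :
    E *ᵥ (S.C.toRows₁ *ᵥ p + S.D.toRows₁ *ᵥ w) = (E * S.C.toRows₁) *ᵥ p := by
  rw [Matrix.mulVec_add, Matrix.mulVec_mulVec, Matrix.mulVec_mulVec, hS.mul_feedthrough,
    Matrix.zero_mulVec, add_zero]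

/-- The outputs of a trajectory form a solution, without modification on a null set. -/
theorem OdeLti.IsAssociated.isSolution (hS : S.IsAssociated E A B) (hI : IsTimeInterval I)
    {p : ℝ → Fin r → ℝ} {q : ℝ → Fin k → ℝ} (h : S.IsTrajectory I p q) :
    IsSolution E A B I (fun t => S.C.toRows₁ *ᵥ p t + S.D.toRows₁ *ᵥ q t)
      (fun t => S.C.toRows₂ *ᵥ p t + S.D.toRows₂ *ᵥ q t) := by
  obtain ⟨x, u, hxu, hae⟩ := (hS.realization I hI).2 p q h
  refine hxu.congr_ae hI (hae.mono fun t ht => ((sumElim_eq_iff _ _ _ _ _ _).1 ht).1)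
    (hae.mono fun t ht => ((sumElim_eq_iff _ _ _ _ _ _).1 ht).2) ?_
  simp only [hS.mul_output]
  exact (mulVecCLM _).continuous.comp_continuousOn (h.1.continuousOn hI)

/-- A solution comes from a trajectory whose state is obtained from `E x` by the state map, at every
time and not only almost everywhere. -/
theorem OdeLti.IsAssociated.exists_trajectory (hS : S.IsAssociated E A B) (hI : IsTimeInterval I)
    (h : IsSolution E A B I x u) :
    ∃ p q, S.IsTrajectory I p q ∧
      (∀ᵐ t ∂(volume.restrict I), Sum.elim (x t) (u t) = S.C *ᵥ p t + S.D *ᵥ q t) ∧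
      (∀ t ∈ I, E *ᵥ x t = (E * S.C.toRows₁) *ᵥ p t) ∧
      ∀ t ∈ I, p t = stateMap E S *ᵥ (E *ᵥ x t) := by
  obtain ⟨p, q, hpq, hae⟩ := (hS.realization I hI).1 x u h
  have heq : Set.EqOn (fun t => E *ᵥ x t) (fun t => (E * S.C.toRows₁) *ᵥ p t) I := by
    refine Measure.eqOn_of_ae_eq (μ := volume) (hae.mono fun t ht => ?_)
      (h.absolutelyContinuous.continuousOn hI)
      ((mulVecCLM _).continuous.comp_continuousOn (hpq.1.continuousOn hI))
      hI.subset_closure_interior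
    simp only []
    rw [((sumElim_eq_iff _ _ _ _ _ _).1 ht).1, hS.mul_output]
  refine ⟨p, q, hpq, hae, heq, fun t ht => ?_⟩
  have h1 : E *ᵥ x t = (E * S.C.toRows₁) *ᵥ p t := heq ht
  rw [h1, Matrix.mulVec_mulVec, hS.stateMap_mul, Matrix.one_mulVec]

theorem OdeLti.IsAssociated.mulVec_stateMap (hS : S.IsAssociated E A B) {z : Fin c → ℝ}
    (hz : DifferentiablyConsistent E A B z) :
    (E * S.C.toRows₁) *ᵥ (stateMap E S *ᵥ z) = z := by
  obtain ⟨I, hI, h0, x, u, h, rfl⟩ := hz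
  obtain ⟨p, q, -, -, h1, h2⟩ := hS.exists_trajectory hI h
  rw [← h2 0 h0, ← h1 0 h0]

variable {T : Matrix (Fin l ⊕ Fin l') (Fin r) ℝ} {T' : Matrix (Fin r) (Fin l ⊕ Fin l') ℝ}

/-- A solution whose initial state is stabilizable is an output of the stabilizable part. -/
theorem OdeLti.IsAssociated.exists_stabilizable_trajectory (hS : S.IsAssociated E A B)
    (hT : S.IsStabilizabilityBasis T T') (hI : IsTimeInterval I) (hpos : I ⊆ Set.Ici 0)
    (h0 : (0 : ℝ) ∈ I) {z : Fin c → ℝ} (h : IsSolutionFrom E A B I z x u)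
    (hz : stateMap E S *ᵥ z ∈ stabilizabilitySubmodule S) :
    ∃ v q, (S.stabilizablePart T T').IsTrajectory I v q ∧
      v 0 = stabilizableStateMap E S T *ᵥ z ∧
      (∀ᵐ t ∂(volume.restrict I), Sum.elim (x t) (u t) =
        (S.stabilizablePart T T').C *ᵥ v t + (S.stabilizablePart T T').D *ᵥ q t) ∧
      ∀ t ∈ I, v t = stabilizableStateMap E S T *ᵥ (E *ᵥ x t) := by
  obtain ⟨p, q, hpq, hae, -, hp⟩ := hS.exists_trajectory hI h.1
  have hp0 : p 0 = stateMap E S *ᵥ z := by rw [hp 0 h0, h.2]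
  obtain ⟨hv, hpv⟩ := hT.isTrajectory_toRows₁ hI hpos h0 hpq (hp0 ▸ hz)
  refine ⟨_, q, hv, ?_, ?_, fun t ht => ?_⟩
  · rw [hp0, stabilizableStateMap_eq, Matrix.mulVec_mulVec]
  · filter_upwards [hae, ae_restrict_mem hI.isClosed.measurableSet] with t ht htI
    rw [ht, stabilizablePart_C, stabilizablePart_D, ← Matrix.mulVec_mulVec, hpv t htI]
  · rw [hp t ht, stabilizableStateMap_eq, Matrix.mulVec_mulVec]

variable {Q : Matrix (Fin n) (Fin n) ℝ} {R : Matrix (Fin m) (Fin m) ℝ}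
  {Q₀ : Matrix (Fin c) (Fin c) ℝ}

theorem lintegral_cost_eq {G : OdeLti l k n m} {p : ℝ → Fin l → ℝ} {q : ℝ → Fin k → ℝ}
    (h : ∀ᵐ t ∂(volume.restrict I), Sum.elim (x t) (u t) = G.C *ᵥ p t + G.D *ᵥ q t) :
    ∫⁻ s in I, ENNReal.ofReal (x s ⬝ᵥ (Q *ᵥ x s) + u s ⬝ᵥ (R *ᵥ u s)) =
      ∫⁻ s in I, ENNReal.ofReal (runningCost G Q R (p s) (q s)) :=
  lintegral_congr_ae (h.mono fun t ht => by
    simp only []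
    rw [← quad_weight, ht, runningCost])

/-! ### Stabilizability from finite optimal cost -/

/-- An absolutely continuous solution of `ẏ = M y` agrees with a differentiable one. -/
theorem eq_of_linear {d : ℕ} {M : Matrix (Fin d) (Fin d) ℝ} {f y : ℝ → Fin d → ℝ} {t : ℝ}
    (ht : 0 ≤ t) (hf : AbsolutelyContinuousOnInterval f 0 t)
    (hfd : ∀ᵐ s, s ∈ Set.Icc 0 t → HasDerivAt f (M *ᵥ f s) s)
    (hy : ∀ s, HasDerivAt y (M *ᵥ y s) s) (h0 : f 0 = y 0) : f t = y t := by
  have hyc : Continuous y := continuous_iff_continuousAt.2 fun t => (hy t).continuousAt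
  have hyac : AbsolutelyContinuousOnInterval y 0 t :=
    absolutelyContinuousOnInterval_of_hasDerivAt hy ((mulVecCLM M).continuous.comp hyc) 0 t
  refine sub_eq_zero.1 (eq_zero_of_linear (A := M) (p := fun s => f s - y s) ht
    (hf.fun_sub hyac) ?_ (by rw [h0, sub_self]))
  filter_upwards [hfd] with s hs hmem
  rw [Matrix.mulVec_sub]
  exact (hs hmem).fun_sub (hy s)

/-- The component of the state transverse to the stabilizability subspace evolves autonomously,
whatever the input. -/
theorem OdeLti.IsStabilizabilityBasis.toRows₂_eq (hT : S.IsStabilizabilityBasis T T')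
    {p : ℝ → Fin r → ℝ} {q : ℝ → Fin k → ℝ} (h : S.IsTrajectory I p q) {y : ℝ → Fin l' → ℝ}
    (hy : ∀ t, HasDerivAt y ((T.toRows₂ * S.A * T'.toCols₂) *ᵥ y t) t)
    (h0 : y 0 = T.toRows₂ *ᵥ p 0) {t : ℝ} (ht : 0 ≤ t) (hI : Set.Icc 0 t ⊆ I) :
    T.toRows₂ *ᵥ p t = y t := by
  refine eq_of_linear (f := fun s => T.toRows₂ *ᵥ p s) ht
    (absolutelyContinuousOnInterval_mulVec _ (h.1 0 t ht hI)) ?_ hy h0.symm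
  filter_upwards [h.ae_Icc hI] with s hs hmem using hT.hasDerivAt_toRows₂ (hs hmem)

/-- When the optimal costs over the finite horizons have a finite upper limit, the transverse
component of the state, which is the same for all horizons, is square integrable on `[0, ∞)`. -/
theorem OdeLti.IsAssociated.exists_transverse_bound (hS : S.IsAssociated E A B)
    (hT : S.IsStabilizabilityBasis T T') (hQ : Q.PosDef) (hR : R.PosDef) {z : Fin c → ℝ}
    (h : optCostInf E A B Q R Q₀ z < ⊤) {y : ℝ → Fin l' → ℝ}
    (hy : ∀ t, HasDerivAt y ((T.toRows₂ * S.A * T'.toCols₂) *ᵥ y t) t)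
    (h0 : y 0 = T.toRows₂ *ᵥ (stateMap E S *ᵥ z)) :
    ∃ C : ℝ, ∀ T₀, 0 ≤ T₀ → ∫ s in (0 : ℝ)..T₀, y s ⬝ᵥ y s ≤ C := by
  obtain ⟨κ, hκ, hcoer⟩ := hS.isRegular.exists_coercive hQ hR
  obtain ⟨b, hb, hbT⟩ := exists_le_mul_dotProduct (T.toRows₂ᵀ * T.toRows₂)
  have hyc : Continuous y := continuous_iff_continuousAt.2 fun t => (hy t).continuousAt
  have hcy : Continuous fun s => y s ⬝ᵥ y s := by fun_prop
  have hbκ : 0 ≤ b / κ := div_nonneg hb.le hκ.le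
  obtain ⟨N, hN, hNtop⟩ := exists_between h
  have hev := eventually_lt_of_limsup_lt hN
  refine ⟨b / κ * N.toReal, fun T₀ hT₀ => ?_⟩
  -- a near-optimal solution on a horizon `t ≥ T₀` of cost less than `N`
  obtain ⟨t, ht, htT, htpos⟩ := (hev.and ((eventually_ge_atTop T₀).and
    (eventually_gt_atTop 0))).exists
  simp only [optCost, iInf_lt_iff] at ht
  obtain ⟨x, u, hxu, hcost⟩ := ht
  have h0t : (0 : ℝ) ∈ Set.Icc 0 t := Set.left_mem_Icc.2 htpos.le
  obtain ⟨p, q, hpq, hae, -, hp⟩ := hS.exists_trajectory (isTimeInterval_Icc htpos) hxu.1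
  have hyp : ∀ s ∈ Set.Icc 0 t, T.toRows₂ *ᵥ p s = y s := fun s hs =>
    hT.toRows₂_eq hpq hy (by rw [hp 0 h0t, hxu.2, h0]) hs.1 (Set.Icc_subset_Icc_right hs.2)
  have hpt : ∀ s ∈ Set.Icc 0 t, ENNReal.ofReal (y s ⬝ᵥ y s) ≤
      ENNReal.ofReal (b / κ) * ENNReal.ofReal (runningCost S Q R (p s) (q s)) := by
    intro s hs
    rw [← ENNReal.ofReal_mul hbκ, ← hyp s hs]
    refine ENNReal.ofReal_le_ofReal ?_
    have h1 := hbT (p s)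
    rw [← Matrix.mulVec_mulVec, dotProduct_transpose_mulVec] at h1
    refine h1.trans ?_
    rw [div_mul_eq_mul_div, le_div_iff₀ hκ, mul_assoc, mul_comm _ κ]
    exact mul_le_mul_of_nonneg_left (hcoer (p s) (q s)) hb.le
  have hrc : ∫⁻ s in Set.Icc 0 t, ENNReal.ofReal (runningCost S Q R (p s) (q s)) ≤ N := by
    rw [← lintegral_cost_eq hae]
    exact le_add_self.trans hcost.le
  have hle : ∫⁻ s in Set.Icc 0 T₀, ENNReal.ofReal (y s ⬝ᵥ y s) ≤ ENNReal.ofReal (b / κ) * N :=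
    (lintegral_mono_set (Set.Icc_subset_Icc_right htT)).trans
      ((setLIntegral_mono' measurableSet_Icc hpt).trans (by
        rw [lintegral_const_mul' _ _ ENNReal.ofReal_ne_top]
        exact mul_le_mul_right hrc _))
  rw [intervalIntegral.integral_of_le hT₀, ← integral_Icc_eq_integral_Ioc,
    ← ENNReal.ofReal_le_ofReal_iff (mul_nonneg hbκ ENNReal.toReal_nonneg),
    ofReal_integral_eq_lintegral_ofReal hcy.integrableOn_Icc
      (Eventually.of_forall fun s => zero_le_dotProduct_self _),
    ENNReal.ofReal_mul hbκ, ENNReal.ofReal_toReal hNtop.ne]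
  exact hle

theorem OdeLti.IsStabilizabilityBasis.dotProduct_self_le (hT : S.IsStabilizabilityBasis T T') :
    ∃ b : ℝ, 0 < b ∧ ∀ p, p ⬝ᵥ p ≤ b * ((T.toRows₁ *ᵥ p) ⬝ᵥ (T.toRows₁ *ᵥ p) +
      (T.toRows₂ *ᵥ p) ⬝ᵥ (T.toRows₂ *ᵥ p)) := by
  obtain ⟨b, hb, hbT⟩ := exists_le_mul_dotProduct (T'ᵀ * T')
  refine ⟨b, hb, fun p => ?_⟩
  have h1 := hbT (T *ᵥ p)
  rw [← Matrix.mulVec_mulVec, dotProduct_transpose_mulVec, Matrix.mulVec_mulVec, hT.2.1,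
    Matrix.one_mulVec] at h1
  have h2 : (T *ᵥ p) ⬝ᵥ (T *ᵥ p) = (T.toRows₁ *ᵥ p) ⬝ᵥ (T.toRows₁ *ᵥ p) +
      (T.toRows₂ *ᵥ p) ⬝ᵥ (T.toRows₂ *ᵥ p) := by
    simp only [dotProduct, Fintype.sum_sum_type]
    rfl
  rwa [h2] at h1

/-- If the transverse component is square integrable, then the optimal feedback of the stabilizable
part, with this component as disturbance, makes the whole state square integrable, and the state
of the resulting linear system tends to zero. -/
theorem OdeLti.IsAssociated.mem_of_transverse_bound (hS : S.IsAssociated E A B)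
    (hT : S.IsStabilizabilityBasis T T') (hQ : Q.PosDef) (hR : R.PosDef) {p₀ : Fin r → ℝ}
    {y : ℝ → Fin l' → ℝ} (hy : ∀ t, HasDerivAt y ((T.toRows₂ * S.A * T'.toCols₂) *ᵥ y t) t)
    (h0 : y 0 = T.toRows₂ *ᵥ p₀) {C : ℝ}
    (hC : ∀ T₀, 0 ≤ T₀ → ∫ s in (0 : ℝ)..T₀, y s ⬝ᵥ y s ≤ C) :
    p₀ ∈ stabilizabilitySubmodule S := by
  have hG := hS.isRegular_stabilizablePart hT
  obtain ⟨P, ⟨hP, hric⟩, -⟩ := hG.existsUnique_riccati hQ hR hT.exists_tendsto_zero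
  obtain ⟨K, hK⟩ : ∃ K, K = gain (S.stabilizablePart T T') Q R P := ⟨_, rfl⟩
  obtain ⟨p, hp0, hp⟩ := exists_hasDerivAt_linear_at (S.A - S.B * (K * T.toRows₁)) 0 p₀
  have hp' : ∀ t, HasDerivAt p (S.A *ᵥ p t + S.B *ᵥ (-(K *ᵥ (T.toRows₁ *ᵥ p t)))) t := fun t => by
    have := hp t
    rwa [sub_mul_mulVec, ← Matrix.mulVec_mulVec] at this
  have hpc : Continuous p := continuous_iff_continuousAt.2 fun t => (hp t).continuousAt
  have htraj : IsSmoothTrajectory S.A S.B p fun t => -(K *ᵥ (T.toRows₁ *ᵥ p t)) :=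
    ⟨((mulVecCLM K).continuous.comp ((mulVecCLM T.toRows₁).continuous.comp hpc)).neg, hp'⟩
  have hyp : ∀ t, 0 ≤ t → T.toRows₂ *ᵥ p t = y t := fun t ht =>
    hT.toRows₂_eq (htraj.isTrajectory (Set.Ici 0)) hy (by rw [hp0, h0]) ht Set.Icc_subset_Ici_self
  have hpc₁ : Continuous fun t => T.toRows₁ *ᵥ p t := (mulVecCLM T.toRows₁).continuous.comp hpc
  have hpc₂ : Continuous fun t => T.toRows₂ *ᵥ p t := (mulVecCLM T.toRows₂).continuous.comp hpc
  have hyb : ∀ T₀, 0 ≤ T₀ →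
      ∫ s in (0 : ℝ)..T₀, (T.toRows₂ *ᵥ p s) ⬝ᵥ (T.toRows₂ *ᵥ p s) ≤ C := by
    intro T₀ hT₀
    refine le_trans (le_of_eq (intervalIntegral.integral_congr fun s hs => ?_)) (hC T₀ hT₀)
    rw [Set.uIcc_of_le hT₀] at hs
    simp only [hyp s hs.1]
  have hder : ∀ t, HasDerivAt (fun t => T.toRows₁ *ᵥ p t)
      (((S.stabilizablePart T T').A - (S.stabilizablePart T T').B * K) *ᵥ (T.toRows₁ *ᵥ p t) +
        (T.toRows₁ * S.A * T'.toCols₂) *ᵥ (T.toRows₂ *ᵥ p t)) t := fun t => by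
    refine (hasDerivAt_mulVec T.toRows₁ (hp' t)).congr_deriv ?_
    have h1 : S.A *ᵥ p t = S.A *ᵥ (T'.toCols₁ *ᵥ (T.toRows₁ *ᵥ p t)) +
        S.A *ᵥ (T'.toCols₂ *ᵥ (T.toRows₂ *ᵥ p t)) := by
      rw [← Matrix.mulVec_add, hT.decomp_mulVec]
    rw [sub_mul_mulVec, stabilizablePart_A, stabilizablePart_B, h1]
    simp only [Matrix.mulVec_add, ← Matrix.mulVec_mulVec]
    abel
  rw [hK] at hder
  obtain ⟨C', hC'⟩ := hG.exists_integral_bound hQ hR hP hric (T.toRows₁ * S.A * T'.toCols₂)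
    hpc₂ hder hyb
  obtain ⟨b, hb, hbT⟩ := hT.dotProduct_self_le
  refine ⟨p, _, htraj.isTrajectory _, hp0,
    tendsto_zero_of_linear hp (C := b * (C' + C)) fun T₀ hT₀ => ?_⟩
  have hc0 : Continuous fun s => p s ⬝ᵥ p s := by fun_prop
  have hc1 : Continuous fun s => (T.toRows₁ *ᵥ p s) ⬝ᵥ (T.toRows₁ *ᵥ p s) :=
    hpc₁.dotProduct hpc₁
  have hc2 : Continuous fun s => (T.toRows₂ *ᵥ p s) ⬝ᵥ (T.toRows₂ *ᵥ p s) :=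
    hpc₂.dotProduct hpc₂
  have h1 := intervalIntegral.integral_mono_on (μ := volume) hT₀ (hc0.intervalIntegrable 0 T₀)
    (((hc1.fun_add hc2).const_mul b).intervalIntegrable 0 T₀) fun s _ => hbT (p s)
  rw [intervalIntegral.integral_const_mul, intervalIntegral.integral_add
    (hc1.intervalIntegrable 0 T₀) (hc2.intervalIntegrable 0 T₀)] at h1
  exact h1.trans (mul_le_mul_of_nonneg_left (add_le_add (hC' T₀ hT₀) (hyb T₀ hT₀)) hb.le)

theorem OdeLti.IsAssociated.mem_of_optCostInf_lt_top (hS : S.IsAssociated E A B)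
    (hQ : Q.PosDef) (hR : R.PosDef) {z : Fin c → ℝ}
    (h : optCostInf E A B Q R Q₀ z < ⊤) :
    stateMap E S *ᵥ z ∈ stabilizabilitySubmodule S := by
  obtain ⟨l, l', T, T', hT⟩ := exists_isStabilizabilityBasis S
  obtain ⟨y, hy0, hy⟩ := exists_hasDerivAt_linear_at (T.toRows₂ * S.A * T'.toCols₂) 0
    (T.toRows₂ *ᵥ (stateMap E S *ᵥ z))
  obtain ⟨C, hC⟩ := hS.exists_transverse_bound hT hQ hR h hy hy0
  exact hS.mem_of_transverse_bound hT hQ hR hy hy0 hC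

theorem OdeLti.IsAssociated.mem_of_stabilizable (hS : S.IsAssociated E A B) {z : Fin c → ℝ}
    (h : BehaviorallyStabilizable E A B z) :
    stateMap E S *ᵥ z ∈ stabilizabilitySubmodule S := by
  obtain ⟨x, u, hxu, hlim⟩ := h
  obtain ⟨p, q, hpq, -, -, hp⟩ := hS.exists_trajectory (isTimeInterval_Ici 0) hxu.1
  refine ⟨p, q, hpq, by rw [hp 0 Set.self_mem_Ici, hxu.2], ?_⟩
  have h1 : Tendsto (fun t => stateMap E S *ᵥ (E *ᵥ x t)) atTop (𝓝 0) := by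
    have hc : Continuous fun w : Fin n → ℝ => stateMap E S *ᵥ (E *ᵥ w) := by fun_prop
    simpa [Function.comp_def] using (hc.tendsto 0).comp hlim
  refine h1.congr' ?_
  filter_upwards [eventually_ge_atTop 0] with t ht using (hp t ht).symm

end Correspondence

/-! ### Optimality of the closed loop -/

section Optimality

variable {c r k n m l l' : ℕ} {E A : Matrix (Fin c) (Fin n) ℝ} {B : Matrix (Fin c) (Fin m) ℝ}
  {S : OdeLti r k n m} {I : Set ℝ} {x : ℝ → Fin n → ℝ} {u : ℝ → Fin m → ℝ}
  {Q : Matrix (Fin n) (Fin n) ℝ} {R : Matrix (Fin m) (Fin m) ℝ} {Q₀ : Matrix (Fin c) (Fin c) ℝ}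
  {T : Matrix (Fin l ⊕ Fin l') (Fin r) ℝ} {T' : Matrix (Fin r) (Fin l ⊕ Fin l') ℝ}
  {G : OdeLti l k n m} {K : Matrix (Fin k) (Fin l) ℝ} {P : Matrix (Fin l) (Fin l) ℝ}
  {v₀ : Fin l → ℝ} {v : ℝ → Fin l → ℝ} {z : Fin c → ℝ}

theorem IsSolution.mono (h : IsSolution E A B I x u) {J : Set ℝ} (hJ : J ⊆ I) :
    IsSolution E A B J x u :=
  ⟨h.1.mono_set hJ, h.2.mono_set hJ, h.3.mono hJ, fun a ha b hb => h.4 a (hJ ha) b (hJ hb)⟩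

theorem sumElim_closedLoop (G : OdeLti l k n m) (K : Matrix (Fin k) (Fin l) ℝ)
    (v : ℝ → Fin l → ℝ) (t : ℝ) :
    Sum.elim (closedLoopState G K v t) (closedLoopInput G K v t) =
      G.C *ᵥ v t + G.D *ᵥ (-(K *ᵥ v t)) :=
  (sumElim_eq_iff _ _ _ _ _ _).2 ⟨sub_mul_mulVec _ _ _ _, sub_mul_mulVec _ _ _ _⟩

/-- The closed loop output is a solution of the DAE-LTI with the prescribed initial state. -/
theorem OdeLti.IsAssociated.isSolutionFrom_closedLoop (hS : S.IsAssociated E A B)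
    (hT : S.IsStabilizabilityBasis T T') (hz : DifferentiablyConsistent E A B z)
    (hmem : stateMap E S *ᵥ z ∈ stabilizabilitySubmodule S)
    (hv : IsClosedLoop (S.stabilizablePart T T') K (stabilizableStateMap E S T *ᵥ z) v) :
    IsSolutionFrom E A B (Set.Ici 0) z (closedLoopState (S.stabilizablePart T T') K v)
      (closedLoopInput (S.stabilizablePart T T') K v) := by
  obtain ⟨w, hw0, hw, hvw⟩ := hv.exists_extension
  have hI : IsTimeInterval (Set.Ici (0 : ℝ)) := isTimeInterval_Ici 0
  have hwc : Continuous w := continuous_iff_continuousAt.2 fun t => (hw t).continuousAt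
  have hsm : IsSmoothTrajectory (S.stabilizablePart T T').A (S.stabilizablePart T T').B w
      fun t => -(K *ᵥ w t) :=
    ⟨((mulVecCLM K).continuous.comp hwc).neg, fun t => by rw [← sub_mul_mulVec]; exact hw t⟩
  have hsol := hS.isSolution hI (hT.isTrajectory_toCols₁ (hsm.isTrajectory (Set.Ici 0)))
  have hx : ∀ t ∈ Set.Ici (0 : ℝ),
      S.C.toRows₁ *ᵥ (T'.toCols₁ *ᵥ w t) + S.D.toRows₁ *ᵥ (-(K *ᵥ w t)) =
        closedLoopState (S.stabilizablePart T T') K v t := fun t ht => by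
    rw [closedLoopState, hvw t ht, sub_mul_mulVec, Matrix.mulVec_mulVec]; rfl
  have hu : ∀ t ∈ Set.Ici (0 : ℝ),
      S.C.toRows₂ *ᵥ (T'.toCols₁ *ᵥ w t) + S.D.toRows₂ *ᵥ (-(K *ᵥ w t)) =
        closedLoopInput (S.stabilizablePart T T') K v t := fun t ht => by
    rw [closedLoopInput, hvw t ht, sub_mul_mulVec, Matrix.mulVec_mulVec]; rfl
  refine ⟨hsol.congr_ae hI ((ae_restrict_mem measurableSet_Ici).mono hx)
    ((ae_restrict_mem measurableSet_Ici).mono hu)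
    ((hsol.absolutelyContinuous.continuousOn hI).congr fun t ht => ?_), ?_⟩
  · simp only [hx t ht]
  · have h1 := hT.decomp_mulVec (stateMap E S *ᵥ z)
    rw [(hT.mem_iff _).1 hmem, Matrix.mulVec_zero, add_zero] at h1
    rw [← hx 0 Set.self_mem_Ici, hS.mul_output, hw0, stabilizableStateMap_eq,
      ← Matrix.mulVec_mulVec z, h1, hS.mulVec_stateMap hz]

theorem IsClosedLoop.cost_eq (hv : IsClosedLoop G (gain G Q R P) v₀ v) (hG : G.IsRegular)
    (hQ : Q.PosDef) (hR : R.PosDef) (hP : P.PosDef) (hric : riccati G Q R P = 0)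
    (E : Matrix (Fin c) (Fin n) ℝ) {t : ℝ} (ht : 0 ≤ t) :
    cost E Q R Q₀ t (closedLoopState G (gain G Q R P) v) (closedLoopInput G (gain G Q R P) v) =
      ENNReal.ofReal ((E *ᵥ closedLoopState G (gain G Q R P) v t) ⬝ᵥ
        (Q₀ *ᵥ (E *ᵥ closedLoopState G (gain G Q R P) v t))) +
      ENNReal.ofReal (v₀ ⬝ᵥ (P *ᵥ v₀) - v t ⬝ᵥ (P *ᵥ v t)) := by
  obtain ⟨w, hw0, hw, hvw⟩ := hv.exists_extension
  rw [cost, lintegral_cost_eq (G := G) (p := v) (q := fun s => -(gain G Q R P *ᵥ v s))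
    (Eventually.of_forall fun s => sumElim_closedLoop _ _ _ _),
    setLIntegral_congr_fun (g := fun s => ENNReal.ofReal
      (runningCost G Q R (w s) (-(gain G Q R P *ᵥ w s)))) measurableSet_Icc
      (fun s hs => by simp only [hvw s hs.1]),
    hG.lintegral_closedLoop hQ hR hP hric hw ht, hw0, hvw t ht]

theorem IsClosedLoop.tendsto_zero (hv : IsClosedLoop G (gain G Q R P) v₀ v) (hG : G.IsRegular)
    (hQ : Q.PosDef) (hR : R.PosDef) (hP : P.PosDef) (hric : riccati G Q R P = 0) :
    Tendsto v atTop (𝓝 0) := by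
  obtain ⟨w, -, hw, hvw⟩ := hv.exists_extension
  refine (hG.tendsto_zero hQ hR hP hric hw).congr' ?_
  filter_upwards [eventually_ge_atTop 0] with t ht using (hvw t ht).symm

theorem tendsto_closedLoopState (h : Tendsto v atTop (𝓝 0)) :
    Tendsto (closedLoopState G K v) atTop (𝓝 0) := by
  have hc : Continuous fun p : Fin l → ℝ => (G.C.toRows₁ - G.D.toRows₁ * K) *ᵥ p := by fun_prop
  have h1 := (hc.tendsto 0).comp h
  rwa [Matrix.mulVec_zero] at h1

theorem IsClosedLoop.costInf_eq (hv : IsClosedLoop G (gain G Q R P) v₀ v) (hG : G.IsRegular)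
    (hQ : Q.PosDef) (hR : R.PosDef) (hP : P.PosDef) (hric : riccati G Q R P = 0)
    (E : Matrix (Fin c) (Fin n) ℝ) :
    costInf E Q R Q₀ (closedLoopState G (gain G Q R P) v) (closedLoopInput G (gain G Q R P) v) =
      ENNReal.ofReal (v₀ ⬝ᵥ (P *ᵥ v₀)) := by
  have hv0 := hv.tendsto_zero hG hQ hR hP hric
  have hx0 := tendsto_closedLoopState (G := G) (K := gain G Q R P) hv0
  have hc1 : Continuous fun p : Fin n → ℝ => (E *ᵥ p) ⬝ᵥ (Q₀ *ᵥ (E *ᵥ p)) := by fun_prop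
  have hc2 : Continuous fun p : Fin l → ℝ => v₀ ⬝ᵥ (P *ᵥ v₀) - p ⬝ᵥ (P *ᵥ p) := by fun_prop
  have h1 := ENNReal.tendsto_ofReal ((hc1.tendsto 0).comp hx0)
  have h2 := ENNReal.tendsto_ofReal ((hc2.tendsto 0).comp hv0)
  have h3 := h1.add h2
  simp only [Matrix.mulVec_zero, dotProduct_zero, ENNReal.ofReal_zero, sub_zero, zero_add] at h3
  refine Tendsto.limsup_eq (h3.congr' ?_)
  filter_upwards [eventually_ge_atTop 0] with t ht
  exact (hv.cost_eq hG hQ hR hP hric E ht).symm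

/-- The optimal costs over the finite horizons are bounded below by the optimal cost over the
infinite horizon times a factor that tends to one. -/
theorem OdeLti.IsAssociated.le_optCost (hS : S.IsAssociated E A B)
    (hT : S.IsStabilizabilityBasis T T') (hQ : Q.PosDef) (hR : R.PosDef) (hP : P.PosDef)
    (hric : riccati (S.stabilizablePart T T') Q R P = 0)
    (hmem : stateMap E S *ᵥ z ∈ stabilizabilitySubmodule S)
    (hv₀ : v₀ = stabilizableStateMap E S T *ᵥ z) :
    ∃ κ : ℝ, 0 < κ ∧ ∀ t, 0 < t → ENNReal.ofReal ((v₀ ⬝ᵥ (P *ᵥ v₀)) * (t / (κ + t))) ≤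
      optCost E A B Q R Q₀ z t := by
  obtain ⟨κ, hκ, hle⟩ := (hS.isRegular_stabilizablePart hT).exists_cost_lower_bound hQ hR hP hric
  refine ⟨κ, hκ, fun t ht => le_iInf fun x => le_iInf fun u => le_iInf fun hxu => ?_⟩
  obtain ⟨v, q, hvq, hv0, hae, -⟩ := hS.exists_stabilizable_trajectory hT (isTimeInterval_Icc ht)
    Set.Icc_subset_Ici_self (Set.left_mem_Icc.2 ht.le) hxu hmem
  have := hle t v q ht hvq
  rw [hv0, ← hv₀, ← lintegral_cost_eq hae] at this
  exact this.trans le_add_self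

/-- The optimal costs over the finite horizons lie between the costs of the closed loop and the
lower bounds `le_optCost`, and both converge to the value `⟨v₀, P v₀⟩`. -/
theorem OdeLti.IsAssociated.optCostInf_eq (hS : S.IsAssociated E A B)
    (hT : S.IsStabilizabilityBasis T T') (hQ : Q.PosDef) (hR : R.PosDef) (hP : P.PosDef)
    (hric : riccati (S.stabilizablePart T T') Q R P = 0)
    (hz : DifferentiablyConsistent E A B z)
    (hmem : stateMap E S *ᵥ z ∈ stabilizabilitySubmodule S)
    (hv₀ : v₀ = stabilizableStateMap E S T *ᵥ z) :
    optCostInf E A B Q R Q₀ z = ENNReal.ofReal (v₀ ⬝ᵥ (P *ᵥ v₀)) := by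
  have hG := hS.isRegular_stabilizablePart hT
  obtain ⟨v, hv⟩ := exists_isClosedLoop (S.stabilizablePart T T')
    (gain (S.stabilizablePart T T') Q R P) (stabilizableStateMap E S T *ᵥ z)
  have hsol := hS.isSolutionFrom_closedLoop hT hz hmem hv
  refine le_antisymm ?_ ?_
  · rw [hv₀, ← hv.costInf_eq (Q₀ := Q₀) hG hQ hR hP hric E]
    refine limsup_le_limsup ?_
    filter_upwards [eventually_gt_atTop 0] with t ht
    exact iInf_le_of_le _ (iInf_le_of_le _ (iInf_le_of_le
      ⟨hsol.1.mono Set.Icc_subset_Ici_self, hsol.2⟩ le_rfl))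
  · obtain ⟨κ, hκ, hle⟩ := hS.le_optCost (Q₀ := Q₀) hT hQ hR hP hric hmem hv₀
    have h1 : Tendsto (fun t : ℝ => t / (κ + t)) atTop (𝓝 1) := by
      have h2 : Tendsto (fun t : ℝ => 1 - κ / (κ + t)) atTop (𝓝 (1 - 0)) :=
        tendsto_const_nhds.sub ((tendsto_atTop_add_const_left _ κ tendsto_id).const_div_atTop κ)
      rw [sub_zero] at h2
      refine h2.congr' ?_
      filter_upwards [eventually_gt_atTop 0] with t ht
      have : κ + t ≠ 0 := by positivity
      field_simp
      ring
    have h3 := ENNReal.tendsto_ofReal (h1.const_mul (v₀ ⬝ᵥ (P *ᵥ v₀)))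
    rw [mul_one] at h3
    rw [← h3.limsup_eq]
    refine limsup_le_limsup ?_
    filter_upwards [eventually_gt_atTop 0] with t ht using hle t ht

theorem OdeLti.IsAssociated.isOptimal_closedLoop (hS : S.IsAssociated E A B)
    (hT : S.IsStabilizabilityBasis T T') (hQ : Q.PosDef) (hR : R.PosDef) (hP : P.PosDef)
    (hric : riccati (S.stabilizablePart T T') Q R P = 0)
    (hz : DifferentiablyConsistent E A B z)
    (hmem : stateMap E S *ᵥ z ∈ stabilizabilitySubmodule S)
    (hv : IsClosedLoop (S.stabilizablePart T T') (gain (S.stabilizablePart T T') Q R P)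
      (stabilizableStateMap E S T *ᵥ z) v) :
    IsOptimal E A B Q R Q₀ z
      (closedLoopState (S.stabilizablePart T T') (gain (S.stabilizablePart T T') Q R P) v)
      (closedLoopInput (S.stabilizablePart T T') (gain (S.stabilizablePart T T') Q R P) v) := by
  have hval := hS.optCostInf_eq (Q₀ := Q₀) hT hQ hR hP hric hz hmem rfl
  refine ⟨hS.isSolutionFrom_closedLoop hT hz hmem hv, ?_, hval ▸ ENNReal.ofReal_lt_top⟩
  rw [hval, hv.costInf_eq (hS.isRegular_stabilizablePart hT) hQ hR hP hric]

/-! ### The feedback law and the constrained system -/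

theorem mulVec_closedLoopState {Mg : Matrix (Fin l) (Fin c) ℝ}
    (h1 : Mg * (E * G.C.toRows₁) = 1) (h2 : E * G.D.toRows₁ = 0) (v : ℝ → Fin l → ℝ) (t : ℝ) :
    Mg *ᵥ (E *ᵥ closedLoopState G K v t) = v t := by
  rw [closedLoopState, Matrix.mulVec_mulVec (v t) E, Matrix.mul_sub, ← Matrix.mul_assoc E, h2,
    Matrix.zero_mul, sub_zero, Matrix.mulVec_mulVec, h1, Matrix.one_mulVec]

/-- The algebraic constraint says that `(x, u)` is the closed loop output for the state
`Mg E x`. -/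
theorem constraint_iff {Mg : Matrix (Fin l) (Fin c) ℝ} (x : Fin n → ℝ) (u : Fin m → ℝ) :
    constraintState E G Mg K *ᵥ x + constraintInput n m *ᵥ u = 0 ↔
      Sum.elim x u = G.C *ᵥ (Mg *ᵥ (E *ᵥ x)) + G.D *ᵥ (-(K *ᵥ (Mg *ᵥ (E *ᵥ x)))) := by
  have h : constraintInput n m *ᵥ u = Matrix.fromRows 1 0 *ᵥ x - Sum.elim x u := by
    rw [constraintInput, Matrix.fromRows_mulVec, Matrix.fromRows_mulVec]
    ext (i | i) <;> simp [Matrix.neg_mulVec]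
  rw [h, constraintState, Matrix.sub_mulVec, ← Matrix.mulVec_mulVec, ← Matrix.mulVec_mulVec,
    sub_add_sub_cancel, sub_mul_mulVec, sub_eq_zero, eq_comm]

/-- The constrained system has at most one solution: the constraint turns the trajectory that
produces a solution into a trajectory of the closed loop. -/
theorem OdeLti.IsAssociated.ae_eq_closedLoop (hS : S.IsAssociated E A B)
    (hT : S.IsStabilizabilityBasis T T')
    (hmem : stateMap E S *ᵥ z ∈ stabilizabilitySubmodule S)
    (hv : IsClosedLoop (S.stabilizablePart T T') K (stabilizableStateMap E S T *ᵥ z) v)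
    (h : IsConstrainedSolutionFrom E A B
      (constraintState E (S.stabilizablePart T T') (stabilizableStateMap E S T) K)
      (constraintInput n m) z x u) :
    ∀ᵐ t ∂(volume.restrict (Set.Ici (0 : ℝ))),
      x t = closedLoopState (S.stabilizablePart T T') K v t ∧
      u t = closedLoopInput (S.stabilizablePart T T') K v t := by
  obtain ⟨w, hw0, hw, hvw⟩ := hv.exists_extension
  obtain ⟨p, q, hpq, hp0, hae, hp⟩ := hS.exists_stabilizable_trajectory hT (isTimeInterval_Ici 0)
    subset_rfl Set.self_mem_Ici h.1 hmem
  have hcl : ∀ᵐ t ∂(volume.restrict (Set.Ici (0 : ℝ))),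
      Sum.elim (x t) (u t) = (S.stabilizablePart T T').C *ᵥ p t +
        (S.stabilizablePart T T').D *ᵥ (-(K *ᵥ p t)) := by
    filter_upwards [h.2, ae_restrict_mem measurableSet_Ici] with t ht hmem
    have := (constraint_iff _ _).1 ht
    rwa [← hp t hmem] at this
  have hder : ∀ᵐ t ∂(volume.restrict (Set.Ici (0 : ℝ))), HasDerivAt p
      (((S.stabilizablePart T T').A - (S.stabilizablePart T T').B * K) *ᵥ p t) t := by
    filter_upwards [hcl, hae, hpq.2.2] with t h1 h2 h3
    have h4 : (S.stabilizablePart T T').D *ᵥ (q t - -(K *ᵥ p t)) = 0 := by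
      rw [Matrix.mulVec_sub, sub_eq_zero]
      exact add_left_cancel (h2.symm.trans h1)
    have h5 : (S.stabilizablePart T T').B *ᵥ (q t - -(K *ᵥ p t)) = 0 := by
      rcases (hS.isRegular_stabilizablePart hT).feedthrough with hD | hD
      · rw [hD.2, Matrix.zero_mulVec]
      · rw [hD _ h4, Matrix.mulVec_zero]
    rw [Matrix.mulVec_sub, sub_eq_zero] at h5
    rwa [sub_mul_mulVec, ← h5]
  have hpw : ∀ t, 0 ≤ t → p t = v t := fun t ht => by
    rw [hvw t ht]
    refine eq_of_linear ht (hpq.1 0 t ht Set.Icc_subset_Ici_self) ?_ hw (hp0.trans hw0.symm)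
    rw [ae_restrict_iff' measurableSet_Ici] at hder
    filter_upwards [hder] with s hs hmem using hs hmem.1
  filter_upwards [hcl, ae_restrict_mem measurableSet_Ici] with t ht hmem
  rw [hpw t hmem, ← sumElim_closedLoop] at ht
  exact ⟨funext fun i => congrFun ht (Sum.inl i), funext fun i => congrFun ht (Sum.inr i)⟩

end Optimality

/-! ### Existence of associated ODE-LTIs -/

section Existence

theorem exists_mul_eq_of_forall {ι κ μ : Type*} [Fintype ι] [DecidableEq ι] [Fintype μ]
    {X : Matrix κ ι ℝ} {Y : Matrix κ μ ℝ} (h : ∀ v, ∃ a, Y *ᵥ a = X *ᵥ v) :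
    ∃ M : Matrix μ ι ℝ, Y * M = X := by
  choose f hf using fun i => h (Pi.single i 1)
  refine ⟨Matrix.of fun j i => f i j, Matrix.ext_of_mulVec_single fun i => ?_⟩
  rw [← hf i, ← Matrix.mulVec_mulVec, Matrix.mulVec_single_one]
  rfl

/-- A subspace is the range of a matrix whose columns are linearly independent. -/
theorem exists_matrix_range_eq {ι : Type*} [Fintype ι] (U : Submodule ℝ (ι → ℝ)) :
    ∃ (r : ℕ) (X : Matrix ι (Fin r) ℝ), (∀ a, X *ᵥ a = 0 → a = 0) ∧
      ∀ y, y ∈ U ↔ ∃ a, X *ᵥ a = y := by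
  let b := Module.finBasis ℝ U
  have hX : ∀ a : Fin (Module.finrank ℝ U) → ℝ, (Matrix.of fun i j => (b j : ι → ℝ) i) *ᵥ a =
      ((b.equivFun.symm a : U) : ι → ℝ) := fun a => by
    ext i
    simp [Module.Basis.equivFun_symm_apply, Matrix.mulVec, dotProduct, mul_comm]
  refine ⟨_, Matrix.of fun i j => (b j : ι → ℝ) i, fun a ha => ?_, fun y => ⟨fun hy => ?_, ?_⟩⟩
  · rw [hX] at ha
    exact (LinearEquiv.map_eq_zero_iff _).1 (Subtype.ext ha)
  · exact ⟨b.equivFun ⟨y, hy⟩, by rw [hX]; simp⟩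
  · rintro ⟨a, rfl⟩
    rw [hX]
    exact Subtype.coe_prop _

theorem exists_matrix_ker_eq {d : ℕ} (U : Submodule ℝ (Fin d → ℝ)) :
    ∃ M : Matrix (Fin d) (Fin d) ℝ, ∀ y, y ∈ U ↔ M *ᵥ y = 0 := by
  obtain ⟨W, hW⟩ := U.exists_isCompl
  refine ⟨LinearMap.toMatrix' (W.subtype ∘ₗ W.projectionOnto U hW.symm), fun y => ?_⟩
  rw [LinearMap.toMatrix'_mulVec, LinearMap.comp_apply, Submodule.subtype_apply,
    ZeroMemClass.coe_eq_zero, Submodule.projectionOnto_apply_eq_zero_iff]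

theorem rank_eq_of_injective {ι : Type*} [Fintype ι] {r : ℕ} {X : Matrix ι (Fin r) ℝ}
    (h : ∀ a, X *ᵥ a = 0 → a = 0) : X.rank = r := by
  rw [Matrix.rank, LinearMap.finrank_range_of_inj
    ((injective_iff_map_eq_zero X.mulVecLin).2 h), Module.finrank_fin_fun]

/-- If `N V ⊆ F V`, then `V` has a description `V = {C p + D q}` in which `F` determines `p`, and
in which `N` becomes `p ↦ A p + B q`. -/
theorem exists_parametrization {ι : Type*} [Fintype ι] [DecidableEq ι] {c : ℕ}
    (F N : Matrix (Fin c) ι ℝ)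
    (V : Submodule ℝ (ι → ℝ)) (h : V.map N.mulVecLin ≤ V.map F.mulVecLin) :
    ∃ (r k : ℕ) (A : Matrix (Fin r) (Fin r) ℝ) (B : Matrix (Fin r) (Fin k) ℝ)
      (C : Matrix ι (Fin r) ℝ) (D : Matrix ι (Fin k) ℝ),
      (F * C).rank = r ∧ D.rank = k ∧ F * D = 0 ∧ F * C * A = N * C ∧ F * C * B = N * D ∧
      ∀ w ∈ V, ∃ p q, w = C *ᵥ p + D *ᵥ q := by
  obtain ⟨s, X, -, hV⟩ := exists_matrix_range_eq V
  obtain ⟨r, Y, hYinj, hY⟩ := exists_matrix_range_eq (V.map F.mulVecLin)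
  obtain ⟨k, D, hDinj, hD⟩ := exists_matrix_range_eq (V ⊓ F.mulVecLin.ker)
  obtain ⟨L, hL⟩ : ∃ L, F * X * L = Y := exists_mul_eq_of_forall fun v => by
    obtain ⟨w, hw, hwv⟩ := (hY _).2 ⟨v, rfl⟩
    obtain ⟨a, rfl⟩ := (hV w).1 hw
    exact ⟨a, by rw [← Matrix.mulVec_mulVec]; exact hwv⟩
  have hFC : F * (X * L) = Y := by rw [← Matrix.mul_assoc, hL]
  have hN : ∀ w ∈ V, ∃ a, Y *ᵥ a = N *ᵥ w := fun w hw => (hY _).1 (h ⟨w, hw, rfl⟩)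
  have hCV : ∀ p, (X * L) *ᵥ p ∈ V := fun p =>
    (hV _).2 ⟨L *ᵥ p, by rw [Matrix.mulVec_mulVec]⟩
  have hDV : ∀ q, D *ᵥ q ∈ V ⊓ F.mulVecLin.ker := fun q => (hD _).2 ⟨q, rfl⟩
  obtain ⟨A, hA⟩ : ∃ A, Y * A = N * (X * L) := exists_mul_eq_of_forall fun v => by
    rw [← Matrix.mulVec_mulVec]
    exact hN _ (hCV v)
  obtain ⟨B, hB⟩ : ∃ B, Y * B = N * D := exists_mul_eq_of_forall fun v => by
    rw [← Matrix.mulVec_mulVec]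
    exact hN _ (hDV v).1
  refine ⟨r, k, A, B, X * L, D, by rw [hFC, rank_eq_of_injective hYinj],
    rank_eq_of_injective hDinj, ?_, by rw [hFC, hA], by rw [hFC, hB], fun w hw => ?_⟩
  · refine Matrix.ext_of_mulVec_single fun i => ?_
    rw [← Matrix.mulVec_mulVec, Matrix.zero_mulVec]
    exact (hDV _).2
  · obtain ⟨p, hp⟩ := (hY _).1 ⟨w, hw, rfl⟩
    obtain ⟨q, hq⟩ := (hD (w - (X * L) *ᵥ p)).1 ⟨V.sub_mem hw (hCV p), by
      rw [SetLike.mem_coe, LinearMap.mem_ker, Matrix.mulVecLin_apply, Matrix.mulVec_sub,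
        Matrix.mulVec_mulVec, hFC, hp, Matrix.mulVecLin_apply, sub_self]⟩
    exact ⟨p, q, by rw [hq, add_sub_cancel]⟩

variable {c n m : ℕ} {E A : Matrix (Fin c) (Fin n) ℝ} {B : Matrix (Fin c) (Fin m) ℝ}
  {I : Set ℝ} {x : ℝ → Fin n → ℝ} {u : ℝ → Fin m → ℝ}

theorem IsTimeInterval.uniqueDiffOn (hI : IsTimeInterval I) : UniqueDiffOn ℝ I := by
  rcases hI with rfl | ⟨a, rfl⟩ | ⟨a, rfl⟩ | ⟨a, b, hab, rfl⟩
  · exact uniqueDiffOn_univ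
  · exact uniqueDiffOn_Ici a
  · exact uniqueDiffOn_Iic a
  · exact uniqueDiffOn_Icc hab

theorem locallyIntegrableOn_derivative (hI : IsTimeInterval I) (A : Matrix (Fin c) (Fin n) ℝ)
    (B : Matrix (Fin c) (Fin m) ℝ) (hx : LocallyIntegrableOn x I) (hu : LocallyIntegrableOn u I) :
    LocallyIntegrableOn (fun t => A *ᵥ x t + B *ᵥ u t) I :=
  (locallyIntegrableOn_mulVec A hI hx).add (locallyIntegrableOn_mulVec B hI hu)

/-- The differential form of the solution concept. -/
theorem isSolution_iff (hI : IsTimeInterval I) :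
    IsSolution E A B I x u ↔ LocallyIntegrableOn x I ∧ LocallyIntegrableOn u I ∧
      LocallyAC (fun t => E *ᵥ x t) I ∧
      ∀ᵐ t ∂(volume.restrict I), HasDerivAt (fun t => E *ᵥ x t) (A *ᵥ x t + B *ᵥ u t) t := by
  constructor
  · intro h
    have := (hI.locallyAC_iff_integral (locallyIntegrableOn_derivative hI A B h.1 h.2)).2 h.4
    exact ⟨h.1, h.2, this⟩
  · intro ⟨h1, h2, h3⟩
    exact ⟨h1, h2, h3.1,
      (hI.locallyAC_iff_integral (locallyIntegrableOn_derivative hI A B h1 h2)).1 h3⟩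

theorem fromCols_zero_mulVec_sumElim (E : Matrix (Fin c) (Fin n) ℝ) (x : Fin n → ℝ)
    (u : Fin m → ℝ) : Matrix.fromCols E 0 *ᵥ Sum.elim x u = E *ᵥ x := by
  rw [Matrix.fromCols_mulVec_sumElim, Matrix.zero_mulVec, add_zero]

/-- The largest subspace `V` of `ℝⁿ⁺ᵐ` with `[A B] V ⊆ [E 0] V`. -/
noncomputable def consistencySubspace (E A : Matrix (Fin c) (Fin n) ℝ)
    (B : Matrix (Fin c) (Fin m) ℝ) : Submodule ℝ (Fin n ⊕ Fin m → ℝ) :=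
  sSup {V | V.map (Matrix.fromCols A B).mulVecLin ≤
    V.map (Matrix.fromCols E (0 : Matrix (Fin c) (Fin m) ℝ)).mulVecLin}

variable (E A B) in
theorem map_consistencySubspace_le :
    (consistencySubspace E A B).map (Matrix.fromCols A B).mulVecLin ≤
      (consistencySubspace E A B).map (Matrix.fromCols E 0).mulVecLin := by
  rw [Submodule.map_le_iff_le_comap]
  refine sSup_le fun V hV => ?_
  rw [← Submodule.map_le_iff_le_comap]
  exact (show _ ≤ _ from hV).trans (Submodule.map_mono (le_sSup hV))

/-- If a solution takes its values in a subspace `V`, then its derivative is in `[E 0] V`. -/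
theorem IsSolution.ae_mem_map (hI : IsTimeInterval I) (h : IsSolution E A B I x u)
    {V : Submodule ℝ (Fin n ⊕ Fin m → ℝ)}
    (hV : ∀ᵐ t ∂(volume.restrict I), Sum.elim (x t) (u t) ∈ V) :
    ∀ᵐ t ∂(volume.restrict I), A *ᵥ x t + B *ᵥ u t ∈
      V.map (Matrix.fromCols E (0 : Matrix (Fin c) (Fin m) ℝ)).mulVecLin := by
  obtain ⟨M, hM⟩ := exists_matrix_ker_eq
    (V.map (Matrix.fromCols E (0 : Matrix (Fin c) (Fin m) ℝ)).mulVecLin)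
  have h0 : Set.EqOn (fun t => M *ᵥ (E *ᵥ x t)) (fun _ => 0) I := by
    refine Measure.eqOn_of_ae_eq (μ := volume) (hV.mono fun t ht => ?_)
      ((mulVecCLM M).continuous.comp_continuousOn (h.absolutelyContinuous.continuousOn hI))
      continuousOn_const hI.subset_closure_interior
    exact (hM _).1 ⟨_, ht, fromCols_zero_mulVec_sumElim _ _ _⟩
  filter_upwards [((isSolution_iff hI).1 h).2.2.2, ae_restrict_mem hI.isClosed.measurableSet]
    with t ht htI
  rw [hM]
  exact (hI.uniqueDiffOn t htI).eq_deriv I (hasDerivAt_mulVec M ht).hasDerivWithinAt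
    ((hasDerivWithinAt_const t I 0).congr h0 (h0 htI))

/-- The smallest subspace that contains almost all values of a solution satisfies the condition
defining `consistencySubspace`: otherwise `ae_mem_map` would yield a smaller one. -/
theorem IsSolution.ae_mem_consistencySubspace (hI : IsTimeInterval I)
    (h : IsSolution E A B I x u) :
    ∀ᵐ t ∂(volume.restrict I), Sum.elim (x t) (u t) ∈ consistencySubspace E A B := by
  obtain ⟨V, hV, hmin⟩ := WellFounded.has_min
    (wellFounded_lt (α := Submodule ℝ (Fin n ⊕ Fin m → ℝ)))
    {V | ∀ᵐ t ∂(volume.restrict I), Sum.elim (x t) (u t) ∈ V}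
    ⟨⊤, Set.mem_ofPred.2 (Eventually.of_forall fun _ => Submodule.mem_top)⟩
  have hW : ∀ᵐ t ∂(volume.restrict I), Sum.elim (x t) (u t) ∈ V ⊓
      (V.map (Matrix.fromCols E (0 : Matrix (Fin c) (Fin m) ℝ)).mulVecLin).comap
        (Matrix.fromCols A B).mulVecLin := by
    filter_upwards [hV, h.ae_mem_map hI hV] with t h1 h2
    refine ⟨h1, ?_⟩
    rw [SetLike.mem_coe, Submodule.mem_comap, Matrix.mulVecLin_apply,
      Matrix.fromCols_mulVec_sumElim]
    exact h2
  have hVW := eq_of_le_of_not_lt inf_le_left (hmin _ hW)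
  have hle := le_sSup (α := Submodule ℝ (Fin n ⊕ Fin m → ℝ)) (s := {V |
    V.map (Matrix.fromCols A B).mulVecLin ≤
      V.map (Matrix.fromCols E (0 : Matrix (Fin c) (Fin m) ℝ)).mulVecLin})
    (Submodule.map_le_iff_le_comap.2 (inf_eq_left.1 hVW))
  exact (show ∀ᵐ t ∂(volume.restrict I), Sum.elim (x t) (u t) ∈ V from hV).mono fun t ht => hle ht

theorem LocallyAC.locallyIntegrableOn {d : ℕ} {f : ℝ → Fin d → ℝ} (hI : IsTimeInterval I)
    (h : LocallyAC f I) : LocallyIntegrableOn f I :=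
  (h.continuousOn hI).locallyIntegrableOn hI.isClosed.measurableSet

variable (E A B) in
/-- Coordinates on `consistencySubspace` given by `exists_parametrization` form an associated
ODE-LTI: the state `p` is read off from `E x`, and the input `q` is the rest of `(x, u)`. -/
theorem exists_isAssociated : ∃ (r k : ℕ) (S : OdeLti r k n m), S.IsAssociated E A B := by
  obtain ⟨r, k, Al, Bl, C, D, hFC, hD, hFD, hA, hB, hV⟩ :=
    exists_parametrization _ _ _ (map_consistencySubspace_le E A B)
  rw [fromCols_zero_mul] at hFC hFD hA hB
  have hN : ∀ p q, (E * C.toRows₁) *ᵥ (Al *ᵥ p + Bl *ᵥ q) =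
      A *ᵥ (C.toRows₁ *ᵥ p + D.toRows₁ *ᵥ q) + B *ᵥ (C.toRows₂ *ᵥ p + D.toRows₂ *ᵥ q) :=
    fun p q => by
    rw [Matrix.mulVec_add, Matrix.mulVec_mulVec, Matrix.mulVec_mulVec, hA, hB,
      ← Matrix.mulVec_mulVec, ← Matrix.mulVec_mulVec, ← Matrix.mulVec_add, ← sumElim_mulVec_add,
      Matrix.fromCols_mulVec_sumElim]
  obtain ⟨Λ, hΛ⟩ := exists_left_inverse_of_rank_eq hFC
  obtain ⟨Δ, hΔ⟩ := exists_left_inverse_of_rank_eq hD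
  have hE : ∀ p q, E *ᵥ (C.toRows₁ *ᵥ p + D.toRows₁ *ᵥ q) = (E * C.toRows₁) *ᵥ p := fun p q => by
    rw [Matrix.mulVec_add, Matrix.mulVec_mulVec, Matrix.mulVec_mulVec, hFD, Matrix.zero_mulVec,
      add_zero]
  refine ⟨r, k, ⟨Al, Bl, C, D⟩, ?_, .inr hD, hFD, hFC, fun I hI => ⟨fun x u h => ?_, ?_⟩⟩
  · calc r = (E * C.toRows₁).rank := hFC.symm
      _ ≤ n := (Matrix.rank_mul_le_left _ _).trans (Matrix.rank_le_width E)
  · have hsol := (isSolution_iff hI).1 h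
    obtain ⟨p, hp⟩ : ∃ p, p = fun t => Λ *ᵥ (E *ᵥ x t) := ⟨_, rfl⟩
    obtain ⟨q, hq⟩ : ∃ q, q = fun t => Δ *ᵥ (Sum.elim (x t) (u t) - C *ᵥ p t) := ⟨_, rfl⟩
    have hpac : LocallyAC p I := hp ▸ hsol.2.2.1.mulVec Λ
    have hpq : ∀ᵐ t ∂(volume.restrict I), Sum.elim (x t) (u t) = C *ᵥ p t + D *ᵥ q t := by
      filter_upwards [h.ae_mem_consistencySubspace hI] with t ht
      obtain ⟨a, b, hab⟩ := hV _ ht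
      have ha : p t = a := by
        rw [hp]
        simp only [((sumElim_eq_iff _ _ _ _ _ _).1 hab).1, hE]
        rw [Matrix.mulVec_mulVec, hΛ, Matrix.one_mulVec]
      have hb : q t = b := by
        rw [hq]
        simp only [ha, hab, add_sub_cancel_left]
        rw [Matrix.mulVec_mulVec, hΔ, Matrix.one_mulVec]
      rw [ha, hb, hab]
    have hw : LocallyIntegrableOn (fun t => Sum.elim (x t) (u t)) I := by
      have h1 := (locallyIntegrableOn_mulVec (Matrix.fromRows (1 : Matrix (Fin n) (Fin n) ℝ)
        (0 : Matrix (Fin m) (Fin n) ℝ)) hI h.1).add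
        (locallyIntegrableOn_mulVec (Matrix.fromRows (0 : Matrix (Fin n) (Fin m) ℝ)
        (1 : Matrix (Fin m) (Fin m) ℝ)) hI h.2)
      refine locallyIntegrableOn_congr_ae hI h1 (Eventually.of_forall fun t => ?_)
      ext (i | i) <;> simp
    refine ⟨p, q, ⟨hpac, hq ▸ locallyIntegrableOn_mulVec Δ hI
      (hw.sub (locallyIntegrableOn_mulVec C hI (hpac.locallyIntegrableOn hI))), ?_⟩, hpq⟩
    filter_upwards [hsol.2.2.2, hpq] with t h1 h2
    have h3 := (sumElim_eq_iff _ _ _ _ _ _).1 h2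
    rw [h3.1, h3.2, ← hN] at h1
    have h4 := hasDerivAt_mulVec Λ h1
    rwa [Matrix.mulVec_mulVec, hΛ, Matrix.one_mulVec, ← hp] at h4
  · intro p q h
    have hp := h.1.locallyIntegrableOn hI
    refine ⟨fun t => C.toRows₁ *ᵥ p t + D.toRows₁ *ᵥ q t,
      fun t => C.toRows₂ *ᵥ p t + D.toRows₂ *ᵥ q t, (isSolution_iff hI).2
      ⟨locallyIntegrableOn_derivative hI _ _ hp h.2.1,
        locallyIntegrableOn_derivative hI _ _ hp h.2.1, ?_, ?_⟩,
      Eventually.of_forall fun t => sumElim_mulVec_add _ _ _ _⟩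
    · simp only [hE]
      exact h.1.mulVec _
    · filter_upwards [h.2.2] with t ht
      simp only [hE, ← hN]
      exact hasDerivAt_mulVec _ ht

end Existence

end DaeLQ

theorem mainTheorem1 {c n m : ℕ}
    (E A : Matrix (Fin c) (Fin n) ℝ) (B : Matrix (Fin c) (Fin m) ℝ)
    (Q : Matrix (Fin n) (Fin n) ℝ) (R : Matrix (Fin m) (Fin m) ℝ) (Q₀ : Matrix (Fin c) (Fin c) ℝ)
    (hQ : Q.PosDef) (hR : R.PosDef) (hQ₀ : Q₀.PosSemidef)
    (z : Fin c → ℝ) (hz : DifferentiablyConsistent E A B z) :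
    [Solvable E A B Q R Q₀ z,
      BehaviorallyStabilizable E A B z,
      optCostInf E A B Q R Q₀ z < ⊤].TFAE ∧
    (∃ (r k : ℕ) (S : OdeLti r k n m), S.IsAssociated E A B) ∧
    ∀ (r k : ℕ) (S : OdeLti r k n m), S.IsAssociated E A B →
      (∃ (l l' : ℕ) (T : Matrix (Fin l ⊕ Fin l') (Fin r) ℝ)
        (T' : Matrix (Fin r) (Fin l ⊕ Fin l') ℝ), S.IsStabilizabilityBasis T T') ∧
      ∀ (l l' : ℕ) (T : Matrix (Fin l ⊕ Fin l') (Fin r) ℝ)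
        (T' : Matrix (Fin r) (Fin l ⊕ Fin l') ℝ), S.IsStabilizabilityBasis T T' →
        let G := S.stabilizablePart T T'
        let Mg := stabilizableStateMap E S T
        (∃! P : Matrix (Fin l) (Fin l) ℝ, P.PosDef ∧ IsRiccatiSolution G Q R P) ∧
        ∀ P : Matrix (Fin l) (Fin l) ℝ, P.PosDef → IsRiccatiSolution G Q R P →
          let K := gain G Q R P
          (∃ v, IsClosedLoop G K (Mg *ᵥ z) v) ∧
          ∀ v, IsClosedLoop G K (Mg *ᵥ z) v →
            (Solvable E A B Q R Q₀ z ∨ BehaviorallyStabilizable E A B z ∨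
              optCostInf E A B Q R Q₀ z < ⊤) →
            let x := closedLoopState G K v
            let u := closedLoopInput G K v
            let K₁ := constraintState E G Mg K
            let K₂ := constraintInput n m
            IsOptimal E A B Q R Q₀ z x u ∧
            optCostInf E A B Q R Q₀ z = costInf E Q R Q₀ x u ∧
            costInf E Q R Q₀ x u =
              ENNReal.ofReal ((Mg *ᵥ z) ⬝ᵥ (P *ᵥ (Mg *ᵥ z))) ∧
            (∀ t, 0 ≤ t → u t = feedbackMatrix E G Mg K *ᵥ x t) ∧
            IsConstrainedSolutionFrom E A B K₁ K₂ z x u ∧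
            ∀ x' u', IsConstrainedSolutionFrom E A B K₁ K₂ z x' u' →
              ∀ᵐ t ∂(MeasureTheory.volume.restrict (Set.Ici (0 : ℝ))), x' t = x t ∧ u' t = u t := by
  have hmem : ∀ {r k : ℕ} {S : OdeLti r k n m}, S.IsAssociated E A B →
      (Solvable E A B Q R Q₀ z ∨ BehaviorallyStabilizable E A B z ∨
        optCostInf E A B Q R Q₀ z < ⊤) → stateMap E S *ᵥ z ∈ stabilizabilitySubmodule S := by
    rintro r k S hS (⟨x, u, h⟩ | h | h)
    · exact hS.mem_of_optCostInf_lt_top hQ hR h.2.2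
    · exact hS.mem_of_stabilizable h
    · exact hS.mem_of_optCostInf_lt_top hQ hR h
  refine ⟨?_, exists_isAssociated E A B, fun r k S hS => ⟨exists_isStabilizabilityBasis S,
    fun l l' T T' hT => ?_⟩⟩
  · -- the closed loop is both optimal and stabilizing, so that each condition yields the others
    have hback : (Solvable E A B Q R Q₀ z ∨ BehaviorallyStabilizable E A B z ∨
        optCostInf E A B Q R Q₀ z < ⊤) →
        Solvable E A B Q R Q₀ z ∧ BehaviorallyStabilizable E A B z := by
      intro h
      obtain ⟨r, k, S, hS⟩ := exists_isAssociated E A B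
      obtain ⟨l, l', T, T', hT⟩ := exists_isStabilizabilityBasis S
      have hG := hS.isRegular_stabilizablePart hT
      obtain ⟨P, ⟨hP, hric⟩, -⟩ := hG.existsUnique_riccati hQ hR hT.exists_tendsto_zero
      obtain ⟨v, hv⟩ := exists_isClosedLoop (S.stabilizablePart T T')
        (gain (S.stabilizablePart T T') Q R P) (stabilizableStateMap E S T *ᵥ z)
      have hopt := hS.isOptimal_closedLoop (Q₀ := Q₀) hT hQ hR hP hric hz (hmem hS h) hv
      exact ⟨⟨_, _, hopt⟩, _, _, hopt.1,
        tendsto_closedLoopState (hv.tendsto_zero hG hQ hR hP hric)⟩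
    tfae_have 1 → 3 := fun ⟨_, _, h⟩ => h.2.2
    tfae_have 3 → 2 := fun h => (hback (.inr (.inr h))).2
    tfae_have 2 → 1 := fun h => (hback (.inr (.inl h))).1
    tfae_finish
  · have hG := hS.isRegular_stabilizablePart hT
    refine ⟨hG.existsUnique_riccati hQ hR hT.exists_tendsto_zero, fun P hP hric =>
      ⟨exists_isClosedLoop _ _ _, fun v hv h => ?_⟩⟩
    have hz' := hmem hS h
    have hopt := hS.isOptimal_closedLoop (Q₀ := Q₀) hT hQ hR hP hric hz hz' hv
    have hx : ∀ t, stabilizableStateMap E S T *ᵥ (E *ᵥ closedLoopState (S.stabilizablePart T T')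
        (gain (S.stabilizablePart T T') Q R P) v t) = v t :=
      mulVec_closedLoopState (hS.stabilizableStateMap_mul hT) hS.mul_feedthrough v
    refine ⟨hopt, hopt.2.1.symm, hv.costInf_eq hG hQ hR hP hric E, fun t _ => ?_,
      ⟨hopt.1, Eventually.of_forall fun t => ?_⟩,
      fun x' u' h' => hS.ae_eq_closedLoop hT hz' hv h'⟩
    · rw [feedbackMatrix, ← Matrix.mulVec_mulVec, ← Matrix.mulVec_mulVec, hx]
      rfl
    · rw [constraint_iff, hx, sumElim_closedLoop]
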